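/- **Setting.** Let $\beta>0$, $h>0$, $\mathrm{Th}(x)=\tanh(h+\beta x)$, and let $q\ge 0$ be the solution of $q=E\tanh^2(h+\beta\sqrt q\,Z)$; $Z,Z',Z''$ denote independent standard Gaussian variables. Put $\psi(t)=E\,\mathrm{Th}(\sqrt t Z+\sqrt{q-t}Z')\,\mathrm{Th}(\sqrt t Z+\sqrt{q-t}Z'')$ for $0\le t\le q$, $\rho_1=\sqrt q\,E\,\mathrm{Th}(\sqrt q Z)$ and $\rho_{k}=\psi(\rho_{k-1})$ for $k\ge 2$. On a probability space let, for each $N\ge1$, $\mathbf g=(g_{ij})$ be a symmetric $N\times N$ matrix with $g_{ii}=0$ and with $g_{ij}$, $i<j$, independent centered Gaussian of variance $1/N$ (the dependence on $N$ is suppressed). For $x,y\in\mathbb R^N$ let $\langle x,y\rangle=\frac1N\sum_i x_iy_i$ and $\|x\|=\sqrt{\langle x,x\rangle}$. Define $\mathbf m^{(0)}=0$, $\mathbf m^{(1)}=\sqrt q\,\mathbf 1$ and, coordinatewise, $\mathbf m^{(k+1)}=\mathrm{Th}\bigl(\mathbf g\mathbf m^{(k)}-\beta(1-q)\mathbf m^{(k-1)}\bigr)$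 for $k\ge1$. Let $\mathbf M^{(k)}$ be the component of $\mathbf m^{(k)}$ orthogonal to $\mathrm{span}(\mathbf m^{(1)},\dots,\mathbf m^{(k-1)})$, and $\phi^{(k)}=\mathbf M^{(k)}/\|\mathbf M^{(k)}\|$, with $\phi^{(k)}=\mathbf 1$ where $\mathbf M^{(k)}=0$. **Modified matrices.** Let $\mathcal F_{-1}=\mathcal F_0$ be the trivial $\sigma$-field, $\mathbf g^{(1)}=\mathbf g$ and, for $k\ge 1$, $$\mathbf g^{(k+1)}=\mathbf g^{(k)}-\pi_k(\mathbf g^{(k)}),\qquad \mathcal F_k=\sigma\bigl(\mathcal F_{k-1},\ \mathbf g^{(k)}\phi^{(k)}\bigr),$$ where $\pi_k$ is the entrywise linear projection, conditionally on $\mathcal F_{k-1}$, onto the space $\mathcal L_k$ of all random variables $\sum_i a_i(\mathbf g^{(k)}\mathbf M^{(k)})_i$ with $\mathcal F_{k-1}$-measurable $a_i$; that is, $\pi_k(g^{(k)}_{ij})\in\mathcal L_k$ and $\mathbb E\bigl[(g^{(k)}_{ij}-\pi_k(g^{(k)}_{ij}))U\mid\mathcal F_{k-1}\bigr]=0$ a.s.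 for every $U\in\mathcal L_k$ for which $(g^{(k)}_{ij}-\pi_k(g^{(k)}_{ij}))U$ is integrable. Write $\mathbb E_k=\mathbb E[\,\cdot\mid\mathcal F_k]$. **Error terms.** For families $X_\iota,Y_\iota$ of random variables, indexed by $N$ and matrix indices, $X_\iota=Y_\iota+O_k(N^{-r})$ means that every $X_\iota-Y_\iota$ is (up to null sets) $\mathcal F_k$-measurable, and that there are constants $C,K>0$, not depending on $N$ or on the indices, with $\mathbb P(N^r|X_\iota-Y_\iota|\ge K)\le Ce^{-N/C}$ for all $N$ and all indices. Write $X_N\simeq Y_N$ if for some $C>0$ one has $\mathbb P(|X_N-Y_N|\ge t)\le C e^{-t^2N/C}$ for all $N$ and all $0<t\le1$. For $J\ge 1$ let $\mathrm{COND}(J)$ be the statement that $\|\mathbf m^{(k)}\|^2\simeq q$ for $1\le k\le J$ and $\langle\mathbf m^{(j)},\mathbf m^{(k)}\rangle\simeq\rho_j$ for $1\le j<k\le J$. **Covariance relations at level $k\ge1$:** 1. $\displaystyle \mathbb E_{k-2}\bigl(g^{(k)}_{ij}\bigr)^2=\frac1N+O_{k-2}(N^{-2})$ for all $i\ne j$;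 2. $\displaystyle \mathbb E_{k-2}\,g^{(k)}_{ij}g^{(k)}_{jt}=-\sum_{m=1}^{k-1}\frac{\phi^{(m)}_i\phi^{(m)}_t}{N^2}+O_{k-2}(N^{-3})$ for all distinct $i,j,t$; 3. $\displaystyle \mathbb E_{k-2}\,g^{(k)}_{ij}g^{(k)}_{st}=\frac{\alpha^{(k)}_{ijst}}{N^3}+O_{k-2}(N^{-4})$ for all distinct $i,j,s,t$, where $$\alpha^{(k)}_{ijst}=\sum_{a,b,c,d=1}^{k-1}\lambda^{(k)}_{abcd}\,\phi^{(a)}_i\phi^{(b)}_j\phi^{(c)}_s\phi^{(d)}_t$$ for some real (non-random) coefficients $\lambda^{(k)}_{abcd}$ that depend neither on $N$ nor on $i,j,s,t$, and with $\lambda^{(k)}_{abcd}=\lambda^{(k)}_{bacd}=\lambda^{(k)}_{abdc}=\lambda^{(k)}_{cdab}$. **Proposition.** Let $J\ge1$. Assume $\mathrm{COND}(J)$, and assume that relations 1, 2, 3 hold at all levels $1\le k\le J$. Then the entries of $\mathbf g^{(J+1)}$ are square integrable, and relations 1, 2, 3 hold at level $k=J+1$. -/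

import Mathlib

open MeasureTheory ProbabilityTheory

namespace TAP

noncomputable section

/-- The standard Gaussian law on the real line. -/
abbrev stdGaussian : Measure ℝ := gaussianReal 0 1

/-- `Th x = tanh (h + β x)`. -/
def Th (β h x : ℝ) : ℝ := Real.tanh (h + β * x)

/-- `q` is a non-negative solution of the fixed point equation
`q = E tanh² (h + β √q Z)`; for `h > 0` there is exactly one. -/
def IsFixedPoint (β h q : ℝ) : Prop :=
  0 ≤ q ∧ q = ∫ z, Real.tanh (h + β * √q * z) ^ 2 ∂stdGaussian

/-- `ψ(t) = E Th(√t Z + √(q-t) Z') Th(√t Z + √(q-t) Z'')`, with independent standard Gaussian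
variables `Z, Z', Z''`. -/
def psi (β h q t : ℝ) : ℝ :=
  ∫ z, ∫ z', ∫ z'', Th β h (√t * z + √(q - t) * z') * Th β h (√t * z + √(q - t) * z'')
    ∂stdGaussian ∂stdGaussian ∂stdGaussian

/-- `ρ₁ = √q · E Th(√q Z)` and `ρ_{k+1} = ψ(ρ_k)` for `k ≥ 1` (the value at `0` is not used). -/
def rho (β h q : ℝ) : ℕ → ℝ
  | 0 => 0
  | 1 => (∫ z, Th β h (√q * z) ∂stdGaussian) * √q
  | k + 2 => psi β h q (rho β h q (k + 1))

/-! ### Vectors in dimension `N` and the iteration -/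

section Iteration

variable {N : ℕ}

/-- The normalized inner product `N⁻¹ ∑ xᵢ yᵢ`. -/
def nInner (x y : EuclideanSpace ℝ (Fin N)) : ℝ := (1 / (N : ℝ)) * ∑ i, x i * y i

/-- The norm of the normalized inner product. -/
def nNorm (x : EuclideanSpace ℝ (Fin N)) : ℝ := √(nInner x x)

/-- The iterates `m⁽ᵏ⁾`, as a function of the interaction matrix `A`:
`m⁽⁰⁾ = 0`, `m⁽¹⁾ = √q 1`, `m⁽ᵏ⁺¹⁾ = Th (A m⁽ᵏ⁾ - β (1 - q) m⁽ᵏ⁻¹⁾)`. -/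
def mIter (β h q : ℝ) (A : Matrix (Fin N) (Fin N) ℝ) : ℕ → EuclideanSpace ℝ (Fin N)
  | 0 => 0
  | 1 => WithLp.toLp 2 (fun _ => √q)
  | k + 2 => WithLp.toLp 2 (fun i =>
      Th β h ((∑ j, A i j * mIter β h q A (k + 1) j) - β * (1 - q) * mIter β h q A k i))

/-- `M⁽ᵏ⁾`: the component of `m⁽ᵏ⁾` orthogonal to the span of `m⁽¹⁾, …, m⁽ᵏ⁻¹⁾`. (Orthogonality
for the normalized and for the Euclidean inner product is the same.) -/
def MIter (β h q : ℝ) (A : Matrix (Fin N) (Fin N) ℝ) (k : ℕ) : EuclideanSpace ℝ (Fin N) :=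
  mIter β h q A k -
    (Submodule.span ℝ (mIter β h q A '' Set.Ico 1 k)).starProjection (mIter β h q A k)

open Classical in
/-- `φ⁽ᵏ⁾ = M⁽ᵏ⁾ / ‖M⁽ᵏ⁾‖`, and the vector with all coordinates `1` where `M⁽ᵏ⁾ = 0`. -/
def phi (β h q : ℝ) (A : Matrix (Fin N) (Fin N) ℝ) (k : ℕ) : EuclideanSpace ℝ (Fin N) :=
  if MIter β h q A k = 0 then WithLp.toLp 2 (fun _ => 1)
  else (nNorm (MIter β h q A k))⁻¹ • MIter β h q A k

end Iteration

section Probability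

variable {Ω : Type*}

/-- Symmetric `N × N` matrix, zero on the diagonal, whose entries above the diagonal are
independent centered Gaussian variables of variance `1/N`. -/
structure IsInteraction {mΩ : MeasurableSpace Ω} (μ : Measure Ω) {N : ℕ} (g : Ω → Matrix (Fin N) (Fin N) ℝ) : Prop where
  measurable : ∀ i j, Measurable fun ω => g ω i j
  symm : ∀ ω i j, g ω i j = g ω j i
  diag : ∀ ω i, g ω i i = 0
  gaussian : ∀ i j, i < j → μ.map (fun ω => g ω i j) = gaussianReal 0 (N : NNReal)⁻¹
  indep : iIndepFun (fun (p : {p : Fin N × Fin N // p.1 < p.2}) ω => g ω p.1.1 p.1.2) μ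

/-! ### Conditional linear projection and the modified matrices -/

/-- The space of random variables `∑ᵢ aᵢ zᵢ` with `G`-measurable coefficients `aᵢ`. -/
def condSpan {N : ℕ} (G : MeasurableSpace Ω) (z : Ω → Fin N → ℝ) : Set (Ω → ℝ) :=
  {U | ∃ a : Fin N → Ω → ℝ, (∀ i, Measurable[G] (a i)) ∧ U = fun ω => ∑ i, a i ω * z ω i}

/-- `p` is a version of the linear projection of `y` onto `L`, conditionally on `G`:
`p ∈ L` and `E[(y - p) U | G] = 0` almost surely for all `U ∈ L` (for which this conditional
expectation makes sense). For square integrable `y` and `L` spanned by square integrable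
variables, it is unique up to null sets, as the coefficients may be cut off by indicators of
sets in `G`. -/
def IsCondProj (G : MeasurableSpace Ω) {mΩ : MeasurableSpace Ω} (μ : Measure Ω) (L : Set (Ω → ℝ)) (y p : Ω → ℝ) : Prop :=
  p ∈ L ∧ ∀ U ∈ L, Integrable (fun ω => (y ω - p ω) * U ω) μ →
    μ[fun ω => (y ω - p ω) * U ω | G] =ᵐ[μ] 0

open Classical in
/-- The conditional linear projection of `y` onto `L` given `G`. -/
def condProj (G : MeasurableSpace Ω) {mΩ : MeasurableSpace Ω} (μ : Measure Ω) (L : Set (Ω → ℝ)) (y : Ω → ℝ) : Ω → ℝ :=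
  if hp : ∃ p, IsCondProj G μ L y p then hp.choose else 0

/-- The sequence `k ↦ (g⁽ᵏ⁺¹⁾, F_k)`. It starts with `g⁽¹⁾ = g` and the trivial σ-field `F₀`; then
`g⁽ᵏ⁺¹⁾ = g⁽ᵏ⁾ - π(g⁽ᵏ⁾)`, with `π` the entrywise projection, given `F_{k-1}`, onto the span of the
coordinates of `g⁽ᵏ⁾ M⁽ᵏ⁾` with `F_{k-1}`-measurable coefficients, and
`F_k = σ(F_{k-1}, g⁽ᵏ⁾ φ⁽ᵏ⁾)`. -/
def stage {mΩ : MeasurableSpace Ω} (μ : Measure Ω) (β h q : ℝ) {N : ℕ} (g : Ω → Matrix (Fin N) (Fin N) ℝ) :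
    ℕ → (Ω → Matrix (Fin N) (Fin N) ℝ) × MeasurableSpace Ω
  | 0 => (g, ⊥)
  | k + 1 =>
    let y := (stage μ β h q g k).1
    let G := (stage μ β h q g k).2
    (fun ω => Matrix.of fun i j => y ω i j -
        condProj G μ
          (condSpan G fun ω' a => ∑ b, y ω' a b * MIter β h q (g ω') (k + 1) b)
          (fun ω' => y ω' i j) ω,
      G ⊔ MeasurableSpace.comap
        (fun ω (a : Fin N) => ∑ b, y ω a b * phi β h q (g ω) (k + 1) b) MeasurableSpace.pi)

/-- The modified matrix `g⁽ᵏ⁾`, for `k ≥ 1`. -/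
def gMod {mΩ : MeasurableSpace Ω} (μ : Measure Ω) (β h q : ℝ) {N : ℕ} (g : Ω → Matrix (Fin N) (Fin N) ℝ) (k : ℕ) :
    Ω → Matrix (Fin N) (Fin N) ℝ := (stage μ β h q g (k - 1)).1

/-- The σ-field `F_k`, for `k ≥ 0`. -/
@[reducible] def Fil {mΩ : MeasurableSpace Ω} (μ : Measure Ω) (β h q : ℝ) {N : ℕ} (g : Ω → Matrix (Fin N) (Fin N) ℝ) (k : ℕ) :
    MeasurableSpace Ω := (stage μ β h q g k).2

/-- `E[g⁽ᵏ⁾_{ij} g⁽ᵏ⁾_{st} | F_{k-2}]`, for `k ≥ 1`. As `F_{-1} = F_0` is trivial, the truncated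
subtraction `1 - 2 = 0` gives the intended σ-field for `k = 1`. -/
def condCov {mΩ : MeasurableSpace Ω} (μ : Measure Ω) (β h q : ℝ) {N : ℕ} (g : Ω → Matrix (Fin N) (Fin N) ℝ) (k : ℕ)
    (i j s t : Fin N) : Ω → ℝ :=
  μ[fun ω => gMod μ β h q g k ω i j * gMod μ β h q g k ω s t | Fil μ β h q g (k - 2)]

/-! ### The asymptotic relations -/

/-- `X_N ≃ Y_N`: for some `C > 0`, `P(|X_N - Y_N| ≥ t) ≤ C exp(-t² N / C)` for all `N` and
all `0 < t ≤ 1`. -/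
def SimEq {mΩ : MeasurableSpace Ω} (μ : Measure Ω) (X Y : ℕ → Ω → ℝ) : Prop :=
  ∃ C : ℝ, 0 < C ∧ ∀ N : ℕ, 1 ≤ N → ∀ t : ℝ, 0 < t → t ≤ 1 →
    μ.real {ω | t ≤ |X N ω - Y N ω|} ≤ C * Real.exp (-(t ^ 2 * N / C))

/-- The condition `COND(J)`: for `k ≤ J`, `‖m⁽ᵏ⁾‖² ≃ q`, and `⟨m⁽ʲ⁾, m⁽ᵏ⁾⟩ ≃ ρ_j`
for `1 ≤ j < k`. -/
def Cond {mΩ : MeasurableSpace Ω} (μ : Measure Ω) (β h q : ℝ) (g : (N : ℕ) → Ω → Matrix (Fin N) (Fin N) ℝ) (J : ℕ) : Prop :=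
  ∀ k, 1 ≤ k → k ≤ J →
    SimEq μ (fun N ω => nNorm (mIter β h q (g N ω) k) ^ 2) (fun _ _ => q) ∧
    ∀ j, 1 ≤ j → j < k →
      SimEq μ (fun N ω => nInner (mIter β h q (g N ω) j) (mIter β h q (g N ω) k))
        (fun _ _ => rho β h q j)

/-- The requirement in `X = O(N⁻ʳ)` on one variable `X` in dimension `N`, with constants `C, K`:
`X` is `F`-measurable (up to null sets) and `P(Nʳ |X| ≥ K) ≤ C exp(-N/C)`. -/
def ErrBound {mΩ : MeasurableSpace Ω} (μ : Measure Ω) (F : MeasurableSpace Ω) (N r : ℕ) (C K : ℝ) (X : Ω → ℝ) : Prop :=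
  AEStronglyMeasurable[F] X μ ∧
    μ.real {ω | K ≤ (N : ℝ) ^ r * |X ω|} ≤ C * Real.exp (-((N : ℝ) / C))

/-- `E_{k-2} (g⁽ᵏ⁾_{ij})² = 1/N + O_{k-2}(N⁻²)` for `i ≠ j`. -/
def GaussMain1 {mΩ : MeasurableSpace Ω} (μ : Measure Ω) (β h q : ℝ) (g : (N : ℕ) → Ω → Matrix (Fin N) (Fin N) ℝ)
    (k : ℕ) : Prop :=
  ∃ C K : ℝ, 0 < C ∧ 0 < K ∧ ∀ N : ℕ, 1 ≤ N → ∀ i j : Fin N, i ≠ j →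
    ErrBound μ (Fil μ β h q (g N) (k - 2)) N 2 C K fun ω =>
      condCov μ β h q (g N) k i j i j ω - 1 / (N : ℝ)

/-- `E_{k-2} g⁽ᵏ⁾_{ij} g⁽ᵏ⁾_{jt} = - ∑_{m<k} φ⁽ᵐ⁾_i φ⁽ᵐ⁾_t / N² + O_{k-2}(N⁻³)` for distinct
`i, j, t`. -/
def GaussMain2 {mΩ : MeasurableSpace Ω} (μ : Measure Ω) (β h q : ℝ) (g : (N : ℕ) → Ω → Matrix (Fin N) (Fin N) ℝ)
    (k : ℕ) : Prop :=
  ∃ C K : ℝ, 0 < C ∧ 0 < K ∧ ∀ N : ℕ, 1 ≤ N → ∀ i j t : Fin N, i ≠ j → t ≠ i → t ≠ j →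
    ErrBound μ (Fil μ β h q (g N) (k - 2)) N 3 C K fun ω =>
      condCov μ β h q (g N) k i j j t ω -
        (-∑ m ∈ Finset.Ico 1 k, phi β h q (g N ω) m i * phi β h q (g N ω) m t / (N : ℝ) ^ 2)

/-- The polynomial
`α_{ijst} = ∑_{1 ≤ a,b,c,d < k} λ_{abcd} φ⁽ᵃ⁾_i φ⁽ᵇ⁾_j φ⁽ᶜ⁾_s φ⁽ᵈ⁾_t`. -/
def alphaPoly (β h q : ℝ) {N : ℕ} (A : Matrix (Fin N) (Fin N) ℝ) (k : ℕ)
    (lam : ℕ → ℕ → ℕ → ℕ → ℝ) (i j s t : Fin N) : ℝ :=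
  ∑ a ∈ Finset.Ico 1 k, ∑ b ∈ Finset.Ico 1 k, ∑ c ∈ Finset.Ico 1 k, ∑ d ∈ Finset.Ico 1 k,
    lam a b c d * (phi β h q A a i * phi β h q A b j * phi β h q A c s * phi β h q A d t)

/-- `E_{k-2} g⁽ᵏ⁾_{ij} g⁽ᵏ⁾_{st} = α_{ijst} / N³ + O_{k-2}(N⁻⁴)` for distinct `i, j, s, t`, with
real coefficients `λ` of `α` that depend neither on `N` nor on the indices `i, j, s, t`, and
that are symmetric under `i ↔ j`, `s ↔ t` and `(i, j) ↔ (s, t)`. -/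
def GaussMain3 {mΩ : MeasurableSpace Ω} (μ : Measure Ω) (β h q : ℝ) (g : (N : ℕ) → Ω → Matrix (Fin N) (Fin N) ℝ)
    (k : ℕ) : Prop :=
  ∃ lam : ℕ → ℕ → ℕ → ℕ → ℝ,
    (∀ a b c d, lam a b c d = lam b a c d ∧ lam a b c d = lam a b d c ∧
      lam a b c d = lam c d a b) ∧
    ∃ C K : ℝ, 0 < C ∧ 0 < K ∧ ∀ N : ℕ, 1 ≤ N → ∀ i j s t : Fin N,
      i ≠ j → s ≠ t → s ≠ i → s ≠ j → t ≠ i → t ≠ j →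
      ErrBound μ (Fil μ β h q (g N) (k - 2)) N 4 C K fun ω =>
        condCov μ β h q (g N) k i j s t ω -
          alphaPoly β h q (g N ω) k lam i j s t / (N : ℝ) ^ 3

end Probability

end

end TAP

/-! Read the entries of g above the diagonal as a Gaussian vector X with covariance N⁻¹ times the
identity. Let A_n be the random subspace of symmetric matrices with zero diagonal that annihilate
m⁽¹⁾, …, m⁽ⁿ⁾ (`annih`), and P_n the orthogonal projection onto it. The abstract conditional
projections are in fact these geometric ones: almost surely g⁽ⁿ⁺¹⁾_{ij} = ⟨P_n e_{ij}, X⟩, where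
e_{ij} represents the entry (i, j) (`StageSpec`).

The reason is a resampling property. Adding an element of A_n to g changes none of the iterates up
to index n+1 (`mIter_add`) and, up to null sets, no event of F_n; and the law of X does not change
when its A_n-component is replaced by that of an independent copy (`resampleInvariant_annih`). So,
given F_n, the projections P_n and P_{n+1} are frozen while the A_n-component of X is fresh Gaussian
noise. In particular the conditional covariance of g⁽ⁿ⁺²⁾_{ij} and g⁽ⁿ⁺²⁾_{st} given F_n is exactly
N⁻¹⟨P_{n+1} e_{ij}, e_{st}⟩ (`IsInteraction.condCov_ae_eq`). With J = n+1 the three relations become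
a deterministic statement on the entries of P_J e_{ij}.

Let R be the projection of ℝᴺ onto the span of the iterates, Q = 1 - R, and E the symmetrized matrix
unit at (i, j). Then P_J e_{ij} is QEQ - 2QDQ, with a diagonal matrix D that restores the zero
diagonal (`toMat_starProjection_annih`). If the entries of R are O(N⁻¹), the linear system for D is
a small perturbation of the identity, and D only enters the error terms
(`starProjection_annih_expansion`). Substituting R_{ij} = N⁻¹ ∑ φ⁽ᵐ⁾_i φ⁽ᵐ⁾_j gives the main terms;
in the third relation these are the two pairings of {i, j} with {s, t}.

The entries of R are O(N⁻¹) once the iterates, which are bounded coordinatewise, have a Gram matrix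
bounded below (`abs_spanProj_le`). By COND that matrix is close to `limGram` outside an event of
exponentially small probability, which is what the error terms allow. Positive definiteness of
`limGram` goes by induction: the matrix of order n+1 is the L² Gram matrix of √q, Th(x₁), …, Th(x_n)
for a Gaussian vector x whose covariance is the matrix of order n. These functions are linearly
independent because x has full support and Th is injective (`posDef_limGram`). -/

namespace TAP

noncomputable section

/-! ### Orthogonal projections depending measurably on parameters -/

section MeasurableProjection

variable {S E : Type*} [MeasurableSpace S] [NormedAddCommGroup E] [InnerProductSpace ℝ E]
  [MeasurableSpace E] [BorelSpace E] [SecondCountableTopology E]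

/-- Gram–Schmidt, one vector at a time: the new direction is the residual w of u n, with coefficient
⟨w, r⟩ / ⟨w, w⟩. Division by zero yields 0, which is an admissible coefficient where w vanishes, so
the formula is measurable and valid everywhere, whatever the rank of the family. -/
theorem exists_measurable_coeff_finset {ι : Type*} [DecidableEq ι] {u : ι → S → E}
    (hu : ∀ i, Measurable (u i)) (s : Finset ι) :
    ∀ x : S → E, Measurable x → ∃ a : ι → S → ℝ, (∀ i, Measurable (a i)) ∧
      ∀ ω, ∀ j ∈ s, inner ℝ (u j ω) (x ω - ∑ i ∈ s, a i ω • u i ω) = 0 := by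
  induction s using Finset.induction_on with
  | empty => exact fun x _ => ⟨fun _ _ => 0, fun _ => measurable_const, by simp⟩
  | insert n s hn ih =>
    intro x hx
    obtain ⟨a, ha, hax⟩ := ih x hx
    obtain ⟨c, hc, hcu⟩ := ih (u n) (hu n)
    let w : S → E := fun ω => u n ω - ∑ i ∈ s, c i ω • u i ω
    let r : S → E := fun ω => x ω - ∑ i ∈ s, a i ω • u i ω
    have hw : Measurable w := (hu n).sub (Finset.measurable_fun_sum _ fun i _ => (hc i).smul (hu i))
    have hr : Measurable r := hx.sub (Finset.measurable_fun_sum _ fun i _ => (ha i).smul (hu i))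
    let t : S → ℝ := fun ω => inner ℝ (w ω) (r ω) / inner ℝ (w ω) (w ω)
    have ht : Measurable t := (hw.inner hr).div (hw.inner hw)
    refine ⟨fun i ω => if i = n then t ω else a i ω - t ω * c i ω, fun i => ?_, fun ω j hj => ?_⟩
    · by_cases h : i = n
      · simpa [h] using ht
      · simp only [h, if_false]
        exact (ha i).sub (ht.mul (hc i))
    · have hres : x ω - ∑ i ∈ insert n s,
          (if i = n then t ω else a i ω - t ω * c i ω) • u i ω = r ω - t ω • w ω := by
        rw [Finset.sum_insert hn, if_pos rfl]
        have : ∑ i ∈ s, (if i = n then t ω else a i ω - t ω * c i ω) • u i ω =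
            ∑ i ∈ s, a i ω • u i ω - t ω • ∑ i ∈ s, c i ω • u i ω := by
          rw [Finset.smul_sum, ← Finset.sum_sub_distrib]
          refine Finset.sum_congr rfl fun i hi => ?_
          rw [if_neg (by rintro rfl; exact hn hi), sub_smul, mul_smul]
        rw [this]
        simp only [r, w, smul_sub]
        abel
      have hs : ∀ j ∈ s, inner ℝ (u j ω) (r ω - t ω • w ω) = 0 := fun j hj => by
        rw [inner_sub_right, inner_smul_right, hax ω j hj, hcu ω j hj]; simp
      rw [hres]
      rcases Finset.mem_insert.1 hj with rfl | hj
      · have hjw : u j ω = w ω + ∑ i ∈ s, c i ω • u i ω := by simp [w]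
        rw [hjw, inner_add_left, sum_inner, Finset.sum_eq_zero, add_zero, inner_sub_right,
          inner_smul_right]
        · rcases eq_or_ne (w ω) 0 with h0 | h0
          · simp [h0]
          · have : inner ℝ (w ω) (w ω) ≠ 0 := inner_self_ne_zero.2 h0
            simp only [t]
            field_simp
            simp
        · intro i hi
          rw [inner_smul_left, hs i hi, mul_zero]
      · exact hs j hj

theorem exists_measurable_coeff {ι : Type*} [Fintype ι] {u : ι → S → E}
    (hu : ∀ i, Measurable (u i)) {x : S → E} (hx : Measurable x) :
    ∃ a : ι → S → ℝ, (∀ i, Measurable (a i)) ∧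
      ∀ ω j, inner ℝ (u j ω) (x ω - ∑ i, a i ω • u i ω) = 0 := by
  classical
  obtain ⟨a, ha, h⟩ := exists_measurable_coeff_finset hu Finset.univ x hx
  exact ⟨a, ha, fun ω j => h ω j (Finset.mem_univ j)⟩

variable [FiniteDimensional ℝ E]

omit [MeasurableSpace E] [BorelSpace E] [SecondCountableTopology E] in
theorem starProjection_span_eq {ι : Type*} [Fintype ι] {v : ι → E} {x : E} {a : ι → ℝ}
    (h : ∀ j, inner ℝ (v j) (x - ∑ i, a i • v i) = 0) :
    (Submodule.span ℝ (Set.range v)).starProjection x = ∑ i, a i • v i := by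
  refine Submodule.eq_starProjection_of_mem_orthogonal
    (Submodule.sum_mem _ fun i _ => Submodule.smul_mem _ _ (Submodule.subset_span ⟨i, rfl⟩)) ?_
  rw [Submodule.mem_orthogonal]
  intro w hw
  induction hw using Submodule.span_induction with
  | mem y hy => obtain ⟨j, rfl⟩ := hy; exact h j
  | zero => simp
  | add y z _ _ hy hz => rw [inner_add_left, hy, hz, add_zero]
  | smul c y _ hy => rw [inner_smul_left, hy, mul_zero]

theorem measurable_starProjection_span {ι : Type*} [Fintype ι] {u : ι → S → E}
    (hu : ∀ i, Measurable (u i)) {x : S → E} (hx : Measurable x) :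
    Measurable fun ω => (Submodule.span ℝ (Set.range fun i => u i ω)).starProjection (x ω) := by
  obtain ⟨a, ha, h⟩ := exists_measurable_coeff hu hx
  have : (fun ω => (Submodule.span ℝ (Set.range fun i => u i ω)).starProjection (x ω)) =
      fun ω => ∑ i, a i ω • u i ω := funext fun ω => starProjection_span_eq (h ω)
  rw [this]
  exact Finset.measurable_fun_sum _ fun i _ => (ha i).smul (hu i)

end MeasurableProjection

/-! ### Symmetric matrices with zero diagonal, in coordinates -/

/-- The positions above the diagonal. -/
abbrev Pair (N : ℕ) := {p : Fin N × Fin N // p.1 < p.2}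

/-- Symmetric `N × N` matrices with zero diagonal, given by the entries above the diagonal. -/
abbrev Coords (N : ℕ) := EuclideanSpace ℝ (Pair N)

section Coordinates

variable {N : ℕ}

/-- The vector representing the entry at `(i, j)`. -/
def entryVec (i j : Fin N) : Coords N :=
  if h : i < j then EuclideanSpace.single ⟨(i, j), h⟩ 1
  else if h : j < i then EuclideanSpace.single ⟨(j, i), h⟩ 1 else 0

/-- The symmetric matrix with given entries above the diagonal. -/
def toMat (x : Coords N) : Matrix (Fin N) (Fin N) ℝ :=
  Matrix.of fun i j => inner ℝ (entryVec i j) x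

/-- The vector representing the linear functional `x ↦ (toMat x *ᵥ y) i`. -/
def rowVec (y : EuclideanSpace ℝ (Fin N)) (i : Fin N) : Coords N := ∑ j, y j • entryVec i j

theorem entryVec_self (i : Fin N) : entryVec i i = 0 := by simp [entryVec]

theorem entryVec_comm (i j : Fin N) : entryVec i j = entryVec j i := by
  unfold entryVec
  rcases lt_trichotomy i j with h | rfl | h
  · simp [h, h.not_gt]
  · rfl
  · simp [h, h.not_gt]

theorem toMat_apply (x : Coords N) (i j : Fin N) : toMat x i j = inner ℝ (entryVec i j) x := rfl

theorem toMat_comm (x : Coords N) (i j : Fin N) : toMat x i j = toMat x j i := by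
  rw [toMat_apply, entryVec_comm, toMat_apply]

theorem toMat_self (x : Coords N) (i : Fin N) : toMat x i i = 0 := by
  rw [toMat_apply, entryVec_self, inner_zero_left]

theorem toMat_pair (x : Coords N) (p : Pair N) : toMat x p.1.1 p.1.2 = x p := by
  rw [toMat_apply, entryVec, dif_pos p.2]
  exact (EuclideanSpace.inner_single_left _ _ _).trans (by simp)

theorem toMat_add (x y : Coords N) (i j : Fin N) : toMat (x + y) i j = toMat x i j + toMat y i j := by
  simp only [toMat_apply, inner_add_right]

theorem toMat_of_symm {A : Matrix (Fin N) (Fin N) ℝ} (hs : ∀ i j, A i j = A j i)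
    (hd : ∀ i, A i i = 0) : toMat (WithLp.toLp 2 fun p : Pair N => A p.1.1 p.1.2) = A := by
  ext i j
  rcases lt_trichotomy i j with h | rfl | h
  · exact toMat_pair _ ⟨(i, j), h⟩
  · rw [toMat_self, hd]
  · rw [toMat_comm, hs]; exact toMat_pair _ ⟨(j, i), h⟩

theorem inner_rowVec (y : EuclideanSpace ℝ (Fin N)) (i : Fin N) (x : Coords N) :
    inner ℝ (rowVec y i) x = ∑ j, toMat x i j * y j := by
  simp [rowVec, sum_inner, inner_smul_left, toMat_apply, mul_comm]

/-- Twice the inner product in coordinates is the Frobenius inner product of the matrices. -/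
theorem two_mul_inner_eq (x y : Coords N) :
    2 * inner ℝ x y = ∑ i, ∑ j, toMat x i j * toMat y i j := by
  have h1 : ∀ i j, toMat x i j * toMat y i j =
      (if i < j then toMat x i j * toMat y i j else 0) +
        (if j < i then toMat x i j * toMat y i j else 0) := by
    intro i j
    rcases lt_trichotomy i j with h | rfl | h
    · simp [h, h.not_gt]
    · simp [toMat_self]
    · simp [h, h.not_gt]
  have h2 : inner ℝ x y = ∑ i, ∑ j, if i < j then toMat x i j * toMat y i j else 0 := by
    rw [← Fintype.sum_prod_type' (f := fun i j => if i < j then toMat x i j * toMat y i j else 0),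
      PiLp.inner_apply, ← Finset.sum_filter,
      ← Finset.sum_subtype_of_mem (p := fun p : Fin N × Fin N => p.1 < p.2)
        (fun p => toMat x p.1 p.2 * toMat y p.1 p.2) (by simp)]
    refine Finset.sum_congr (by ext p; simpa using p.2) fun p _ => ?_
    rw [toMat_pair, toMat_pair]
    simp [mul_comm]
  have h3 : (∑ i, ∑ j, if j < i then toMat x i j * toMat y i j else 0) =
      ∑ i, ∑ j, if i < j then toMat x i j * toMat y i j else 0 := by
    rw [Finset.sum_comm]
    refine Finset.sum_congr rfl fun i _ => Finset.sum_congr rfl fun j _ => ?_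
    rw [toMat_comm x j i, toMat_comm y j i]
  rw [Finset.sum_congr rfl fun i _ => Finset.sum_congr rfl fun j _ => h1 i j]
  simp only [Finset.sum_add_distrib]
  rw [h3, ← h2, two_mul]

theorem measurable_toMat (i j : Fin N) : Measurable fun x : Coords N => toMat x i j := by
  simp only [toMat_apply]
  fun_prop

theorem measurable_rowVec (i : Fin N) :
    Measurable fun y : EuclideanSpace ℝ (Fin N) => rowVec y i := by
  unfold rowVec
  fun_prop

theorem rowVec_add (y z : EuclideanSpace ℝ (Fin N)) (i : Fin N) :
    rowVec (y + z) i = rowVec y i + rowVec z i := by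
  simp [rowVec, add_smul, Finset.sum_add_distrib]

theorem rowVec_smul (c : ℝ) (y : EuclideanSpace ℝ (Fin N)) (i : Fin N) :
    rowVec (c • y) i = c • rowVec y i := by
  simp [rowVec, mul_smul, Finset.smul_sum]

theorem rowVec_zero (i : Fin N) : rowVec (0 : EuclideanSpace ℝ (Fin N)) i = 0 := by
  simp [rowVec]

theorem norm_rowVec_le (y : EuclideanSpace ℝ (Fin N)) (i : Fin N) :
    ‖rowVec y i‖ ≤ N * ‖y‖ := by
  have h : ∀ i j : Fin N, ‖entryVec i j‖ ≤ 1 := by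
    intro i j
    unfold entryVec
    split_ifs <;> simp
  calc ‖rowVec y i‖ ≤ ∑ j, ‖y j • entryVec i j‖ := norm_sum_le _ _
    _ ≤ ∑ _j : Fin N, ‖y‖ := by
        refine Finset.sum_le_sum fun j _ => ?_
        rw [norm_smul]
        exact (mul_le_of_le_one_right (norm_nonneg _) (h i j)).trans (PiLp.norm_apply_le y j)
    _ = N * ‖y‖ := by simp

end Coordinates


/-! ### Gaussian vectors and partial resampling -/

section Resampling

variable {E : Type*} [NormedAddCommGroup E] [InnerProductSpace ℝ E] [FiniteDimensional ℝ E]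
  [MeasurableSpace E] [BorelSpace E]

/-- The centered Gaussian measure on `E` with covariance `c² ⟪·, ·⟫`. -/
def isoGaussian (E : Type*) [NormedAddCommGroup E] [InnerProductSpace ℝ E] [FiniteDimensional ℝ E]
    [MeasurableSpace E] [BorelSpace E] (c : ℝ) : Measure E :=
  (ProbabilityTheory.stdGaussian E).map (c • ContinuousLinearMap.id ℝ E)

instance (c : ℝ) : IsGaussian (isoGaussian E c) := by
  unfold isoGaussian
  infer_instance

theorem charFun_isoGaussian (c : ℝ) (t : E) :
    charFun (isoGaussian E c) t = Complex.exp (-(c ^ 2 * ‖t‖ ^ 2 / 2 : ℝ)) := by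
  have : charFun (isoGaussian E c) t = charFun (ProbabilityTheory.stdGaussian E) (c • t) := by
    rw [isoGaussian, ← charFun_map_smul]
    rfl
  rw [this, charFun_stdGaussian, norm_smul, Real.norm_eq_abs, ← Complex.ofReal_pow, mul_pow, sq_abs]
  push_cast
  congr 1
  ring

theorem memLp_isoGaussian (c : ℝ) {p : ENNReal} (hp : p ≠ ⊤) :
    MemLp (fun x : E => x) p (isoGaussian E c) :=
  IsGaussian.memLp_id _ p hp

theorem integral_inner_mul_inner_isoGaussian (c : ℝ) (u v : E) :
    ∫ x, inner ℝ u x * inner ℝ v x ∂(isoGaussian E c) = c ^ 2 * inner ℝ u v := by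
  have h0 : ∫ x, inner ℝ u x * inner ℝ v x ∂(ProbabilityTheory.stdGaussian E) = inner ℝ u v := by
    have h1 : covarianceBilin (ProbabilityTheory.stdGaussian E) u v = inner ℝ u v := by
      rw [covarianceBilin_stdGaussian, innerSL_apply_apply ℝ]
    rw [← h1, covarianceBilin_apply IsGaussian.memLp_two_id]
    simp
  rw [isoGaussian, integral_map (by fun_prop) (by fun_prop)]
  simp only [smul_apply, ContinuousLinearMap.id_apply, inner_smul_right]
  rw [← h0, ← integral_const_mul]
  congr 1 with x
  ring

/-- The components in W and in its orthogonal complement are independent, so the first may be taken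
from an independent copy. On characteristic functions this is Pythagoras for t. -/
theorem map_add_starProjection_isoGaussian (c : ℝ) (W : Submodule ℝ E) :
    ((isoGaussian E c).prod (isoGaussian E c)).map
      (fun p => p.1 + W.starProjection (p.2 - p.1)) = isoGaussian E c := by
  have hm : Measurable fun p : E × E => p.1 + W.starProjection (p.2 - p.1) := by fun_prop
  have := Measure.isProbabilityMeasure_map (μ := (isoGaussian E c).prod (isoGaussian E c))
    hm.aemeasurable
  refine Measure.ext_of_charFun (funext fun t => ?_)
  rw [charFun_apply, integral_map hm.aemeasurable (by fun_prop)]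
  have h1 : ∀ p : E × E, Complex.exp (inner ℝ (p.1 + W.starProjection (p.2 - p.1)) t * Complex.I) =
      Complex.exp (inner ℝ p.1 (t - W.starProjection t) * Complex.I) *
        Complex.exp (inner ℝ p.2 (W.starProjection t) * Complex.I) := by
    intro p
    rw [← Complex.exp_add, ← add_mul, ← Complex.ofReal_add]
    congr 4
    rw [map_sub, inner_add_left, inner_sub_left, inner_sub_right,
      Submodule.inner_starProjection_left_eq_right, Submodule.inner_starProjection_left_eq_right]
    ring
  simp_rw [h1]
  rw [integral_prod_mul (fun x : E => Complex.exp (inner ℝ x (t - W.starProjection t) * Complex.I))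
    (fun x : E => Complex.exp (inner ℝ x (W.starProjection t) * Complex.I)),
    ← charFun_apply, ← charFun_apply, charFun_isoGaussian, charFun_isoGaussian,
    charFun_isoGaussian, ← Complex.exp_add, ← Complex.ofReal_neg, ← Complex.ofReal_neg,
    ← Complex.ofReal_neg, ← Complex.ofReal_add]
  congr 2
  have h2 : ‖t‖ ^ 2 = ‖W.starProjection t‖ ^ 2 + ‖t - W.starProjection t‖ ^ 2 := by
    have h3 : inner ℝ (t - W.starProjection t) (W.starProjection t) = 0 :=
      Submodule.starProjection_inner_eq_zero _ _ (Submodule.starProjection_apply_mem _ _)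
    have h4 := norm_add_sq_real (t - W.starProjection t) (W.starProjection t)
    rw [h3] at h4
    simp only [sub_add_cancel] at h4
    linarith
  rw [h2]
  ring

/-- Replace the component of `x` in the subspace `W x` by that of an independent copy. -/
def resample (W : E → Submodule ℝ E) (p : E × E) : E :=
  p.1 + (W p.1).starProjection (p.2 - p.1)

/-- The measure `ν` is invariant under resampling in the subspaces `W x`. -/
def ResampleInvariant (ν : Measure E) (W : E → Submodule ℝ E) : Prop :=
  (Measurable fun p : E × E => (W p.1).starProjection p.2) ∧
    (ν.prod ν).map (resample W) = ν

theorem measurable_resample {W : E → Submodule ℝ E}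
    (h : Measurable fun p : E × E => (W p.1).starProjection p.2) : Measurable (resample W) := by
  have h2 : Measurable fun p : E × E => (p.1, p.2 - p.1) := by fun_prop
  exact measurable_fst.add (h.comp h2)

omit [MeasurableSpace E] [BorelSpace E] in
theorem starProjection_of_le {W W' : Submodule ℝ E} (h : W' ≤ W) (x : E) :
    W'.starProjection (W.starProjection x) = W'.starProjection x := by
  have h0 : W'.starProjection (x - W.starProjection x) = 0 := by
    rw [Submodule.starProjection_apply_eq_zero_iff]
    exact Submodule.orthogonal_le h (Submodule.sub_starProjection_mem_orthogonal x)
  rw [map_sub, sub_eq_zero] at h0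
  exact h0.symm

omit [MeasurableSpace E] [BorelSpace E] in
theorem starProjection_of_le' {W W' : Submodule ℝ E} (h : W' ≤ W) (x : E) :
    W.starProjection (W'.starProjection x) = W'.starProjection x :=
  Submodule.starProjection_eq_self_iff.2 (h (Submodule.starProjection_apply_mem _ _))

-- Resampling in W x leaves W' x unchanged, so a second resampling, in the smaller space W' x, only
-- modifies the W' x-component of the noise ξ used in the first.
omit [MeasurableSpace E] [BorelSpace E] in
theorem resample_step {W W' : E → Submodule ℝ E} (hle : ∀ x, W' x ≤ W x)
    (hinv : ∀ x, ∀ w ∈ W x, W' (x + w) = W' x) (x ξ η : E) :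
    resample W' (resample W (x, ξ), η) = resample W (x, ξ + (W' x).starProjection (η - ξ)) := by
  have h1 : W' (resample W (x, ξ)) = W' x := hinv x _ (Submodule.starProjection_apply_mem _ _)
  have h2 : (W' x).starProjection (resample W (x, ξ)) = (W' x).starProjection ξ := by
    simp only [resample, map_add, map_sub, starProjection_of_le (hle x)]
    abel
  have h3 : resample W' (resample W (x, ξ), η) =
      resample W (x, ξ) + (W' x).starProjection (η - resample W (x, ξ)) := by
    rw [← h1]
    rfl
  rw [h3, map_sub, h2]
  simp only [resample, map_add, map_sub, starProjection_of_le' (hle x)]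
  abel

/-- Start from the law already resampled in W. For fixed x, resampling again in W' replaces ξ by a
vector of the same law (`resample_step`, `map_add_starProjection_isoGaussian`), so it has no effect.
The subspace may be random because it depends only on what the first resampling keeps. -/
theorem ResampleInvariant.step {c : ℝ} {W W' : E → Submodule ℝ E}
    (h : ResampleInvariant (isoGaussian E c) W)
    (hm : Measurable fun p : E × E => (W' p.1).starProjection p.2) (hle : ∀ x, W' x ≤ W x)
    (hinv : ∀ x, ∀ w ∈ W x, W' (x + w) = W' x) : ResampleInvariant (isoGaussian E c) W' := by
  refine ⟨hm, Measure.ext_of_lintegral _ fun f hf => ?_⟩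
  obtain ⟨hmW, hW⟩ := h
  have m1 := measurable_resample hmW
  have m2 := measurable_resample hm
  set ν := isoGaussian E c
  have key : ∀ x : E, ∫⁻ ξ, ∫⁻ η, f (resample W' (resample W (x, ξ), η)) ∂ν ∂ν =
      ∫⁻ ξ, f (resample W (x, ξ)) ∂ν := by
    intro x
    simp_rw [resample_step hle hinv]
    have m3 : Measurable fun ξ => f (resample W (x, ξ)) := by fun_prop
    have m4 : Measurable fun p : E × E => p.1 + (W' x).starProjection (p.2 - p.1) := by fun_prop
    have m6 := map_add_starProjection_isoGaussian c (W' x)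
    change (ν.prod ν).map _ = ν at m6
    conv_rhs => rw [← m6]
    rw [lintegral_map m3 m4, lintegral_prod (fun p : E × E => f (resample W (x,
      p.1 + (W' x).starProjection (p.2 - p.1)))) (m3.comp m4).aemeasurable]
  have m5 : Measurable fun x => ∫⁻ η, f (resample W' (x, η)) ∂ν :=
    (hf.comp m2).lintegral_prod_right'
  calc ∫⁻ x, f x ∂((ν.prod ν).map (resample W'))
      = ∫⁻ x, ∫⁻ η, f (resample W' (x, η)) ∂ν ∂ν := by
        rw [lintegral_map hf m2, lintegral_prod (fun p => f (resample W' p)) (hf.comp m2).aemeasurable]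
    _ = ∫⁻ x, ∫⁻ η, f (resample W' (x, η)) ∂ν ∂((ν.prod ν).map (resample W)) := by rw [hW]
    _ = ∫⁻ x, ∫⁻ ξ, ∫⁻ η, f (resample W' (resample W (x, ξ), η)) ∂ν ∂ν ∂ν := by
        rw [lintegral_map m5 m1, lintegral_prod
          (fun p => ∫⁻ η, f (resample W' (resample W p, η)) ∂ν) (m5.comp m1).aemeasurable]
    _ = ∫⁻ x, ∫⁻ ξ, f (resample W (x, ξ)) ∂ν ∂ν := by simp_rw [key]
    _ = ∫⁻ x, f x ∂ν := by
        conv_rhs => rw [← hW]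
        rw [lintegral_map hf m1, lintegral_prod (fun p => f (resample W p)) (hf.comp m1).aemeasurable]

theorem resampleInvariant_top (c : ℝ) : ResampleInvariant (isoGaussian E c) fun _ => ⊤ := by
  refine ⟨by simpa [Submodule.starProjection_top] using measurable_snd, ?_⟩
  have : resample (fun _ : E => (⊤ : Submodule ℝ E)) = Prod.snd := by
    ext p
    simp [resample, Submodule.starProjection_top]
  rw [this]
  exact Measure.map_snd_prod.trans (by simp)

end Resampling

/-! ### The subspaces of matrices annihilating the iterates -/

section Subspaces

variable {N : ℕ}

/-- The symmetric matrices with zero diagonal that annihilate the vectors `u 1, …, u n`. -/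
def annih (n : ℕ) (u : ℕ → EuclideanSpace ℝ (Fin N)) : Submodule ℝ (Coords N) :=
  (Submodule.span ℝ (Set.range fun p : Fin n × Fin N => rowVec (u (p.1 + 1)) p.2))ᗮ

theorem mem_annih {n : ℕ} {u : ℕ → EuclideanSpace ℝ (Fin N)} {w : Coords N} :
    w ∈ annih n u ↔ ∀ j, 1 ≤ j → j ≤ n → ∀ i, inner ℝ (rowVec (u j) i) w = 0 := by
  rw [annih, Submodule.mem_orthogonal]
  constructor
  · intro h j h1 hj i
    obtain ⟨l, rfl⟩ : ∃ l, j = l + 1 := ⟨j - 1, by omega⟩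
    exact h _ (Submodule.subset_span ⟨(⟨l, by omega⟩, i), rfl⟩)
  · intro h v hv
    induction hv using Submodule.span_induction with
    | mem y hy =>
      obtain ⟨p, rfl⟩ := hy
      exact h _ (by omega) (by omega) _
    | zero => simp
    | add y z _ _ hy hz => rw [inner_add_left, hy, hz, add_zero]
    | smul c y _ hy => rw [inner_smul_left, hy, mul_zero]

theorem annih_congr {n : ℕ} {u v : ℕ → EuclideanSpace ℝ (Fin N)}
    (h : ∀ j, 1 ≤ j → j ≤ n → u j = v j) : annih n u = annih n v := by
  ext w
  simp only [mem_annih]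
  exact forall_congr' fun j => forall_congr' fun h1 => forall_congr' fun h2 => by rw [h j h1 h2]

theorem annih_zero (u : ℕ → EuclideanSpace ℝ (Fin N)) : annih 0 u = ⊤ := by
  ext w
  simp only [mem_annih, Submodule.mem_top, iff_true]
  omega

theorem annih_anti {n n' : ℕ} (h : n ≤ n') (u : ℕ → EuclideanSpace ℝ (Fin N)) :
    annih n' u ≤ annih n u := fun _ hw =>
  mem_annih.2 fun j h1 hj => mem_annih.1 hw j h1 (hj.trans h)

/-- Elements of `annih n u` annihilate the span of `u 1, …, u n`. -/
theorem inner_rowVec_eq_zero {n : ℕ} {u : ℕ → EuclideanSpace ℝ (Fin N)} {w : Coords N}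
    (hw : w ∈ annih n u) {y : EuclideanSpace ℝ (Fin N)}
    (hy : y ∈ Submodule.span ℝ (u '' Set.Icc 1 n)) (i : Fin N) : inner ℝ (rowVec y i) w = 0 := by
  induction hy using Submodule.span_induction with
  | mem y hy =>
    obtain ⟨j, hj, rfl⟩ := hy
    exact mem_annih.1 hw j hj.1 hj.2 i
  | zero => simp [rowVec_zero]
  | add y z _ _ hy hz => rw [rowVec_add, inner_add_left, hy, hz, add_zero]
  | smul c y _ hy => rw [rowVec_smul, inner_smul_left, hy, mul_zero]

theorem measurable_annih_starProjection {S : Type*} [MeasurableSpace S] (n : ℕ)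
    {u : S → ℕ → EuclideanSpace ℝ (Fin N)} (hu : ∀ j, 1 ≤ j → j ≤ n → Measurable fun s => u s j)
    {x : S → Coords N} (hx : Measurable x) :
    Measurable fun s => (annih n (u s)).starProjection (x s) := by
  unfold annih
  simp only [Submodule.starProjection_orthogonal_val]
  refine hx.sub (measurable_starProjection_span (fun p => ?_) hx)
  exact (measurable_rowVec p.2).comp (hu _ (by omega) (by omega))

/-- The component of `u k` orthogonal to the span of `u 1, …, u (k - 1)`. -/
def orthComp (u : ℕ → EuclideanSpace ℝ (Fin N)) (k : ℕ) : EuclideanSpace ℝ (Fin N) :=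
  u k - (Submodule.span ℝ (u '' Set.Ico 1 k)).starProjection (u k)

open Classical in
/-- The normalized vectors `orthComp u k`. -/
def normComp (u : ℕ → EuclideanSpace ℝ (Fin N)) (k : ℕ) : EuclideanSpace ℝ (Fin N) :=
  if orthComp u k = 0 then WithLp.toLp 2 (fun _ => 1)
  else (nNorm (orthComp u k))⁻¹ • orthComp u k

theorem MIter_eq (β h q : ℝ) (A : Matrix (Fin N) (Fin N) ℝ) (k : ℕ) :
    MIter β h q A k = orthComp (mIter β h q A) k := rfl

theorem phi_eq (β h q : ℝ) (A : Matrix (Fin N) (Fin N) ℝ) (k : ℕ) :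
    phi β h q A k = normComp (mIter β h q A) k := rfl

theorem orthComp_congr {u v : ℕ → EuclideanSpace ℝ (Fin N)} {k : ℕ} (hk : 1 ≤ k)
    (h : ∀ j, 1 ≤ j → j ≤ k → u j = v j) : orthComp u k = orthComp v k := by
  have : u '' Set.Ico 1 k = v '' Set.Ico 1 k :=
    Set.image_congr fun j hj => h j hj.1 hj.2.le
  simp only [orthComp, this, h k hk le_rfl]

theorem normComp_congr {u v : ℕ → EuclideanSpace ℝ (Fin N)} {k : ℕ} (hk : 1 ≤ k)
    (h : ∀ j, 1 ≤ j → j ≤ k → u j = v j) : normComp u k = normComp v k := by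
  rw [normComp, normComp, orthComp_congr hk h]

theorem measurable_orthComp (k : ℕ) :
    Measurable fun u : ℕ → EuclideanSpace ℝ (Fin N) => orthComp u k := by
  have h : ∀ u : ℕ → EuclideanSpace ℝ (Fin N),
      u '' Set.Ico 1 k = Set.range fun j : Fin (k - 1) => u (j + 1) := by
    intro u
    ext y
    constructor
    · rintro ⟨j, hj, rfl⟩
      exact ⟨⟨j - 1, by have := hj.1; have := hj.2; omega⟩,
        by simp [Nat.sub_add_cancel hj.1]⟩
    · rintro ⟨j, rfl⟩
      exact ⟨j + 1, ⟨by omega, by omega⟩, rfl⟩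
  unfold orthComp
  simp only [h]
  refine (measurable_pi_apply k).sub ?_
  exact measurable_starProjection_span (S := ℕ → EuclideanSpace ℝ (Fin N))
    (u := fun (j : Fin (k - 1)) u => u (j + 1)) (x := fun u => u k)
    (fun j => measurable_pi_apply _) (measurable_pi_apply k)

theorem measurable_nNorm : Measurable (nNorm (N := N)) := by
  unfold nNorm nInner
  fun_prop

theorem measurable_normComp (k : ℕ) :
    Measurable fun u : ℕ → EuclideanSpace ℝ (Fin N) => normComp u k := by
  unfold normComp
  exact Measurable.ite (measurable_orthComp k (measurableSet_singleton 0)) measurable_const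
    ((measurable_nNorm.comp (measurable_orthComp k)).inv.smul (measurable_orthComp k))

theorem orthComp_mem_span {u : ℕ → EuclideanSpace ℝ (Fin N)} {k : ℕ} (hk : 1 ≤ k) :
    orthComp u k ∈ Submodule.span ℝ (u '' Set.Icc 1 k) := by
  refine Submodule.sub_mem _ (Submodule.subset_span ⟨k, ⟨hk, le_rfl⟩, rfl⟩) ?_
  exact Submodule.span_mono (Set.image_mono Set.Ico_subset_Icc_self)
    (Submodule.starProjection_apply_mem _ _)

theorem norm_orthComp_le (u : ℕ → EuclideanSpace ℝ (Fin N)) (k : ℕ) :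
    ‖orthComp u k‖ ≤ ‖u k‖ := by
  rw [orthComp, ← Submodule.starProjection_orthogonal_val]
  exact Submodule.norm_starProjection_apply_le _ _

theorem nInner_self (x : EuclideanSpace ℝ (Fin N)) : nInner x x = ‖x‖ ^ 2 / N := by
  rw [EuclideanSpace.real_norm_sq_eq, nInner]
  simp only [pow_two]
  ring

theorem nNorm_sq (x : EuclideanSpace ℝ (Fin N)) : nNorm x ^ 2 = ‖x‖ ^ 2 / N := by
  rw [nNorm, Real.sq_sqrt, nInner_self]
  rw [nInner_self]
  positivity

theorem nNorm_ne_zero {x : EuclideanSpace ℝ (Fin N)} (hx : x ≠ 0) : nNorm x ≠ 0 := by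
  have hN : N ≠ 0 := by
    rintro rfl
    exact hx (Subsingleton.elim _ _)
  rw [← pow_ne_zero_iff two_ne_zero, nNorm_sq]
  have := norm_ne_zero_iff.2 hx
  positivity

theorem orthComp_eq_smul_normComp (u : ℕ → EuclideanSpace ℝ (Fin N)) (k : ℕ) :
    orthComp u k = nNorm (orthComp u k) • normComp u k := by
  by_cases h : orthComp u k = 0
  · simp [h, nNorm, nInner]
  · rw [normComp, if_neg h, smul_smul, mul_inv_cancel₀ (nNorm_ne_zero h), one_smul]

theorem normComp_eq_smul_orthComp (u : ℕ → EuclideanSpace ℝ (Fin N)) (k : ℕ)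
    (h : orthComp u k ≠ 0) : normComp u k = (nNorm (orthComp u k))⁻¹ • orthComp u k := by
  rw [normComp, if_neg h]

end Subspaces


theorem continuous_tanh : Continuous Real.tanh := by
  rw [show Real.tanh = fun x => Real.sinh x / Real.cosh x from
    funext Real.tanh_eq_sinh_div_cosh]
  exact Real.continuous_sinh.div Real.continuous_cosh fun x => (Real.cosh_pos x).ne'

/-! ### The iterates as functions of the coordinates -/

section Iterates

variable {N : ℕ} (β h q : ℝ)

theorem abs_mIter_le (A : Matrix (Fin N) (Fin N) ℝ) (k : ℕ) (i : Fin N) :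
    |mIter β h q A k i| ≤ 1 + √q := by
  have hq := Real.sqrt_nonneg q
  match k with
  | 0 => simp only [mIter, PiLp.zero_apply, abs_zero]; linarith
  | 1 => simp only [mIter, abs_of_nonneg hq]; linarith
  | k + 2 =>
    simp only [mIter, Th]
    have h1 := Real.abs_tanh_lt_one (h + β * ((∑ j, A i j * mIter β h q A (k + 1) j) -
      β * (1 - q) * mIter β h q A k i))
    linarith

theorem norm_mIter_le (A : Matrix (Fin N) (Fin N) ℝ) (k : ℕ) :
    ‖mIter β h q A k‖ ≤ N * (1 + √q) := by
  rw [EuclideanSpace.norm_eq]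
  have h0 : 0 ≤ 1 + √q := by positivity
  refine Real.sqrt_le_iff.2 ⟨by positivity, ?_⟩
  calc ∑ i, ‖mIter β h q A k i‖ ^ 2 ≤ ∑ _i : Fin N, (1 + √q) ^ 2 :=
        Finset.sum_le_sum fun i _ => pow_le_pow_left₀ (norm_nonneg _) (abs_mIter_le β h q A k i) 2
    _ = N * (1 + √q) ^ 2 := by simp
    _ ≤ (N * (1 + √q)) ^ 2 := by
        rw [mul_pow]
        refine mul_le_mul_of_nonneg_right ?_ (by positivity)
        rcases Nat.eq_zero_or_pos N with rfl | hN
        · simp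
        · exact le_self_pow₀ (by exact_mod_cast hN) two_ne_zero

theorem measurable_mIter (k : ℕ) :
    Measurable fun x : Coords N => mIter β h q (toMat x) k := by
  induction k using Nat.strong_induction_on with
  | _ k ih =>
    match k with
    | 0 => exact measurable_const
    | 1 => exact measurable_const
    | k + 2 =>
      have h1 := ih (k + 1) (by omega)
      have h2 := ih k (by omega)
      have ht : Measurable Real.tanh := continuous_tanh.measurable
      have h1' : ∀ j, Measurable fun x : Coords N => mIter β h q (toMat x) (k + 1) j :=
        fun j => (by fun_prop : Measurable fun y : EuclideanSpace ℝ (Fin N) => y j).comp h1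
      have h2' : ∀ j, Measurable fun x : Coords N => mIter β h q (toMat x) k j :=
        fun j => (by fun_prop : Measurable fun y : EuclideanSpace ℝ (Fin N) => y j).comp h2
      simp only [mIter, Th]
      refine (WithLp.measurable_toLp 2 _).comp (measurable_pi_lambda _ fun i => ht.comp ?_)
      refine measurable_const.add (measurable_const.mul (Measurable.sub ?_ ?_))
      · exact Finset.measurable_fun_sum _ fun j _ => (measurable_toMat i j).mul (h1' j)
      · exact measurable_const.mul (h2' i)

/-- The iterates do not change if one adds a matrix that annihilates the previous ones. -/
theorem mIter_add {n : ℕ} {x w : Coords N} (hw : w ∈ annih n (mIter β h q (toMat x))) (j : ℕ)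
    (hj : j ≤ n + 1) : mIter β h q (toMat (x + w)) j = mIter β h q (toMat x) j := by
  induction j using Nat.strong_induction_on with
  | _ j ih =>
    match j with
    | 0 => rfl
    | 1 => rfl
    | j + 2 =>
      simp only [mIter]
      rw [ih (j + 1) (by omega) (by omega), ih j (by omega) (by omega)]
      have h0 : ∀ i, ∑ l, toMat (x + w) i l * mIter β h q (toMat x) (j + 1) l =
          ∑ l, toMat x i l * mIter β h q (toMat x) (j + 1) l := by
        intro i
        have := mem_annih.1 hw (j + 1) (by omega) (by omega) i
        rw [inner_rowVec] at this
        simp only [toMat_add, add_mul, Finset.sum_add_distrib, this, add_zero]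
      simp only [h0]

theorem annih_add {n k : ℕ} {x w : Coords N} (hw : w ∈ annih n (mIter β h q (toMat x)))
    (hk : k ≤ n + 1) :
    annih k (mIter β h q (toMat (x + w))) = annih k (mIter β h q (toMat x)) :=
  annih_congr fun j _ hj => mIter_add β h q hw j (hj.trans hk)

/-- For n = 0 everything is resampled. In the induction step, adding elements of `annih n` keeps the
iterates up to index n + 1, hence keeps `annih (n + 1)`, as `ResampleInvariant.step` requires. -/
theorem resampleInvariant_annih (c : ℝ) (n : ℕ) :
    ResampleInvariant (isoGaussian (Coords N) c) fun x => annih n (mIter β h q (toMat x)) := by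
  induction n with
  | zero => simpa only [annih_zero] using resampleInvariant_top c
  | succ n ih =>
    refine ih.step ?_ (fun x => annih_anti n.le_succ _) fun x w hw => annih_add β h q hw le_rfl
    exact measurable_annih_starProjection (S := Coords N × Coords N) (n + 1)
      (u := fun p => mIter β h q (toMat p.1))
      (fun j _ _ => (measurable_mIter β h q j).comp measurable_fst) measurable_snd

/-- The sequence of the iterates with indices `1, …, n`, followed by zeros. -/
def mTrunc (n : ℕ) (x : Coords N) (j : ℕ) : EuclideanSpace ℝ (Fin N) :=
  if 1 ≤ j ∧ j ≤ n then mIter β h q (toMat x) j else 0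

/-- `V` is a measurable function of the first `n` iterates. -/
def IsFunOfIterates {α : Type*} [MeasurableSpace α] (n : ℕ) (V : Coords N → α) : Prop :=
  ∃ Φ : (ℕ → EuclideanSpace ℝ (Fin N)) → α, Measurable Φ ∧ ∀ x, V x = Φ (mTrunc β h q n x)

variable {β h q}

theorem mTrunc_of_le {n j : ℕ} (x : Coords N) (h1 : 1 ≤ j) (hj : j ≤ n) :
    mTrunc β h q n x j = mIter β h q (toMat x) j := by
  rw [mTrunc, if_pos ⟨h1, hj⟩]

theorem measurable_mTrunc (n : ℕ) : Measurable (mTrunc (N := N) β h q n) := by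
  refine measurable_pi_lambda _ fun j => ?_
  by_cases hj : 1 ≤ j ∧ j ≤ n
  · simpa only [mTrunc, hj, and_self, if_true] using measurable_mIter β h q j
  · simpa only [mTrunc, hj, if_false] using measurable_const

section

variable {α γ : Type*} [MeasurableSpace α] [MeasurableSpace γ]

theorem isFunOfIterates_const (n : ℕ) (a : α) : IsFunOfIterates (N := N) β h q n fun _ => a :=
  ⟨fun _ => a, measurable_const, fun _ => rfl⟩

theorem IsFunOfIterates.comp {n : ℕ} {V : Coords N → α} (hV : IsFunOfIterates β h q n V)
    {g : α → γ} (hg : Measurable g) : IsFunOfIterates β h q n fun x => g (V x) := by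
  obtain ⟨Φ, hΦ, hV⟩ := hV
  exact ⟨fun u => g (Φ u), hg.comp hΦ, fun x => congrArg g (hV x)⟩

theorem IsFunOfIterates.prodMk {n : ℕ} {V : Coords N → α} {U : Coords N → γ}
    (hV : IsFunOfIterates β h q n V) (hU : IsFunOfIterates β h q n U) :
    IsFunOfIterates β h q n fun x => (V x, U x) := by
  obtain ⟨Φ, hΦ, hV⟩ := hV
  obtain ⟨Ψ, hΨ, hU⟩ := hU
  exact ⟨fun u => (Φ u, Ψ u), hΦ.prodMk hΨ, fun x => Prod.ext (hV x) (hU x)⟩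

theorem IsFunOfIterates.measurable {n : ℕ} {V : Coords N → α} (hV : IsFunOfIterates β h q n V) :
    Measurable V := by
  obtain ⟨Φ, hΦ, hV⟩ := hV
  rw [funext hV]
  exact hΦ.comp (measurable_mTrunc n)

/-- The gap between n and n + 1 is essential: iterate n + 1 uses the matrix only through its
products with the first n iterates, so it too is fixed by `annih n`. -/
theorem IsFunOfIterates.add_eq {n : ℕ} {V : Coords N → α} (hV : IsFunOfIterates β h q (n + 1) V)
    {x w : Coords N} (hw : w ∈ annih n (mIter β h q (toMat x))) : V (x + w) = V x := by
  obtain ⟨Φ, -, hV⟩ := hV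
  rw [hV, hV]
  congr 1
  ext1 j
  unfold mTrunc
  split_ifs with hj
  · exact mIter_add β h q hw j hj.2
  · rfl

theorem isFunOfIterates_orthComp {n k : ℕ} (h1 : 1 ≤ k) (hk : k ≤ n) :
    IsFunOfIterates β h q n fun x : Coords N => orthComp (mIter β h q (toMat x)) k :=
  ⟨fun u => orthComp u k, measurable_orthComp k, fun x => orthComp_congr h1 fun _ h1 hj =>
    (mTrunc_of_le x h1 (hj.trans hk)).symm⟩

theorem isFunOfIterates_normComp {n k : ℕ} (h1 : 1 ≤ k) (hk : k ≤ n) :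
    IsFunOfIterates β h q n fun x : Coords N => normComp (mIter β h q (toMat x)) k :=
  ⟨fun u => normComp u k, measurable_normComp k, fun x => normComp_congr h1 fun _ h1 hj =>
    (mTrunc_of_le x h1 (hj.trans hk)).symm⟩

theorem IsFunOfIterates.starProjection {n k : ℕ} (hk : k ≤ n) {V : Coords N → Coords N}
    (hV : IsFunOfIterates β h q n V) :
    IsFunOfIterates β h q n fun x => (annih k (mIter β h q (toMat x))).starProjection (V x) := by
  obtain ⟨Φ, hΦ, hV⟩ := hV
  refine ⟨fun u => (annih k u).starProjection (Φ u), measurable_annih_starProjection k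
    (fun j _ _ => measurable_pi_apply j) hΦ, fun x => ?_⟩
  have : annih k (mIter β h q (toMat x)) = annih k (mTrunc β h q n x) :=
    annih_congr fun j h1 hj => (mTrunc_of_le x h1 (hj.trans hk)).symm
  simp only [hV, this]

end

end Iterates

/-! ### Measurability up to null sets -/

section AEMeas

variable {Ω : Type*}

/-- `f` agrees almost everywhere with an `F`-measurable function. -/
def AEMeas {α : Type*} [MeasurableSpace α] (F : MeasurableSpace Ω) {mΩ : MeasurableSpace Ω}
    (μ : Measure Ω) (f : Ω → α) : Prop :=
  ∃ f' : Ω → α, Measurable[F] f' ∧ f =ᵐ[μ] f'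

variable {F F' mΩ : MeasurableSpace Ω} {μ : Measure Ω} {α γ : Type*} [MeasurableSpace α]
  [MeasurableSpace γ]

theorem AEMeas.of_measurable {f : Ω → α} (h : Measurable[F] f) : AEMeas F μ f :=
  ⟨f, h, Filter.EventuallyEq.rfl⟩

theorem AEMeas.mono {f : Ω → α} (h : AEMeas F μ f) (hF : F ≤ F') : AEMeas F' μ f := by
  obtain ⟨f', h1, h2⟩ := h
  exact ⟨f', fun s hs => hF _ (h1 hs), h2⟩

theorem AEMeas.congr {f g : Ω → α} (h : AEMeas F μ f) (hg : g =ᵐ[μ] f) : AEMeas F μ g := by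
  obtain ⟨f', h1, h2⟩ := h
  exact ⟨f', h1, hg.trans h2⟩

theorem AEMeas.comp {f : Ω → α} (h : AEMeas F μ f) {g : α → γ} (hg : Measurable g) :
    AEMeas F μ fun ω => g (f ω) := by
  obtain ⟨f', h1, h2⟩ := h
  exact ⟨fun ω => g (f' ω), fun s hs => h1 (hg hs), h2.mono fun ω hω => by simp only [hω]⟩

theorem AEMeas.pi {ι : Type*} [Countable ι] {f : ι → Ω → α} (h : ∀ i, AEMeas F μ (f i)) :
    AEMeas F μ fun ω i => f i ω := by
  choose f' h1 h2 using h
  refine ⟨fun ω i => f' i ω, @measurable_pi_lambda _ _ _ F _ _ h1, ?_⟩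
  filter_upwards [ae_all_iff.2 h2] with ω hω
  exact funext hω

theorem AEMeas.prodMk {f : Ω → α} {g : Ω → γ} (hf : AEMeas F μ f) (hg : AEMeas F μ g) :
    AEMeas F μ fun ω => (f ω, g ω) := by
  obtain ⟨f', h1, h2⟩ := hf
  obtain ⟨g', h3, h4⟩ := hg
  refine ⟨fun ω => (f' ω, g' ω), Measurable.prodMk (m := F) h1 h3, ?_⟩
  filter_upwards [h2, h4] with ω h5 h6
  rw [h5, h6]

theorem AEMeas.add {f g : Ω → ℝ} (hf : AEMeas F μ f) (hg : AEMeas F μ g) :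
    AEMeas F μ fun ω => f ω + g ω :=
  (hf.prodMk hg).comp measurable_add

theorem AEMeas.mul {f g : Ω → ℝ} (hf : AEMeas F μ f) (hg : AEMeas F μ g) :
    AEMeas F μ fun ω => f ω * g ω :=
  (hf.prodMk hg).comp measurable_mul

theorem AEMeas.sum {ι : Type*} [Fintype ι] {f : ι → Ω → ℝ} (hf : ∀ i, AEMeas F μ (f i)) :
    AEMeas F μ fun ω => ∑ i, f i ω :=
  (AEMeas.pi hf).comp (g := fun v : ι → ℝ => ∑ i, v i) (by fun_prop)

theorem AEMeas.aestronglyMeasurable {f : Ω → ℝ} (hf : AEMeas F μ f) :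
    AEStronglyMeasurable[F] f μ := by
  obtain ⟨f', h1, h2⟩ := hf
  exact ⟨f', h1.stronglyMeasurable, h2⟩

theorem IsFunOfIterates.aemeas {N : ℕ} {β h q : ℝ} {X : Ω → Coords N} {n : ℕ}
    (hX : ∀ j, 1 ≤ j → j ≤ n → AEMeas F μ fun ω => mIter β h q (toMat (X ω)) j)
    {V : Coords N → α} (hV : IsFunOfIterates β h q n V) : AEMeas F μ fun ω => V (X ω) := by
  obtain ⟨Φ, hΦ, hV⟩ := hV
  simp only [hV]
  refine AEMeas.comp ?_ hΦ
  refine AEMeas.pi (f := fun j ω => mTrunc β h q n (X ω) j) fun j => ?_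
  by_cases hj : 1 ≤ j ∧ j ≤ n
  · simpa only [mTrunc, hj, and_self, if_true] using hX j hj.1 hj.2
  · simpa only [mTrunc, hj, if_false] using .of_measurable (@measurable_const _ _ _ F _)

end AEMeas

/-! ### Conditional expectations by resampling -/

section CondExp

variable {N : ℕ} {Ω : Type*} {F mΩ : MeasurableSpace Ω} {μ : Measure Ω}

/-- The σ-field of the sets that are invariant under adding elements of `annih n`. -/
@[reducible] def invSpace (β h q : ℝ) (N n : ℕ) : MeasurableSpace (Coords N) where
  MeasurableSet' s := MeasurableSet s ∧
    ∀ x, ∀ w ∈ annih n (mIter β h q (toMat x)), x + w ∈ s ↔ x ∈ s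
  measurableSet_empty := by simp
  measurableSet_compl s hs := ⟨hs.1.compl, fun x w hw => not_congr (hs.2 x w hw)⟩
  measurableSet_iUnion f hf := ⟨MeasurableSet.iUnion fun i => (hf i).1, fun x w hw => by
    simp only [Set.mem_iUnion]
    exact exists_congr fun i => (hf i).2 x w hw⟩

/-- The σ-field of the events that are invariant up to null sets. -/
@[reducible] def invEvents (β h q : ℝ) (n : ℕ) (μ : Measure Ω) (X : Ω → Coords N) :
    MeasurableSpace Ω :=
  @eventuallyMeasurableSpace Ω ((invSpace β h q N n).comap X) (ae μ) _

theorem invSpace_mono {β h q : ℝ} {n n' : ℕ} (hn : n ≤ n') :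
    invSpace β h q N n ≤ invSpace β h q N n' := fun _ hs =>
  ⟨hs.1, fun x w hw => hs.2 x w (annih_anti hn _ hw)⟩

theorem invEvents_mono {β h q : ℝ} {n n' : ℕ} (hn : n ≤ n') (X : Ω → Coords N) :
    invEvents β h q n μ X ≤ invEvents β h q n' μ X := by
  rintro s ⟨t, ⟨B, hB, rfl⟩, hs⟩
  exact ⟨X ⁻¹' B, ⟨B, invSpace_mono hn _ hB, rfl⟩, hs⟩

theorem comap_le_invEvents {α : Type*} [MeasurableSpace α] {β h q : ℝ} {n : ℕ} {X : Ω → Coords N}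
    {z : Ω → α} {ζ : Coords N → α} (hz : z =ᵐ[μ] fun ω => ζ (X ω)) (hζ : Measurable ζ)
    (hinv : ∀ x, ∀ w ∈ annih n (mIter β h q (toMat x)), ζ (x + w) = ζ x) :
    MeasurableSpace.comap z inferInstance ≤ invEvents β h q n μ X := by
  rintro s ⟨B, hB, rfl⟩
  refine ⟨X ⁻¹' (ζ ⁻¹' B), ⟨ζ ⁻¹' B, ⟨hζ hB, fun x w hw => ?_⟩, rfl⟩, ?_⟩
  · simp only [Set.mem_preimage, hinv x w hw]
  · exact hz.preimage B

/-- An event of F is, up to a null set, X ∈ B with B invariant under resampling. Resampling in ∫_B f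
therefore acts on f alone, and integrating out the fresh noise first gives ∫_B r. -/
theorem condExp_eq_of_resample [IsProbabilityMeasure μ] {β h q c : ℝ} {n : ℕ} {X : Ω → Coords N} (hX : Measurable X)
    (hlaw : μ.map X = isoGaussian (Coords N) c) (hF : F ≤ mΩ)
    (hFinv : F ≤ invEvents β h q n μ X) {f r : Coords N → ℝ}
    (hfi : Integrable f (isoGaussian (Coords N) c))
    (hr : ∀ x, ∫ ξ, f (resample (fun x => annih n (mIter β h q (toMat x))) (x, ξ))
      ∂(isoGaussian (Coords N) c) = r x)
    (hrF : AEMeas F μ fun ω => r (X ω)) :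
    μ[fun ω => f (X ω) | F] =ᵐ[μ] fun ω => r (X ω) := by
  set ν := isoGaussian (Coords N) c
  obtain ⟨hm, hR⟩ := resampleInvariant_annih (N := N) β h q c n
  set W : Coords N → Submodule ℝ (Coords N) := fun x => annih n (mIter β h q (toMat x))
  have hmr := measurable_resample hm
  change (ν.prod ν).map (resample W) = ν at hR
  have hfR : Integrable (fun p => f (resample W p)) (ν.prod ν) := by
    have : Integrable f ((ν.prod ν).map (resample W)) := by rwa [hR]
    exact this.comp_measurable hmr
  have hri : Integrable r ν := by
    have := hfR.integral_prod_left
    simp only [hr] at this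
    exact this
  have hcomp : ∀ {k : Coords N → ℝ}, Integrable k ν → Integrable (fun ω => k (X ω)) μ := by
    intro k hk
    rw [← hlaw] at hk
    exact hk.comp_measurable hX
  have hset : ∀ {k : Coords N → ℝ}, Integrable k ν → ∀ {A : Set Ω} {B : Set (Coords N)},
      MeasurableSet B → A =ᵐ[μ] X ⁻¹' B → ∫ ω in A, k (X ω) ∂μ = ∫ x in B, k x ∂ν := by
    intro k hk A B hB hAB
    rw [setIntegral_congr_set hAB, ← hlaw, setIntegral_map hB _ hX.aemeasurable]
    rw [hlaw]
    exact hk.aestronglyMeasurable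
  refine (ae_eq_condExp_of_forall_setIntegral_eq hF (hcomp hfi)
    (fun A _ _ => (hcomp hri).integrableOn) (fun A hA _ => ?_) hrF.aestronglyMeasurable).symm
  obtain ⟨_, ⟨B, hB, rfl⟩, hAB⟩ := hFinv _ hA
  rw [hset hri hB.1 hAB, hset hfi hB.1 hAB, ← integral_indicator hB.1, ← integral_indicator hB.1]
  have hBf : Integrable (B.indicator f) ν := hfi.indicator hB.1
  have h1 : ∫ x, B.indicator f x ∂ν = ∫ p, B.indicator f (resample W p) ∂(ν.prod ν) := by
    conv_lhs => rw [← hR]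
    rw [integral_map hmr.aemeasurable]
    rw [hR]
    exact hBf.aestronglyMeasurable
  have h2 : Integrable (fun p => B.indicator f (resample W p)) (ν.prod ν) := by
    have : Integrable (B.indicator f) ((ν.prod ν).map (resample W)) := by rwa [hR]
    exact this.comp_measurable hmr
  rw [h1, integral_prod _ h2]
  congr 1 with x
  have h3 : ∀ ξ, resample W (x, ξ) ∈ B ↔ x ∈ B := fun ξ =>
    hB.2 x _ (Submodule.starProjection_apply_mem _ _)
  by_cases hx : x ∈ B
  · simp only [Set.indicator_of_mem hx, Set.indicator_of_mem ((h3 _).2 hx), hr]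
  · simp only [Set.indicator_of_notMem hx, Set.indicator_of_notMem (mt (h3 _).1 hx),
      integral_zero]

/-- The variables `⟪P V, X⟫`, with `V` a bounded function of the iterates, have finite moments. -/
theorem memLp_inner_of_bounded {c C : ℝ} {V : Coords N → Coords N} (hV : Measurable V)
    (hC : ∀ x, ‖V x‖ ≤ C) {p : ENNReal} (hp : p ≠ ⊤) :
    MemLp (fun x => inner ℝ (V x) x) p (isoGaussian (Coords N) c) := by
  refine ((memLp_isoGaussian (E := Coords N) c hp).norm.const_mul C).mono
    (hV.inner measurable_id).aestronglyMeasurable (.of_forall fun x => ?_)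
  calc ‖inner ℝ (V x) x‖ ≤ ‖V x‖ * ‖x‖ := norm_inner_le_norm _ _
    _ ≤ C * ‖x‖ := by gcongr; exact hC x
    _ ≤ ‖C * ‖x‖‖ := le_abs_self _

/-- Resampling freezes V and U, as they depend only on the first n + 1 iterates. Since their values
lie in `annih n`, their inner products with the resampled point see only the fresh Gaussian ξ, whose
covariance is c² times the identity. -/
theorem condExp_inner_mul_inner [IsProbabilityMeasure μ] {β h q c : ℝ} {n : ℕ} {X : Ω → Coords N} (hX : Measurable X)
    (hlaw : μ.map X = isoGaussian (Coords N) c) (hF : F ≤ mΩ)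
    (hFinv : F ≤ invEvents β h q n μ X)
    (hm : ∀ j, 1 ≤ j → j ≤ n + 1 → AEMeas F μ fun ω => mIter β h q (toMat (X ω)) j)
    {V U : Coords N → Coords N} (hV : IsFunOfIterates β h q (n + 1) V)
    (hU : IsFunOfIterates β h q (n + 1) U) {C : ℝ} (hVC : ∀ x, ‖V x‖ ≤ C) (hUC : ∀ x, ‖U x‖ ≤ C)
    (hVm : ∀ x, V x ∈ annih n (mIter β h q (toMat x)))
    (hUm : ∀ x, U x ∈ annih n (mIter β h q (toMat x))) :
    μ[fun ω => inner ℝ (V (X ω)) (X ω) * inner ℝ (U (X ω)) (X ω) | F] =ᵐ[μ]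
      fun ω => c ^ 2 * inner ℝ (V (X ω)) (U (X ω)) := by
  have hVU := hV.prodMk hU
  refine condExp_eq_of_resample (β := β) (h := h) (q := q) (n := n)
    (f := fun x => inner ℝ (V x) x * inner ℝ (U x) x) (r := fun x => c ^ 2 * inner ℝ (V x) (U x))
    hX hlaw hF hFinv
    ((memLp_inner_of_bounded (p := 2) hV.measurable hVC ENNReal.ofNat_ne_top).integrable_mul
      (memLp_inner_of_bounded (p := 2) hU.measurable hUC ENNReal.ofNat_ne_top)) (fun x => ?_) ?_
  · have key : ∀ {V : Coords N → Coords N}, IsFunOfIterates β h q (n + 1) V →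
        (∀ x, V x ∈ annih n (mIter β h q (toMat x))) → ∀ ξ,
        inner ℝ (V (resample (fun x => annih n (mIter β h q (toMat x))) (x, ξ)))
          (resample (fun x => annih n (mIter β h q (toMat x))) (x, ξ)) = inner ℝ (V x) ξ := by
      intro V hV hVm ξ
      have h1 : V (resample (fun x => annih n (mIter β h q (toMat x))) (x, ξ)) = V x :=
        hV.add_eq (Submodule.starProjection_apply_mem _ _)
      rw [h1, resample, inner_add_right, ← Submodule.inner_starProjection_left_eq_right,
        Submodule.starProjection_eq_self_iff.2 (hVm x), inner_sub_right]
      ring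
    simp only [key hV hVm, key hU hUm]
    exact integral_inner_mul_inner_isoGaussian c (V x) (U x)
  · exact IsFunOfIterates.aemeas hm
      (hVU.comp (g := fun p : Coords N × Coords N => c ^ 2 * inner ℝ p.1 p.2) (by fun_prop))

end CondExp


/-! ### Conditional linear projections -/

section CondProj

variable {Ω : Type*} {G mΩ : MeasurableSpace Ω} {μ : Measure Ω} [IsProbabilityMeasure μ] {N : ℕ}

/-- The event that all coefficients are at most `n` in absolute value. -/
def coeffBall (c : Fin N → Ω → ℝ) (n : ℕ) : Set Ω := {ω | ∀ i, |c i ω| ≤ n}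

theorem measurableSet_coeffBall {c : Fin N → Ω → ℝ} (hc : ∀ i, Measurable[G] (c i)) (n : ℕ) :
    MeasurableSet[G] (coeffBall c n) := by
  have : coeffBall c n = ⋂ i, {ω | |c i ω| ≤ n} := by
    ext ω
    simp [coeffBall]
  rw [this]
  exact MeasurableSet.iInter fun i => measurableSet_le (hc i).abs measurable_const

theorem exists_mem_coeffBall (c : Fin N → Ω → ℝ) (ω : Ω) : ∃ n, ω ∈ coeffBall c n := by
  obtain ⟨n, hn⟩ := exists_nat_ge (∑ i, |c i ω|)
  exact ⟨n, fun i => (Finset.single_le_sum (f := fun i => |c i ω|) (fun j _ => abs_nonneg _)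
    (Finset.mem_univ i)).trans hn⟩

theorem abs_indicator_coeffBall_le (c : Fin N → Ω → ℝ) (n : ℕ) (i : Fin N) (ω : Ω) :
    ‖(coeffBall c n).indicator (c i) ω‖ ≤ n := by
  by_cases h : ω ∈ coeffBall c n
  · rw [Set.indicator_of_mem h]
    exact h i
  · simp [Set.indicator_of_notMem h]

theorem indicator_sum_mul (s : Set Ω) (c : Fin N → Ω → ℝ) (z : Ω → Fin N → ℝ) (ω : Ω) :
    s.indicator (fun ω => ∑ i, c i ω * z ω i) ω = ∑ i, s.indicator (c i) ω * z ω i := by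
  by_cases h : ω ∈ s
  · simp only [Set.indicator_of_mem h]
  · simp only [Set.indicator_of_notMem h, zero_mul, Finset.sum_const_zero]

-- The coefficients of U may be unbounded. They are bounded on the G-measurable events `coeffBall c
-- n`, where they can be pulled out of the conditional expectation, and these events exhaust Ω.
omit [IsProbabilityMeasure μ] in
theorem condExp_mul_condSpan_eq_zero (hG : G ≤ mΩ) {z : Ω → Fin N → ℝ}
    {r U : Ω → ℝ} (hrz : ∀ i, Integrable (fun ω => r ω * z ω i) μ)
    (hr : ∀ i, μ[fun ω => r ω * z ω i | G] =ᵐ[μ] 0) (hU : U ∈ condSpan G z)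
    (hUi : Integrable (fun ω => r ω * U ω) μ) : μ[fun ω => r ω * U ω | G] =ᵐ[μ] 0 := by
  obtain ⟨c, hc, rfl⟩ := hU
  have key : ∀ n : ℕ, (coeffBall c n).indicator
      (μ[fun ω => r ω * ∑ i, c i ω * z ω i | G]) =ᵐ[μ] 0 := by
    intro n
    have hs := measurableSet_coeffBall hc n
    have hci : ∀ i, Measurable[G] ((coeffBall c n).indicator (c i)) := fun i =>
      (hc i).indicator hs
    refine (condExp_indicator hUi hs).symm.trans ?_
    have h1 : (coeffBall c n).indicator (fun ω => r ω * ∑ i, c i ω * z ω i) =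
        ∑ i, fun ω => (coeffBall c n).indicator (c i) ω * (r ω * z ω i) := by
      ext ω
      rw [Finset.sum_apply]
      by_cases h : ω ∈ coeffBall c n
      · simp only [Set.indicator_of_mem h, Finset.mul_sum]
        exact Finset.sum_congr rfl fun i _ => by ring
      · simp [Set.indicator_of_notMem h]
    have h2 : ∀ i, Integrable (fun ω => (coeffBall c n).indicator (c i) ω * (r ω * z ω i)) μ :=
      fun i => (hrz i).bdd_mul ((hci i).mono hG le_rfl).aestronglyMeasurable
        (.of_forall (abs_indicator_coeffBall_le c n i))
    rw [h1]
    refine (condExp_finsetSum (fun i _ => h2 i) G).trans ?_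
    have h3 : ∀ i, μ[fun ω => (coeffBall c n).indicator (c i) ω * (r ω * z ω i) | G] =ᵐ[μ] 0 := by
      intro i
      refine (condExp_mul_of_stronglyMeasurable_left (hci i).stronglyMeasurable (h2 i)
        (hrz i)).trans ?_
      filter_upwards [hr i] with ω hω
      simp [hω]
    filter_upwards [ae_all_iff.2 h3] with ω hω
    simp [Finset.sum_apply, hω]
  filter_upwards [ae_all_iff.2 key] with ω hω
  obtain ⟨n, hn⟩ := exists_mem_coeffBall c ω
  simpa [Set.indicator_of_mem hn] using hω n

omit [IsProbabilityMeasure μ] in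
-- No existence of a projection is needed: the default value 0 also lies in the span.
theorem condProj_mem_condSpan (z : Ω → Fin N → ℝ) (y : Ω → ℝ) :
    condProj G μ (condSpan G z) y ∈ condSpan G z := by
  unfold condProj
  split_ifs with hp
  · exact hp.choose_spec.1
  · exact ⟨fun _ _ => 0, fun _ => measurable_const, by ext; simp⟩

/-- If `y` is the sum of an element of the span and of a conditionally uncorrelated variable `r`,
then `r` is the residual of the conditional projection. -/
theorem sub_condProj_ae_eq (hG : G ≤ mΩ) {z : Ω → Fin N → ℝ}
    (hz : ∀ i, MemLp (fun ω => z ω i) 2 μ) {y r : Ω → ℝ} (hr : MemLp r 2 μ)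
    {a : Fin N → Ω → ℝ} (ha : ∀ i, AEMeas G μ (a i))
    (hyr : y =ᵐ[μ] fun ω => r ω + ∑ i, a i ω * z ω i)
    (hrz : ∀ i, μ[fun ω => r ω * z ω i | G] =ᵐ[μ] 0) :
    (fun ω => y ω - condProj G μ (condSpan G z) y ω) =ᵐ[μ] r := by
  have hrzi : ∀ i, Integrable (fun ω => r ω * z ω i) μ := fun i => hr.integrable_mul (hz i)
  choose a' ha' haa' using ha
  set p₀ : Ω → ℝ := fun ω => ∑ i, a' i ω * z ω i with hp₀
  have hyp : (fun ω => y ω - p₀ ω) =ᵐ[μ] r := by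
    filter_upwards [hyr, ae_all_iff.2 haa'] with ω h1 h2
    simp only [h1, hp₀, h2]
    ring
  have hex : ∃ p, IsCondProj G μ (condSpan G z) y p := by
    refine ⟨p₀, ⟨a', ha', rfl⟩, fun U hU hUi => ?_⟩
    have h1 : (fun ω => (y ω - p₀ ω) * U ω) =ᵐ[μ] fun ω => r ω * U ω :=
      hyp.mono fun ω hω => by simp only [hω]
    exact (condExp_congr_ae h1).trans
      (condExp_mul_condSpan_eq_zero hG hrzi hrz hU (hUi.congr h1))
  obtain ⟨⟨b, hb, hpb⟩, hp⟩ :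
      IsCondProj G μ (condSpan G z) y (condProj G μ (condSpan G z) y) := by
    unfold condProj
    rw [dif_pos hex]
    exact hex.choose_spec
  set p := condProj G μ (condSpan G z) y
  let c : Fin N → Ω → ℝ := fun i ω => a' i ω - b i ω
  have hc : ∀ i, Measurable[G] (c i) := fun i => (ha' i).sub (hb i)
  have hd : ∀ ω, p₀ ω - p ω = ∑ i, c i ω * z ω i := fun ω => by
    simp only [hp₀, hpb, c, sub_mul, Finset.sum_sub_distrib]
  -- Uniqueness of the projection: the difference of the two candidates, cut off to a `coeffBall`,
  -- is itself an admissible test variable U. Orthogonality for p gives E (r + U) U = 0,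
  -- orthogonality for p₀ gives E r U = 0, hence E U² = 0.
  have key : ∀ n : ℕ, (coeffBall c n).indicator (fun ω => ∑ i, c i ω * z ω i) =ᵐ[μ] 0 := by
    intro n
    have hs := measurableSet_coeffBall hc n
    have hci : ∀ i, Measurable[G] ((coeffBall c n).indicator (c i)) := fun i =>
      (hc i).indicator hs
    set U : Ω → ℝ := (coeffBall c n).indicator (fun ω => ∑ i, c i ω * z ω i)
    have hUsum : U = fun ω => ∑ i, (coeffBall c n).indicator (c i) ω * z ω i :=
      funext (indicator_sum_mul _ c z)
    have hU : U ∈ condSpan G z := ⟨_, hci, hUsum⟩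
    have hUL : MemLp U 2 μ := by
      rw [hUsum]
      refine memLp_finsetSum _ fun i _ => ?_
      refine ((hz i).norm.const_mul (n : ℝ)).mono
        (((hci i).mono hG le_rfl).aestronglyMeasurable.mul (hz i).1) (.of_forall fun ω => ?_)
      rw [norm_mul, norm_mul, norm_norm, Real.norm_of_nonneg (Nat.cast_nonneg n)]
      exact mul_le_mul_of_nonneg_right (abs_indicator_coeffBall_le c n i ω) (norm_nonneg _)
    have hrU : Integrable (fun ω => r ω * U ω) μ := hr.integrable_mul hUL
    have hUU : Integrable (fun ω => U ω * U ω) μ := hUL.integrable_mul hUL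
    have h1 : (fun ω => (y ω - p ω) * U ω) =ᵐ[μ] fun ω => r ω * U ω + U ω * U ω := by
      filter_upwards [hyp] with ω hω
      have h2 : (p₀ ω - p ω) * U ω = U ω * U ω := by
        by_cases h : ω ∈ coeffBall c n
        · simp only [U, Set.indicator_of_mem h, hd]
        · simp only [U, Set.indicator_of_notMem h, mul_zero]
      rw [← h2, ← hω]
      ring
    have h3 : ∫ ω, (y ω - p ω) * U ω ∂μ = 0 := by
      rw [← integral_condExp hG, integral_congr_ae (hp U hU ((hrU.add hUU).congr h1.symm))]
      simp
    have h4 : ∫ ω, r ω * U ω ∂μ = 0 := by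
      rw [← integral_condExp hG,
        integral_congr_ae (condExp_mul_condSpan_eq_zero hG hrzi hrz hU hrU)]
      simp
    rw [integral_congr_ae h1, integral_add hrU hUU, h4, zero_add,
      integral_eq_zero_iff_of_nonneg (fun ω => mul_self_nonneg _) hUU] at h3
    filter_upwards [h3] with ω hω
    exact mul_self_eq_zero.1 hω
  filter_upwards [hyp, ae_all_iff.2 key] with ω h1 h2
  obtain ⟨n, hn⟩ := exists_mem_coeffBall c ω
  have h3 := h2 n
  rw [Set.indicator_of_mem hn, ← hd] at h3
  have h4 : p₀ ω - p ω = 0 := h3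
  linarith

end CondProj


/-! ### The modified matrices as projections of the original one -/

section Stages

variable {N : ℕ}

/-- Inside `annih n u`, the subspace `annih (n + 1) u` is the orthogonal complement of the projected
row vectors of `orthComp u (n + 1)`; replacing u (n + 1) by its orthogonal component is harmless
because the remainder is annihilated already. This matches one step in the recursion for g⁽ᵏ⁾. -/
theorem starProjection_annih_succ {u : ℕ → EuclideanSpace ℝ (Fin N)} {n : ℕ} {e : Coords N}
    {a : Fin N → ℝ}
    (ha : ∀ j, inner ℝ ((annih n u).starProjection (rowVec (orthComp u (n + 1)) j))
      ((annih n u).starProjection e -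
        ∑ i, a i • (annih n u).starProjection (rowVec (orthComp u (n + 1)) i)) = 0) :
    (annih (n + 1) u).starProjection e = (annih n u).starProjection e -
      ∑ i, a i • (annih n u).starProjection (rowVec (orthComp u (n + 1)) i) := by
  set r := (annih n u).starProjection e -
    ∑ i, a i • (annih n u).starProjection (rowVec (orthComp u (n + 1)) i) with hr
  have hrn : r ∈ annih n u := Submodule.sub_mem _ (Submodule.starProjection_apply_mem _ _)
    (Submodule.sum_mem _ fun i _ => Submodule.smul_mem _ _ (Submodule.starProjection_apply_mem _ _))
  refine Submodule.eq_starProjection_of_mem_of_inner_eq_zero (mem_annih.2 fun j h1 hj i => ?_)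
    fun w hw => ?_
  · rcases Nat.lt_or_ge n j with h | h
    · obtain rfl : j = n + 1 := by omega
      have h2 : u (n + 1) = orthComp u (n + 1) +
          (Submodule.span ℝ (u '' Set.Ico 1 (n + 1))).starProjection (u (n + 1)) := by
        simp [orthComp]
      have h3 : Set.Ico 1 (n + 1) = Set.Icc 1 n := by ext; simp
      have h4 : (Submodule.span ℝ (u '' Set.Ico 1 (n + 1))).starProjection (u (n + 1)) ∈
          Submodule.span ℝ (u '' Set.Icc 1 n) := h3 ▸ Submodule.starProjection_apply_mem _ _
      rw [h2, rowVec_add, inner_add_left, inner_rowVec_eq_zero hrn h4, add_zero,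
        ← Submodule.starProjection_eq_self_iff.2 hrn,
        ← Submodule.inner_starProjection_left_eq_right]
      exact ha i
    · exact mem_annih.1 hrn j h1 h i
  · have hwn := annih_anti n.le_succ u hw
    have h4 : ∀ v, inner ℝ ((annih n u).starProjection v) w = inner ℝ v w := fun v => by
      rw [Submodule.inner_starProjection_left_eq_right, Submodule.starProjection_eq_self_iff.2 hwn]
    simp only [hr, inner_sub_left, sum_inner, inner_smul_left, h4,
      inner_rowVec_eq_zero hw (orthComp_mem_span (Nat.le_add_left 1 n))]
    simp

variable {Ω : Type*} {mΩ : MeasurableSpace Ω} {μ : Measure Ω} {β h q c : ℝ} {X : Ω → Coords N}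

/-- What is known about `g⁽ⁿ⁺¹⁾` and `F_n`: the entries of `g⁽ⁿ⁺¹⁾` are those of the projection of
`g` onto the matrices annihilating the first `n` iterates, the first `n + 1` iterates are
determined by `F_n`, and events in `F_n` are invariant under resampling. -/
structure StageSpec (μ : Measure Ω) (β h q : ℝ) (X : Ω → Coords N) (n : ℕ) : Prop where
  le : Fil μ β h q (fun ω => toMat (X ω)) n ≤ mΩ
  inv : Fil μ β h q (fun ω => toMat (X ω)) n ≤ invEvents β h q n μ X
  meas : ∀ i j, Measurable[mΩ] fun ω => (stage μ β h q (fun ω => toMat (X ω)) n).1 ω i j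
  iter : ∀ j, 1 ≤ j → j ≤ n + 1 → AEMeas (Fil μ β h q (fun ω => toMat (X ω)) n) μ
    fun ω => mIter β h q (toMat (X ω)) j
  diff : ∀ i j, AEMeas (Fil μ β h q (fun ω => toMat (X ω)) n) μ
    fun ω => toMat (X ω) i j - (stage μ β h q (fun ω => toMat (X ω)) n).1 ω i j
  eq : ∀ i j, (fun ω => (stage μ β h q (fun ω => toMat (X ω)) n).1 ω i j) =ᵐ[μ] fun ω =>
    inner ℝ ((annih n (mIter β h q (toMat (X ω)))).starProjection (entryVec i j)) (X ω)

theorem stageSpec_zero (hX : Measurable X) : StageSpec μ β h q X 0 where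
  le := bot_le
  inv := bot_le
  meas i j := (measurable_toMat i j).comp hX
  iter j h1 hj := by
    obtain rfl : j = 1 := by omega
    exact .of_measurable measurable_const
  diff i j := by
    simp only [stage, sub_self]
    exact .of_measurable measurable_const
  eq i j := by
    simp only [stage, annih_zero, Submodule.starProjection_top]
    rfl

theorem StageSpec.mulVec_eq {n : ℕ} (hS : StageSpec μ β h q X n)
    (V : Coords N → EuclideanSpace ℝ (Fin N)) (i : Fin N) :
    (fun ω => ∑ j, (stage μ β h q (fun ω => toMat (X ω)) n).1 ω i j * V (X ω) j) =ᵐ[μ] fun ω =>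
      inner ℝ ((annih n (mIter β h q (toMat (X ω)))).starProjection (rowVec (V (X ω)) i)) (X ω) := by
  filter_upwards [ae_all_iff.2 fun j => hS.eq i j] with ω hω
  simp only [hω, rowVec, map_sum, map_smul, sum_inner, inner_smul_left]
  exact Finset.sum_congr rfl fun j _ => mul_comm _ _

theorem norm_starProjection_rowVec_orthComp_le (W : Submodule ℝ (Coords N))
    (A : Matrix (Fin N) (Fin N) ℝ) (n : ℕ) (i : Fin N) :
    ‖W.starProjection (rowVec (orthComp (mIter β h q A) n) i)‖ ≤ N * (N * (1 + √q)) := by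
  refine (Submodule.norm_starProjection_apply_le _ _).trans ((norm_rowVec_le _ _).trans ?_)
  gcongr
  exact (norm_orthComp_le _ _).trans (norm_mIter_le β h q A n)

/-- In the degenerate case φ is the vector 1, which is m⁽¹⁾ / √q; this is where q > 0 enters.
Membership in the span makes the new generators of F_{n+1} invariant under `annih (n + 1)`. -/
theorem normComp_mem_span (hq : 0 < q) (A : Matrix (Fin N) (Fin N) ℝ) (n : ℕ) :
    normComp (mIter β h q A) (n + 1) ∈ Submodule.span ℝ (mIter β h q A '' Set.Icc 1 (n + 1)) := by
  by_cases h0 : orthComp (mIter β h q A) (n + 1) = 0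
  · have h1 : normComp (mIter β h q A) (n + 1) = (√q)⁻¹ • mIter β h q A 1 := by
      ext i
      simp [normComp, h0, mIter, (Real.sqrt_pos.2 hq).ne']
    rw [h1]
    exact Submodule.smul_mem _ _ (Submodule.subset_span ⟨1, by simp, rfl⟩)
  · rw [normComp_eq_smul_orthComp _ _ h0]
    exact Submodule.smul_mem _ _ (orthComp_mem_span (Nat.le_add_left 1 n))

/-- Writes P_n e as P_{n+1} e plus a combination of the vectors representing the coordinates of
g⁽ⁿ⁺¹⁾M⁽ⁿ⁺¹⁾. The coefficients depend on the first n + 1 iterates only, hence are known given F_n,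
which is the form that `sub_condProj_ae_eq` asks for. -/
theorem exists_coeff_starProjection_annih (n : ℕ) (e : Coords N) :
    ∃ a : Fin N → Coords N → ℝ, (∀ b, IsFunOfIterates β h q (n + 1) (a b)) ∧
      ∀ x, (annih n (mIter β h q (toMat x))).starProjection e =
        (annih (n + 1) (mIter β h q (toMat x))).starProjection e +
        ∑ b, a b x • (annih n (mIter β h q (toMat x))).starProjection
          (rowVec (orthComp (mIter β h q (toMat x)) (n + 1)) b) := by
  have hmeas : ∀ {V : (ℕ → EuclideanSpace ℝ (Fin N)) → Coords N}, Measurable V →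
      Measurable fun u => (annih n u).starProjection (V u) := fun hV =>
    measurable_annih_starProjection (S := ℕ → EuclideanSpace ℝ (Fin N)) (u := fun u => u) n
      (fun j _ _ => measurable_pi_apply j) hV
  obtain ⟨a, ha, hau⟩ := exists_measurable_coeff (S := ℕ → EuclideanSpace ℝ (Fin N))
    (u := fun b u => (annih n u).starProjection (rowVec (orthComp u (n + 1)) b))
    (x := fun u => (annih n u).starProjection e)
    (fun b => hmeas ((measurable_rowVec b).comp (measurable_orthComp (n + 1))))
    (hmeas measurable_const)
  refine ⟨fun b x => a b (mTrunc β h q (n + 1) x), fun b => ⟨a b, ha b, fun _ => rfl⟩,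
    fun x => ?_⟩
  have h1 : ∀ j, 1 ≤ j → j ≤ n + 1 → mTrunc β h q (n + 1) x j = mIter β h q (toMat x) j :=
    fun j h1 hj => mTrunc_of_le x h1 hj
  have h2 := starProjection_annih_succ (hau (mTrunc β h q (n + 1) x))
  have h3 : orthComp (mTrunc β h q (n + 1) x) (n + 1) = orthComp (mIter β h q (toMat x)) (n + 1) :=
    orthComp_congr (Nat.le_add_left 1 n) h1
  have h4 := annih_congr (n := n) fun j hj1 hj => h1 j hj1 (hj.trans n.le_succ)
  have h5 := annih_congr (n := n + 1) h1
  simp only [h3, h4, h5] at h2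
  rw [h2, sub_add_cancel]

theorem memLp_inner_comp (hX : Measurable X) (hlaw : μ.map X = isoGaussian (Coords N) c) {n : ℕ}
    {V : Coords N → Coords N} (hV : IsFunOfIterates β h q n V) {C : ℝ} (hC : ∀ x, ‖V x‖ ≤ C) :
    MemLp (fun ω => inner ℝ (V (X ω)) (X ω)) 2 μ := by
  have h1 : MemLp (fun x => inner ℝ (V x) x) 2 (μ.map X) := by
    rw [hlaw]
    exact memLp_inner_of_bounded hV.measurable hC ENNReal.ofNat_ne_top
  exact h1.comp_of_map hX.aemeasurable

/-- All fields advance together: identifying the conditional projection needs the invariance of F_n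
and the measurability of the iterates, and these at the next stage need the formula for g⁽ⁿ⁺¹⁾. Here
z is g⁽ⁿ⁺¹⁾M⁽ⁿ⁺¹⁾ and w is g⁽ⁿ⁺¹⁾φ⁽ⁿ⁺¹⁾. -/
theorem StageSpec.succ [IsProbabilityMeasure μ] (hX : Measurable X)
    (hlaw : μ.map X = isoGaussian (Coords N) c) (hq : 0 < q) {n : ℕ}
    (hS : StageSpec μ β h q X n) : StageSpec μ β h q X (n + 1) := by
  set g : Ω → Matrix (Fin N) (Fin N) ℝ := fun ω => toMat (X ω)
  set m : Coords N → ℕ → EuclideanSpace ℝ (Fin N) := fun x => mIter β h q (toMat x) with hm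
  set y := (stage μ β h q g n).1 with hy
  set z : Ω → Fin N → ℝ := fun ω a => ∑ b, y ω a b * MIter β h q (g ω) (n + 1) b with hz
  set w : Ω → Fin N → ℝ := fun ω a => ∑ b, y ω a b * phi β h q (g ω) (n + 1) b with hw
  have hFil : Fil μ β h q g (n + 1) = Fil μ β h q g n ⊔ MeasurableSpace.comap w MeasurableSpace.pi := rfl
  have hGle : Fil μ β h q g n ≤ Fil μ β h q g (n + 1) := le_sup_left
  have hstage : ∀ ω i j, (stage μ β h q g (n + 1)).1 ω i j =
      y ω i j - condProj (Fil μ β h q g n) μ (condSpan (Fil μ β h q g n) z)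
        (fun ω => y ω i j) ω := fun _ _ _ => rfl
  -- the vectors `z` and `w`
  have hzw : ∀ ω a, z ω a = nNorm (orthComp (m (X ω)) (n + 1)) * w ω a := by
    intro ω a
    simp only [hz, hw, Finset.mul_sum, MIter_eq, phi_eq]
    refine Finset.sum_congr rfl fun b _ => ?_
    conv_lhs => rw [orthComp_eq_smul_normComp]
    simp only [PiLp.smul_apply, smul_eq_mul]
    ring
  have hwF : ∀ a, Measurable[Fil μ β h q g (n + 1)] fun ω => w ω a := fun a =>
    (measurable_pi_apply a).comp
      ((comap_measurable w).mono (le_sup_right (a := Fil μ β h q g n)) le_rfl)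
  have hcoord : ∀ (V : Coords N → EuclideanSpace ℝ (Fin N)), Measurable V → ∀ b,
      Measurable fun ω => V (X ω) b := fun V hV b =>
    (by fun_prop : Measurable fun v : EuclideanSpace ℝ (Fin N) => v b).comp (hV.comp hX)
  have hMfun : IsFunOfIterates β h q (n + 1) fun x => orthComp (m x) (n + 1) :=
    isFunOfIterates_orthComp (Nat.le_add_left 1 n) le_rfl
  have hφfun : IsFunOfIterates β h q (n + 1) fun x => normComp (m x) (n + 1) :=
    isFunOfIterates_normComp (Nat.le_add_left 1 n) le_rfl
  have hzm : ∀ a, Measurable fun ω => z ω a := fun a =>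
    Finset.measurable_fun_sum _ fun b _ => (hS.meas a b).mul (hcoord _ hMfun.measurable b)
  have hwm : Measurable w := measurable_pi_lambda _ fun a =>
    Finset.measurable_fun_sum _ fun b _ => (hS.meas a b).mul (hcoord _ hφfun.measurable b)
  have hzF : ∀ a, AEMeas (Fil μ β h q g (n + 1)) μ fun ω => z ω a := by
    intro a
    have h1 : AEMeas (Fil μ β h q g n) μ fun ω => nNorm (orthComp (m (X ω)) (n + 1)) :=
      (hMfun.comp measurable_nNorm).aemeas hS.iter
    exact ((h1.mono hGle).mul (.of_measurable (hwF a))).congr (.of_forall fun ω => hzw ω a)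
  -- the projections
  set U : Fin N → Coords N → Coords N := fun a x =>
    (annih n (m x)).starProjection (rowVec (orthComp (m x) (n + 1)) a) with hU
  have hUfun : ∀ a, IsFunOfIterates β h q (n + 1) (U a) := fun a =>
    IsFunOfIterates.starProjection n.le_succ (hMfun.comp (measurable_rowVec a))
  have hzU : ∀ a, (fun ω => z ω a) =ᵐ[μ] fun ω => inner ℝ (U a (X ω)) (X ω) := fun a =>
    hS.mulVec_eq (fun x => orthComp (m x) (n + 1)) a
  have hRfun : ∀ i j, IsFunOfIterates β h q (n + 1)
      fun x => (annih (n + 1) (m x)).starProjection (entryVec i j) := fun i j =>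
    IsFunOfIterates.starProjection le_rfl (isFunOfIterates_const _ _)
  have hUC : ∀ a x, ‖U a x‖ ≤ N * (N * (1 + √q)) := fun a x =>
    norm_starProjection_rowVec_orthComp_le _ _ _ _
  -- The candidate residual ⟨P_{n+1} e_{ij}, X⟩ is conditionally uncorrelated with every coordinate
  -- of z: the conditional covariance is c² ⟨P_{n+1} e_{ij}, U b⟩, and P_{n+1} e_{ij} annihilates
  -- M⁽ⁿ⁺¹⁾. Uniqueness then identifies it with the chosen version.
  have hres : ∀ i j, (fun ω => (stage μ β h q g (n + 1)).1 ω i j) =ᵐ[μ] fun ω =>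
      inner ℝ ((annih (n + 1) (m (X ω))).starProjection (entryVec i j)) (X ω) := by
    intro i j
    obtain ⟨a, ha, hae⟩ := exists_coeff_starProjection_annih (β := β) (h := h) (q := q) n
      (entryVec (N := N) i j)
    have hRC : ∀ x, ‖(annih (n + 1) (m x)).starProjection (entryVec i j)‖ ≤ ‖entryVec i j‖ :=
      fun x => Submodule.norm_starProjection_apply_le _ _
    simp only [hstage]
    have hrL := memLp_inner_comp hX hlaw (hRfun i j) hRC
    have hzL : ∀ b, MemLp (fun ω => z ω b) 2 μ := fun b =>
      (memLp_congr_ae (hzU b)).2 (memLp_inner_comp hX hlaw (hUfun b) (hUC b))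
    have haL : ∀ b, AEMeas (Fil μ β h q g n) μ fun ω => a b (X ω) := fun b =>
      (ha b).aemeas hS.iter
    refine sub_condProj_ae_eq (G := Fil μ β h q g n) (z := z) (y := fun ω => y ω i j)
      (r := fun ω => inner ℝ ((annih (n + 1) (m (X ω))).starProjection (entryVec i j)) (X ω))
      (a := fun b ω => a b (X ω)) hS.le hzL hrL haL ?_ ?_
    · filter_upwards [hS.eq i j, ae_all_iff.2 hzU] with ω h1 h2
      have h1' : y ω i j = _ := h1
      rw [h1']
      simp only [h2]
      rw [hae, inner_add_left, sum_inner]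
      simp [inner_smul_left, hU, hm]
    · intro b
      have h1 : (fun ω => inner ℝ ((annih (n + 1) (m (X ω))).starProjection (entryVec i j)) (X ω) *
          z ω b) =ᵐ[μ] fun ω =>
          inner ℝ ((annih (n + 1) (m (X ω))).starProjection (entryVec i j)) (X ω) *
          inner ℝ (U b (X ω)) (X ω) := (hzU b).mono fun ω hω => by simp only [hω]
      refine (condExp_congr_ae h1).trans ((condExp_inner_mul_inner hX hlaw hS.le hS.inv hS.iter
        (hRfun i j) (hUfun b) (C := ‖entryVec i j‖ + N * (N * (1 + √q)))
        (fun x => (hRC x).trans (le_add_of_nonneg_right (by positivity)))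
        (fun x => (hUC b x).trans (le_add_of_nonneg_left (norm_nonneg _)))
        (fun x => annih_anti n.le_succ _ (Submodule.starProjection_apply_mem _ _))
        (fun x => Submodule.starProjection_apply_mem _ _)).trans (.of_forall fun ω => ?_))
      have h2 : (annih (n + 1) (m (X ω))).starProjection (entryVec i j) ∈
        annih (n + 1) (m (X ω)) := Submodule.starProjection_apply_mem _ _
      have h3 : inner ℝ ((annih (n + 1) (m (X ω))).starProjection (entryVec i j)) (U b (X ω)) =
          0 := by
        rw [hU, ← Submodule.inner_starProjection_left_eq_right,
          Submodule.starProjection_eq_self_iff.2 (annih_anti n.le_succ _ h2), real_inner_comm]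
        exact inner_rowVec_eq_zero h2 (orthComp_mem_span (Nat.le_add_left 1 n)) b
      change c ^ 2 * inner ℝ ((annih (n + 1) (m (X ω))).starProjection (entryVec i j))
        (U b (X ω)) = 0
      rw [h3, mul_zero]
  have hproj : ∀ i j, Measurable (condProj (Fil μ β h q g n) μ (condSpan (Fil μ β h q g n) z) fun ω => y ω i j) ∧
      AEMeas (Fil μ β h q g (n + 1)) μ (condProj (Fil μ β h q g n) μ (condSpan (Fil μ β h q g n) z) fun ω => y ω i j) := by
    intro i j
    obtain ⟨a, ha, hae⟩ := condProj_mem_condSpan (G := Fil μ β h q g n) (μ := μ) z fun ω => y ω i j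
    rw [hae]
    refine ⟨Finset.measurable_fun_sum _ fun b _ => ((ha b).mono hS.le le_rfl).mul (hzm b),
      AEMeas.sum fun b => AEMeas.mul ?_ (hzF b)⟩
    exact (AEMeas.of_measurable (ha b)).mono hGle
  refine ⟨?_, ?_, fun i j => ?_, fun j h1 hj => ?_, fun i j => ?_, hres⟩
  · rw [hFil]
    exact sup_le hS.le hwm.comap_le
  · rw [hFil]
    refine sup_le (hS.inv.trans (invEvents_mono n.le_succ X)) ?_
    refine comap_le_invEvents (ζ := fun x a => inner ℝ
      ((annih n (m x)).starProjection (rowVec (normComp (m x) (n + 1)) a)) x) ?_ ?_ ?_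
    · filter_upwards [ae_all_iff.2 (hS.mulVec_eq fun x => normComp (m x) (n + 1))] with ω hω
      exact funext hω
    · exact measurable_pi_lambda _ fun a => ((IsFunOfIterates.starProjection n.le_succ
        (hφfun.comp (measurable_rowVec a))).measurable).inner measurable_id
    · intro x v hv
      have hvn := annih_anti n.le_succ _ hv
      ext1 a
      have h1 : (annih n (m (x + v))).starProjection (rowVec (normComp (m (x + v)) (n + 1)) a) =
          (annih n (m x)).starProjection (rowVec (normComp (m x) (n + 1)) a) :=
        (IsFunOfIterates.starProjection n.le_succ (hφfun.comp (measurable_rowVec a))).add_eq hvn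
      rw [h1, inner_add_right, Submodule.inner_starProjection_left_eq_right _ _ v,
        Submodule.starProjection_eq_self_iff.2 hvn,
        inner_rowVec_eq_zero hv (normComp_mem_span hq _ n), add_zero]
  · exact (hS.meas i j).sub (hproj i j).1
  · rcases Nat.lt_or_ge j (n + 2) with hlt | hge
    · exact (hS.iter j h1 (by omega)).mono hGle
    · obtain rfl : j = n + 2 := by omega
      have hcoordF : ∀ k, k ≤ n + 1 → ∀ i,
          AEMeas (Fil μ β h q g (n + 1)) μ fun ω => m (X ω) k i := by
        intro k hk i
        rcases Nat.eq_zero_or_pos k with rfl | hk0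
        · exact .of_measurable (@measurable_const _ _ _ (Fil μ β h q g (n + 1)) 0)
        · exact ((hS.iter k hk0 hk).mono hGle).comp
            (by fun_prop : Measurable fun v : EuclideanSpace ℝ (Fin N) => v i)
      -- Since g⁽ⁿ⁺¹⁾ kills m⁽¹⁾, …, m⁽ⁿ⁾, it acts on m⁽ⁿ⁺¹⁾ as on M⁽ⁿ⁺¹⁾. So g m⁽ⁿ⁺¹⁾ = (g -
      -- g⁽ⁿ⁺¹⁾) m⁽ⁿ⁺¹⁾ + z, where the first term is known given F_n and z is known given F_{n+1};
      -- this determines iterate n + 2.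
      have hprod : ∀ i, (fun ω => ∑ l, g ω i l * m (X ω) (n + 1) l) =ᵐ[μ] fun ω =>
          ∑ l, (g ω i l - y ω i l) * m (X ω) (n + 1) l + z ω i := by
        intro i
        filter_upwards [hzU i, hS.mulVec_eq (fun x => m x (n + 1)) i] with ω h2 h3
        have h4 : (annih n (m (X ω))).starProjection (rowVec (m (X ω) (n + 1)) i) =
            U i (X ω) := by
          have h5 : m (X ω) (n + 1) = orthComp (m (X ω)) (n + 1) + (Submodule.span ℝ
              (m (X ω) '' Set.Ico 1 (n + 1))).starProjection (m (X ω) (n + 1)) := by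
            simp [orthComp]
          have h6 : Set.Ico 1 (n + 1) = Set.Icc 1 n := by ext; simp
          rw [h5, rowVec_add, map_add, add_eq_left,
            Submodule.starProjection_apply_eq_zero_iff, Submodule.mem_orthogonal']
          intro v hv
          refine inner_rowVec_eq_zero hv ?_ i
          rw [← h6]
          exact Submodule.starProjection_apply_mem _ _
        rw [h4, ← h2] at h3
        simp only [sub_mul, Finset.sum_sub_distrib]
        have h3' : ∑ l, y ω i l * m (X ω) (n + 1) l = z ω i := h3
        rw [h3', sub_add_cancel]
      have hfun : ∀ i, AEMeas (Fil μ β h q g (n + 1)) μ fun ω =>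
          Th β h ((∑ l, g ω i l * m (X ω) (n + 1) l) - β * (1 - q) * m (X ω) n i) := by
        intro i
        have h7 : AEMeas (Fil μ β h q g (n + 1)) μ fun ω => ∑ l, g ω i l * m (X ω) (n + 1) l := by
          refine AEMeas.congr (AEMeas.add (AEMeas.sum fun l => AEMeas.mul ?_ ?_) (hzF i)) (hprod i)
          · exact (hS.diff i l).mono hGle
          · exact hcoordF (n + 1) le_rfl l
        refine (h7.prodMk (hcoordF n n.le_succ i)).comp
          (g := fun p : ℝ × ℝ => Th β h (p.1 - β * (1 - q) * p.2)) ?_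
        unfold Th
        exact continuous_tanh.measurable.comp (by fun_prop)
      exact (AEMeas.pi hfun).comp (WithLp.measurable_toLp 2 (Fin N → ℝ))
  · refine (((hS.diff i j).mono hGle).add (hproj i j).2).congr (.of_forall fun ω => ?_)
    exact (sub_add _ _ _).symm

theorem stageSpec [IsProbabilityMeasure μ] (hX : Measurable X)
    (hlaw : μ.map X = isoGaussian (Coords N) c) (hq : 0 < q) (n : ℕ) : StageSpec μ β h q X n := by
  induction n with
  | zero => exact stageSpec_zero hX
  | succ n ih => exact ih.succ hX hlaw hq

end Stages


/-! ### Conditional covariances of the modified matrices -/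

section Covariance

variable {N : ℕ} {Ω : Type*} {mΩ : MeasurableSpace Ω} {μ : Measure Ω} [IsProbabilityMeasure μ]
  {β h q : ℝ}

/-- The entries above the diagonal. -/
def upperEntries (g : Ω → Matrix (Fin N) (Fin N) ℝ) (ω : Ω) : Coords N :=
  WithLp.toLp 2 fun p => g ω p.1.1 p.1.2

omit [IsProbabilityMeasure μ] in
theorem IsInteraction.toMat_upperEntries {g : Ω → Matrix (Fin N) (Fin N) ℝ}
    (hg : IsInteraction μ g) (ω : Ω) : toMat (upperEntries g ω) = g ω :=
  toMat_of_symm (hg.symm ω) (hg.diag ω)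

omit [IsProbabilityMeasure μ] in
theorem IsInteraction.measurable_upperEntries {g : Ω → Matrix (Fin N) (Fin N) ℝ}
    (hg : IsInteraction μ g) : Measurable (upperEntries g) :=
  (WithLp.measurable_toLp 2 _).comp (measurable_pi_lambda _ fun _ => hg.measurable _ _)

theorem IsInteraction.map_upperEntries {g : Ω → Matrix (Fin N) (Fin N) ℝ}
    (hg : IsInteraction μ g) : μ.map (upperEntries g) = isoGaussian (Coords N) (√N)⁻¹ := by
  have hm : ∀ p : Pair N, Measurable fun ω => g ω p.1.1 p.1.2 := fun p => hg.measurable _ _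
  have h1 := (iIndepFun_iff_map_fun_eq_pi_map fun p => (hm p).aemeasurable).1 hg.indep
  have h2 : μ.map (upperEntries g) =
      (Measure.pi fun _ : Pair N => gaussianReal 0 (N : NNReal)⁻¹).map (WithLp.toLp 2) := by
    have h3 : (fun p : Pair N => μ.map fun ω => g ω p.1.1 p.1.2) =
        fun _ => gaussianReal 0 (N : NNReal)⁻¹ := funext fun p => hg.gaussian _ _ p.2
    rw [h3] at h1
    rw [← h1, Measure.map_map (by fun_prop) (measurable_pi_lambda _ hm)]
    rfl
  have := Measure.isProbabilityMeasure_map (μ := μ) hg.measurable_upperEntries.aemeasurable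
  refine Measure.ext_of_charFun (funext fun t => ?_)
  rw [charFun_isoGaussian, h2, charFun_pi]
  simp_rw [charFun_gaussianReal, ← Complex.exp_sum]
  congr 1
  rw [EuclideanSpace.real_norm_sq_eq, inv_pow, Real.sq_sqrt (Nat.cast_nonneg N)]
  push_cast
  simp only [mul_zero, zero_mul, zero_sub, Finset.sum_neg_distrib]
  rw [Finset.mul_sum, Finset.sum_div]

variable {g : Ω → Matrix (Fin N) (Fin N) ℝ}

theorem IsInteraction.stageSpec (hg : IsInteraction μ g) (hq : 0 < q) (n : ℕ) :
    StageSpec μ β h q (upperEntries g) n :=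
  TAP.stageSpec hg.measurable_upperEntries hg.map_upperEntries hq n

omit [IsProbabilityMeasure μ] in
theorem IsInteraction.eq_toMat (hg : IsInteraction μ g) :
    g = fun ω => toMat (upperEntries g ω) :=
  funext fun ω => (hg.toMat_upperEntries ω).symm

theorem IsInteraction.gMod_ae_eq (hg : IsInteraction μ g) (hq : 0 < q) (n : ℕ) (i j : Fin N) :
    (fun ω => gMod μ β h q g (n + 1) ω i j) =ᵐ[μ] fun ω =>
      inner ℝ ((annih n (mIter β h q (g ω))).starProjection (entryVec i j)) (upperEntries g ω) := by
  have h1 := (hg.stageSpec (β := β) (h := h) hq n).eq i j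
  rw [← hg.eq_toMat] at h1
  simp only [hg.toMat_upperEntries] at h1
  exact h1

theorem IsInteraction.aemeas_mIter (hg : IsInteraction μ g) (hq : 0 < q) {n j : ℕ} (h1 : 1 ≤ j)
    (hj : j ≤ n + 1) : AEMeas (Fil μ β h q g n) μ fun ω => mIter β h q (g ω) j := by
  have h2 := (hg.stageSpec (β := β) (h := h) hq n).iter j h1 hj
  rw [← hg.eq_toMat] at h2
  simpa only [hg.toMat_upperEntries] using h2

theorem IsInteraction.memLp_gMod (hg : IsInteraction μ g) (hq : 0 < q) (n : ℕ) (i j : Fin N) :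
    MemLp (fun ω => gMod μ β h q g (n + 1) ω i j) 2 μ := by
  have h1 := memLp_inner_comp hg.measurable_upperEntries hg.map_upperEntries
    (IsFunOfIterates.starProjection (β := β) (h := h) (q := q) (le_refl n)
      (isFunOfIterates_const n (entryVec i j)))
    (fun x => Submodule.norm_starProjection_apply_le _ _)
  simp only [hg.toMat_upperEntries] at h1
  exact (memLp_congr_ae (hg.gMod_ae_eq hq n i j)).2 h1

/-- The field F_n lags two levels behind g⁽ⁿ⁺²⁾. It determines iterate n + 1, hence P_{n+1}, but
fixes only what is invariant under the larger space `annih n`; so P_{n+1} acts as a constant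
projection on Gaussian noise of variance 1/N, and the formula is exact. -/
theorem IsInteraction.condCov_ae_eq (hg : IsInteraction μ g) (hq : 0 < q) (n : ℕ)
    (i j s t : Fin N) :
    condCov μ β h q g (n + 2) i j s t =ᵐ[μ] fun ω => (N : ℝ)⁻¹ *
      toMat ((annih (n + 1) (mIter β h q (g ω))).starProjection (entryVec i j)) s t := by
  have hS := hg.stageSpec (β := β) (h := h) hq n
  have hfun : ∀ i j : Fin N, IsFunOfIterates β h q (n + 1)
      fun x => (annih (n + 1) (mIter β h q (toMat x))).starProjection (entryVec i j) := fun i j =>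
    IsFunOfIterates.starProjection le_rfl (isFunOfIterates_const _ _)
  have h1 := condExp_inner_mul_inner hg.measurable_upperEntries hg.map_upperEntries hS.le hS.inv
    hS.iter (hfun i j) (hfun s t)
    (C := ‖entryVec i j‖ + ‖entryVec s t‖)
    (fun x => (Submodule.norm_starProjection_apply_le _ _).trans
      (le_add_of_nonneg_right (norm_nonneg _)))
    (fun x => (Submodule.norm_starProjection_apply_le _ _).trans
      (le_add_of_nonneg_left (norm_nonneg _)))
    (fun x => annih_anti n.le_succ _ (Submodule.starProjection_apply_mem _ _))
    (fun x => annih_anti n.le_succ _ (Submodule.starProjection_apply_mem _ _))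
  rw [← hg.eq_toMat] at h1
  simp only [hg.toMat_upperEntries] at h1
  have h2 : (fun ω => gMod μ β h q g (n + 2) ω i j * gMod μ β h q g (n + 2) ω s t) =ᵐ[μ] _ :=
    (hg.gMod_ae_eq hq (n + 1) i j).mul (hg.gMod_ae_eq hq (n + 1) s t)
  refine (condExp_congr_ae h2).trans (h1.trans (.of_forall fun ω => ?_))
  simp only [inv_pow, Real.sq_sqrt (Nat.cast_nonneg N), toMat_apply]
  rw [real_inner_comm, Submodule.inner_starProjection_left_eq_right,
    Submodule.starProjection_eq_self_iff.2 (Submodule.starProjection_apply_mem _ _)]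

end Covariance


/-! ### Explicit form of the projection -/

section Expansion

variable {N : ℕ}

theorem sum_row_eq_zero {n : ℕ} {u : ℕ → EuclideanSpace ℝ (Fin N)} {R : Matrix (Fin N) (Fin N) ℝ}
    (hRV : ∀ i, WithLp.toLp 2 (R i) ∈ Submodule.span ℝ (u '' Set.Icc 1 n)) {y : Coords N}
    (hy : y ∈ annih n u) (s j : Fin N) : ∑ t, toMat y s t * R j t = 0 := by
  have := inner_rowVec_eq_zero hy (hRV j) s
  rwa [inner_rowVec] at this

/-- The projection of a matrix unit onto the symmetric matrices with zero diagonal that annihilate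
given vectors, in terms of the projection `R` onto the span of these vectors. -/
theorem toMat_starProjection_annih {n : ℕ} {u : ℕ → EuclideanSpace ℝ (Fin N)}
    {R : Matrix (Fin N) (Fin N) ℝ} (hRs : ∀ i j, R i j = R j i)
    (hRV : ∀ i, WithLp.toLp 2 (R i) ∈ Submodule.span ℝ (u '' Set.Icc 1 n))
    (hRu : ∀ k, 1 ≤ k → k ≤ n → ∀ i, ∑ t, R i t * u k t = u k i) (i j : Fin N) {d : Fin N → ℝ}
    (hd : ∀ s, ∑ r, (1 - R) s r ^ 2 * d r = (1 - R) s i * (1 - R) s j) (s t : Fin N) :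
    toMat ((annih n u).starProjection (entryVec i j)) s t =
      (1 - R) s i * (1 - R) j t + (1 - R) s j * (1 - R) i t -
        2 * ∑ r, (1 - R) s r * d r * (1 - R) r t := by
  set Q := 1 - R with hQ
  have hQs : ∀ i j, Q i j = Q j i := fun i j => by
    simp only [hQ, Matrix.sub_apply, hRs i j, Matrix.one_apply, eq_comm]
  have hQu : ∀ k, 1 ≤ k → k ≤ n → ∀ i, ∑ t, Q i t * u k t = 0 := fun k h1 h2 i => by
    simp [hQ, Matrix.sub_apply, sub_mul, Finset.sum_sub_distrib, hRu k h1 h2, Matrix.one_apply]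
  -- B is QEQ - 2QDQ with E the symmetrized unit at (i, j) and D = diag d. The factors Q make it
  -- annihilate the vectors u k, and the system `hd` for d says precisely that its diagonal
  -- vanishes.
  let B : Matrix (Fin N) (Fin N) ℝ := Matrix.of fun s t =>
    Q s i * Q j t + Q s j * Q i t - 2 * ∑ r, Q s r * d r * Q r t
  have hBs : ∀ s t, B s t = B t s := fun s t => by
    simp only [B, Matrix.of_apply, hQs s, hQs t]
    rw [hQs j t, hQs i t]
    congr 1
    · rw [hQs t j, hQs t i]; ring
    · refine congrArg _ (Finset.sum_congr rfl fun r _ => ?_)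
      ring
  have hBd : ∀ s, B s s = 0 := fun s => by
    have h1 : ∑ r, Q s r * d r * Q r s = Q s i * Q s j := by
      rw [← hd s]
      refine Finset.sum_congr rfl fun r _ => ?_
      rw [hQs r s]
      ring
    simp only [B, Matrix.of_apply, h1, hQs j s, hQs i s]
    ring
  set w : Coords N := WithLp.toLp 2 fun p => B p.1.1 p.1.2 with hw
  have hwB : toMat w = B := toMat_of_symm hBs hBd
  have hwm : w ∈ annih n u := mem_annih.2 fun k h1 h2 s => by
    rw [inner_rowVec, hwB]
    have h3 : ∀ t, B s t * u k t = Q s i * (Q j t * u k t) + Q s j * (Q i t * u k t) -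
        2 * ∑ r, Q s r * d r * (Q r t * u k t) := fun t => by
      simp only [B, Matrix.of_apply, sub_mul, add_mul, Finset.mul_sum, Finset.sum_mul]
      congr 1
      · ring
      · exact Finset.sum_congr rfl fun r _ => by ring
    simp only [h3, Finset.sum_sub_distrib, Finset.sum_add_distrib, ← Finset.mul_sum,
      hQu k h1 h2]
    rw [Finset.sum_comm]
    simp only [← Finset.mul_sum, hQu k h1 h2]
    simp
  have key : (annih n u).starProjection (entryVec i j) = w := by
    -- A matrix y in the subspace satisfies Qy = yQ = y. Hence QEQ pairs with y to 2 y_{ij}, while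
    -- QDQ only meets the zero diagonal of y.
    refine Submodule.eq_starProjection_of_mem_of_inner_eq_zero hwm fun y hy => ?_
    have h4 : ∀ s j, ∑ t, toMat y s t * Q j t = toMat y s j := fun s j => by
      simp [hQ, Matrix.sub_apply, mul_sub, Finset.sum_sub_distrib, sum_row_eq_zero hRV hy,
        Matrix.one_apply]
    have h5 : ∀ i j, ∑ s, ∑ t, Q s i * Q j t * toMat y s t = toMat y i j := fun i j => by
      have : ∀ s, ∑ t, Q s i * Q j t * toMat y s t = toMat y j s * Q i s := fun s => by
        rw [toMat_comm y j s, ← h4 s j, Finset.sum_mul]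
        refine Finset.sum_congr rfl fun t _ => ?_
        rw [hQs s i]
        ring
      simp only [this, h4]
      exact toMat_comm _ _ _
    have h6 : 2 * inner ℝ w y = 2 * toMat y i j := by
      rw [two_mul_inner_eq, hwB]
      have h7 : ∀ s t, B s t * toMat y s t = Q s i * Q j t * toMat y s t +
          Q s j * Q i t * toMat y s t - 2 * ∑ r, d r * (Q s r * Q r t * toMat y s t) :=
        fun s t => by
          simp only [B, Matrix.of_apply, sub_mul, add_mul, Finset.mul_sum, Finset.sum_mul]
          congr 1
          exact Finset.sum_congr rfl fun r _ => by ring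
      have h8 : ∑ s, ∑ t, ∑ r, d r * (Q s r * Q r t * toMat y s t) = 0 := by
        have : ∀ s, ∑ t, ∑ r, d r * (Q s r * Q r t * toMat y s t) =
            ∑ r, d r * ∑ t, Q s r * Q r t * toMat y s t := fun s => by
          rw [Finset.sum_comm]
          simp only [Finset.mul_sum]
        simp only [this]
        rw [Finset.sum_comm]
        simp only [← Finset.mul_sum, h5, toMat_self]
        simp
      simp only [h7, Finset.sum_sub_distrib, Finset.sum_add_distrib, h5, ← Finset.mul_sum] at h8 ⊢
      rw [h8, toMat_comm y j i]
      ring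
    rw [inner_sub_left, ← toMat_apply]
    linarith
  rw [key, hwB]
  rfl

/-- Solutions of the linear system for the diagonal correction. -/
theorem exists_diag_solution {R : Matrix (Fin N) (Fin N) ℝ} {c : ℝ} (hc : 1 ≤ c)
    (hN : 2 * c * (3 + c) ≤ N) (hRc : ∀ i j, |R i j| ≤ c / N) {i j : Fin N} (hij : i ≠ j) :
    ∃ d : Fin N → ℝ, (∀ s, ∑ r, (1 - R) s r ^ 2 * d r = (1 - R) s i * (1 - R) s j) ∧
      (∀ s, |d s| ≤ 4 * (c / N)) ∧
      ∀ s, s ≠ i → s ≠ j → |d s| ≤ (13 + 4 * c) * (c / N) ^ 2 := by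
  have hN0 : (0 : ℝ) < N := lt_of_lt_of_le (by positivity) hN
  set ε := c / N with hε
  have hε0 : 0 < ε := by positivity
  have hNε : N * ε = c := by rw [hε]; field_simp
  -- This is what the lower bound on N is for: the entrywise square of Q differs from the identity
  -- by at most 3ε on the diagonal and cε in the off-diagonal row sums, so by at most 1/2 in the sup
  -- norm, and its inverse has norm at most 2.
  have hεs : (3 + c) * ε ≤ 1 / 2 := by
    rw [hε, mul_div_assoc', div_le_iff₀ hN0]
    linarith
  have hε1 : ε ≤ 1 := by nlinarith
  have hQd : ∀ s, |1 - (1 - R) s s ^ 2| ≤ 3 * ε := fun s => by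
    have h1 := hRc s s
    have : 1 - (1 - R) s s ^ 2 = R s s * (2 - R s s) := by simp; ring
    rw [this, abs_mul]
    have h2 : |2 - R s s| ≤ 3 := by
      rw [abs_le] at h1 ⊢
      constructor <;> linarith
    nlinarith [abs_nonneg (R s s), abs_nonneg (2 - R s s)]
  have hQo : ∀ s r, s ≠ r → |(1 - R) s r| ≤ ε := fun s r hsr => by
    simpa [Matrix.one_apply, hsr] using hRc s r
  have hrow : ∀ (v : Fin N → ℝ) (m : ℝ), (∀ r, |v r| ≤ m) → ∀ s,
      |v s - ∑ r, (1 - R) s r ^ 2 * v r| ≤ 3 * ε * |v s| + c * ε * m := by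
    intro v m hv s
    have hm : 0 ≤ m := (abs_nonneg _).trans (hv s)
    rw [← Finset.add_sum_erase _ _ (Finset.mem_univ s)]
    have h1 : v s - ((1 - R) s s ^ 2 * v s + ∑ r ∈ Finset.univ.erase s, (1 - R) s r ^ 2 * v r) =
        (1 - (1 - R) s s ^ 2) * v s - ∑ r ∈ Finset.univ.erase s, (1 - R) s r ^ 2 * v r := by ring
    rw [h1]
    refine (abs_sub _ _).trans (add_le_add ?_ ?_)
    · rw [abs_mul]
      exact mul_le_mul_of_nonneg_right (hQd s) (abs_nonneg _)
    · calc |∑ r ∈ Finset.univ.erase s, (1 - R) s r ^ 2 * v r|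
          ≤ ∑ r ∈ Finset.univ.erase s, |(1 - R) s r ^ 2 * v r| := Finset.abs_sum_le_sum_abs _ _
        _ ≤ ∑ r ∈ Finset.univ.erase s, ε ^ 2 * m := by
            refine Finset.sum_le_sum fun r hr => ?_
            rw [abs_mul, abs_pow]
            exact mul_le_mul (pow_le_pow_left₀ (abs_nonneg _)
              (hQo s r (Finset.ne_of_mem_erase hr).symm) 2) (hv r) (abs_nonneg _) (by positivity)
        _ ≤ ∑ _r : Fin N, ε ^ 2 * m :=
            Finset.sum_le_sum_of_subset_of_nonneg (Finset.erase_subset _ _)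
              fun _ _ _ => by positivity
        _ = c * ε * m := by
            rw [Finset.sum_const, Finset.card_univ, Fintype.card_fin, nsmul_eq_mul, ← hNε]
            ring
  have hbound : ∀ (v : Fin N → ℝ) (b : ℝ), (∀ s, |∑ r, (1 - R) s r ^ 2 * v r| ≤ b) →
      ∀ s, |v s| ≤ 2 * b := by
    intro v b hb s
    have hv : ∀ r, |v r| ≤ ‖v‖ := fun r => norm_le_pi_norm v r
    have hb0 : 0 ≤ b := (abs_nonneg _).trans (hb s)
    have h1 : ‖v‖ ≤ b + ‖v‖ / 2 := by
      refine (pi_norm_le_iff_of_nonneg (by positivity)).2 fun r => ?_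
      have h2 := hrow v ‖v‖ hv r
      have h3 := abs_sub_abs_le_abs_sub (v r) (∑ l, (1 - R) r l ^ 2 * v l)
      have h4 := hb r
      have h5 : 3 * ε * |v r| ≤ 3 * ε * ‖v‖ := by gcongr; exact hv r
      have h6 := mul_le_mul_of_nonneg_right hεs (norm_nonneg v)
      rw [Real.norm_eq_abs]
      linarith
    linarith [hv s]
  let L : (Fin N → ℝ) →ₗ[ℝ] (Fin N → ℝ) := Matrix.toLin' (Matrix.of fun s r => (1 - R) s r ^ 2)
  have hL : ∀ v s, L v s = ∑ r, (1 - R) s r ^ 2 * v r := fun v s => by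
    simp [L, Matrix.mulVec, dotProduct]
  have hinj : Function.Injective L := by
    rw [← LinearMap.ker_eq_bot, LinearMap.ker_eq_bot']
    intro v hv
    ext s
    have := hbound v 0 (fun s => by rw [← hL, hv]; simp) s
    simpa using this
  -- The a priori bound gives injectivity, hence solvability in finite dimension.
  obtain ⟨d, hd⟩ := LinearMap.injective_iff_surjective.1 hinj
    fun s => (1 - R) s i * (1 - R) s j
  have hd' : ∀ s, ∑ r, (1 - R) s r ^ 2 * d r = (1 - R) s i * (1 - R) s j := fun s => by
    rw [← hL, hd]
  have hQ2 : ∀ s r, |(1 - R) s r| ≤ 2 := fun s r => by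
    by_cases hsr : s = r
    · subst hsr
      have := hRc s s
      rw [Matrix.sub_apply, Matrix.one_apply_eq]
      rw [abs_le] at this ⊢
      constructor <;> linarith
    · linarith [hQo s r hsr]
  -- As i ≠ j, at least one factor of the right-hand side Q_{si} Q_{sj} is off the diagonal, so the
  -- product is at most 2ε; the inverse doubles this.
  have hdb : ∀ s, |d s| ≤ 4 * ε := by
    have h1 : ∀ s, |∑ r, (1 - R) s r ^ 2 * d r| ≤ 2 * ε := fun s => by
      rw [hd', abs_mul]
      by_cases hsi : s = i
      · have h2 := hQo s j (hsi ▸ hij)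
        have h3 := hQ2 s i
        nlinarith [abs_nonneg ((1 - R) s i), abs_nonneg ((1 - R) s j)]
      · have h2 := hQo s i hsi
        have h3 := hQ2 s j
        nlinarith [abs_nonneg ((1 - R) s i), abs_nonneg ((1 - R) s j)]
    intro s
    linarith [hbound d _ h1 s]
  refine ⟨d, hd', hdb, fun s hsi hsj => ?_⟩
  -- Away from i and j both factors are off the diagonal. The bound is ε² from the right-hand side
  -- plus 3ε · 4ε + cε · 4ε from the perturbation, which is (13 + 4c) ε².
  have h1 := hrow d _ hdb s
  have h2 := abs_sub_abs_le_abs_sub (d s) (∑ r, (1 - R) s r ^ 2 * d r)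
  have h3 : |∑ r, (1 - R) s r ^ 2 * d r| ≤ ε ^ 2 := by
    rw [hd', abs_mul, pow_two]
    exact mul_le_mul (hQo s i hsi) (hQo s j hsj) (abs_nonneg _) hε0.le
  have h4 : 3 * ε * |d s| ≤ 3 * ε * (4 * ε) := by gcongr; exact hdb s
  linarith

/-- For s ≠ t the factor Q_{sr} Q_{rt} is of order ε if r is s or t and of order ε² otherwise, while
d_r is of order ε if r is i or j and of order ε² otherwise. Order ε² thus arises only if {s, t}
meets {i, j}; the sum over the remaining r is of order N ε⁴, that is ε³, as Nε = c. -/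
theorem abs_diag_correction_le {R : Matrix (Fin N) (Fin N) ℝ} {c : ℝ} (hc : 1 ≤ c)
    (hRc : ∀ i j, |R i j| ≤ c / N) (hcN : c ≤ N) {i j : Fin N} {d : Fin N → ℝ}
    (hd1 : ∀ s, |d s| ≤ 4 * (c / N))
    (hd2 : ∀ s, s ≠ i → s ≠ j → |d s| ≤ (13 + 4 * c) * (c / N) ^ 2) {s t : Fin N} (hst : s ≠ t) :
    |∑ r, (1 - R) s r * d r * (1 - R) r t| ≤
      8 * (c / N) ^ 2 * ((if s = i then 1 else 0) + (if s = j then 1 else 0) +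
        (if t = i then 1 else 0) + (if t = j then 1 else 0)) +
      (4 * (13 + 4 * c) + 8 + c * (13 + 4 * c)) * (c / N) ^ 3 := by
  have hN0 : (0 : ℝ) < N := by linarith
  set ε := c / N with hε
  set c' := 13 + 4 * c with hc'
  have hc'0 : 0 < c' := by positivity
  have hε0 : 0 < ε := by positivity
  have hNε : N * ε = c := by rw [hε]; field_simp
  have hε1 : ε ≤ 1 := by rw [hε, div_le_one hN0]; exact hcN
  have hQ : ∀ s r, |(1 - R) s r| ≤ 1 * (if r = s then 1 else 0) + ε := fun s r => by
    have h1 := hRc s r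
    rw [Matrix.sub_apply, Matrix.one_apply]
    refine (abs_sub _ _).trans (add_le_add ?_ h1)
    by_cases h : s = r
    · simp [h]
    · simp [h, Ne.symm h]
  have hdb : ∀ r, |d r| ≤ 4 * ε * ((if r = i then 1 else 0) + (if r = j then 1 else 0)) +
      c' * ε ^ 2 := fun r => by
    have h1 := hd1 r
    have h2 := hd2 r
    have h3 : 0 ≤ c' * ε ^ 2 := by positivity
    by_cases hi : r = i
    · by_cases hj : r = j
      · simp only [hi, if_true]
        split_ifs <;> rw [hi] at h1 <;> linarith
      · rw [if_pos hi, if_neg hj]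
        linarith
    · by_cases hj : r = j
      · rw [if_neg hi, if_pos hj]
        linarith
      · rw [if_neg hi, if_neg hj]
        linarith [h2 hi hj]
  have hterm : ∀ r, |(1 - R) s r * d r * (1 - R) r t| ≤
      (ε * ((if r = s then 1 else 0) + (if r = t then 1 else 0)) + ε ^ 2) *
        (4 * ε * ((if r = i then 1 else 0) + (if r = j then 1 else 0)) + c' * ε ^ 2) := fun r => by
    rw [abs_mul, abs_mul, mul_right_comm]
    refine mul_le_mul ?_ (hdb r) (abs_nonneg _) (by positivity)
    have h1 := hQ s r
    have h2 := hQ r t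
    simp only [eq_comm (a := t)] at h2
    calc |(1 - R) s r| * |(1 - R) r t|
        ≤ (1 * (if r = s then 1 else 0) + ε) * (1 * (if r = t then 1 else 0) + ε) :=
          mul_le_mul h1 h2 (abs_nonneg _) (by positivity)
      _ ≤ _ := by
          by_cases hs : r = s
          · have ht : r ≠ t := hs ▸ hst
            simp only [hs, hst, if_true, if_false]
            nlinarith
          · simp only [hs, if_false]
            nlinarith
  have hsum : ∑ r, (ε * ((if r = s then 1 else 0) + (if r = t then 1 else 0)) + ε ^ 2) *
        (4 * ε * ((if r = i then 1 else 0) + (if r = j then 1 else 0)) + c' * ε ^ 2) =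
      ε * (4 * ε * ((if s = i then 1 else 0) + (if s = j then 1 else 0)) + c' * ε ^ 2) +
      ε * (4 * ε * ((if t = i then 1 else 0) + (if t = j then 1 else 0)) + c' * ε ^ 2) +
      ε ^ 2 * (8 * ε + N * (c' * ε ^ 2)) := by
    have h1 : ∀ (f : Fin N → ℝ) (a : Fin N), ∑ r, (if r = a then 1 else 0) * f r = f a := by
      intro f a
      simp
    have h2 : ∀ r, (ε * ((if r = s then 1 else 0) + (if r = t then 1 else 0)) + ε ^ 2) *
        (4 * ε * ((if r = i then 1 else 0) + (if r = j then 1 else 0)) + c' * ε ^ 2) =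
        ε * ((if r = s then 1 else 0) *
          (4 * ε * ((if r = i then 1 else 0) + (if r = j then 1 else 0)) + c' * ε ^ 2)) +
        ε * ((if r = t then 1 else 0) *
          (4 * ε * ((if r = i then 1 else 0) + (if r = j then 1 else 0)) + c' * ε ^ 2)) +
        (4 * ε ^ 3 * ((if r = i then 1 else 0) * 1) + 4 * ε ^ 3 * ((if r = j then 1 else 0) * 1) +
          c' * ε ^ 4) := fun r => by ring
    rw [Finset.sum_congr rfl fun r _ => h2 r]
    simp only [Finset.sum_add_distrib, ← Finset.mul_sum]
    rw [h1, h1, h1, h1]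
    simp only [Finset.sum_const, Finset.card_univ, Fintype.card_fin, nsmul_eq_mul]
    ring
  refine ((Finset.abs_sum_le_sum_abs _ _).trans (Finset.sum_le_sum fun r _ => hterm r)).trans ?_
  rw [hsum]
  have h3 : ε ^ 2 * (8 * ε + N * (c' * ε ^ 2)) = (8 + c * c') * ε ^ 3 := by
    rw [← hNε]; ring
  rw [h3]
  have h4 : (0 : ℝ) ≤ (if s = i then 1 else 0) + (if s = j then 1 else 0) +
      (if t = i then 1 else 0) + (if t = j then 1 else 0) := by positivity
  have h5 : 0 ≤ c' * ε ^ 3 := by positivity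
  nlinarith [mul_nonneg (sq_nonneg ε) h4]

/-- The entries of the projection of a matrix unit, up to errors of order `N⁻¹`, `N⁻²` and `N⁻³`
according to the number of common indices. -/
theorem starProjection_annih_expansion {n : ℕ} {u : ℕ → EuclideanSpace ℝ (Fin N)}
    {R : Matrix (Fin N) (Fin N) ℝ} (hRs : ∀ i j, R i j = R j i)
    (hRV : ∀ i, WithLp.toLp 2 (R i) ∈ Submodule.span ℝ (u '' Set.Icc 1 n))
    (hRu : ∀ k, 1 ≤ k → k ≤ n → ∀ i, ∑ t, R i t * u k t = u k i) {c : ℝ} (hc : 1 ≤ c)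
    (hN : 2 * c * (3 + c) ≤ N) (hRc : ∀ i j, |R i j| ≤ c / N) {i j : Fin N} (hij : i ≠ j) {K : ℝ}
    (hK : K = 68 + 2 * (4 * (13 + 4 * c) + 8 + c * (13 + 4 * c))) :
    |toMat ((annih n u).starProjection (entryVec i j)) i j - 1| ≤ K * (c / N) ∧
    (∀ t, t ≠ i → t ≠ j →
      |toMat ((annih n u).starProjection (entryVec i j)) j t + R i t| ≤ K * (c / N) ^ 2) ∧
    ∀ s t, s ≠ t → s ≠ i → s ≠ j → t ≠ i → t ≠ j →
      |toMat ((annih n u).starProjection (entryVec i j)) s t -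
        (R s i * R j t + R s j * R i t)| ≤ K * (c / N) ^ 3 := by
  obtain ⟨d, hd, hd1, hd2⟩ := exists_diag_solution hc hN hRc hij
  have hN0 : (0 : ℝ) < N := lt_of_lt_of_le (by positivity) hN
  have hcN : c ≤ N := by nlinarith
  have hT := fun s t (hst : s ≠ t) => abs_diag_correction_le hc hRc hcN hd1 hd2 hst
  simp only [toMat_starProjection_annih hRs hRV hRu i j hd]
  set C := 4 * (13 + 4 * c) + 8 + c * (13 + 4 * c) with hC
  have hC0 : 0 ≤ C := by positivity
  set ε := c / N with hε
  have hε0 : 0 < ε := by positivity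
  have hε1 : ε ≤ 1 := by rw [hε, div_le_one hN0]; exact hcN
  have hε2 : ε ^ 2 ≤ ε := by nlinarith
  have hε3 : ε ^ 3 ≤ ε ^ 2 := by nlinarith [sq_nonneg ε]
  have hCε : C * ε ^ 3 ≤ C * ε ^ 2 := mul_le_mul_of_nonneg_left hε3 hC0
  have hCε' : C * ε ^ 2 ≤ C * ε := mul_le_mul_of_nonneg_left hε2 hC0
  have hRR : ∀ a b a' b', |R a b * R a' b'| ≤ ε ^ 2 := fun a b a' b' => by
    rw [abs_mul, pow_two]
    exact mul_le_mul (hRc a b) (hRc a' b') (abs_nonneg _) hε0.le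
  -- The number of indices shared by (s, t) and (i, j) decides the size of the leading term. With
  -- none shared the products of entries of Q equal those of R exactly, so the error is the diagonal
  -- correction alone. In K, the summand 68 absorbs the products of entries of R and the coincidence
  -- terms of the correction.
  refine ⟨?_, fun t hti htj => ?_, fun s t hst hsi hsj hti htj => ?_⟩
  · have h1 := hT i j hij
    set T := ∑ r, (1 - R) i r * d r * (1 - R) r j
    rw [if_pos rfl, if_neg hij, if_neg hij.symm, if_pos rfl] at h1
    simp only [Matrix.sub_apply, Matrix.one_apply_eq, Matrix.one_apply_ne hij]
    have h2 := abs_le.1 (hRc i i)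
    have h3 := abs_le.1 (hRc j j)
    have h4 := abs_le.1 (hRR i i j j)
    have h5 := abs_le.1 (hRR i j i j)
    have h6 := abs_le.1 h1
    rw [abs_le]
    constructor <;> nlinarith
  · have h1 := hT j t htj.symm
    set T := ∑ r, (1 - R) j r * d r * (1 - R) r t
    rw [if_neg hij.symm, if_pos rfl, if_neg hti, if_neg htj] at h1
    simp only [Matrix.sub_apply, Matrix.one_apply_eq, Matrix.one_apply_ne hij.symm,
      Matrix.one_apply_ne hti.symm, Matrix.one_apply_ne htj.symm]
    have h4 := abs_le.1 (hRR j i j t)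
    have h5 := abs_le.1 (hRR j j i t)
    have h6 := abs_le.1 h1
    rw [abs_le]
    constructor <;> nlinarith
  · have h1 := hT s t hst
    set T := ∑ r, (1 - R) s r * d r * (1 - R) r t
    rw [if_neg hsi, if_neg hsj, if_neg hti, if_neg htj] at h1
    simp only [Matrix.sub_apply, Matrix.one_apply_ne hsi, Matrix.one_apply_ne hsj,
      Matrix.one_apply_ne hti.symm, Matrix.one_apply_ne htj.symm]
    have h6 := abs_le.1 h1
    have h7 : 0 ≤ 68 * ε ^ 3 := by positivity
    rw [abs_le]
    constructor <;> nlinarith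

end Expansion


/-! ### The projection onto the span of the iterates -/

section SpanProjection

variable {N : ℕ}

/-- The matrix of the orthogonal projection onto the span of `u 1, …, u n`. -/
def spanProj (n : ℕ) (u : ℕ → EuclideanSpace ℝ (Fin N)) : Matrix (Fin N) (Fin N) ℝ :=
  Matrix.of fun i j =>
    (Submodule.span ℝ (u '' Set.Icc 1 n)).starProjection (EuclideanSpace.single i 1) j

theorem spanProj_apply_eq_inner (n : ℕ) (u : ℕ → EuclideanSpace ℝ (Fin N)) (i j : Fin N) :
    spanProj n u i j = inner ℝ ((Submodule.span ℝ (u '' Set.Icc 1 n)).starProjection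
      (EuclideanSpace.single i 1)) (EuclideanSpace.single j 1) := by
  rw [spanProj, Matrix.of_apply, real_inner_comm, EuclideanSpace.inner_single_left]
  simp

theorem spanProj_symm (n : ℕ) (u : ℕ → EuclideanSpace ℝ (Fin N)) (i j : Fin N) :
    spanProj n u i j = spanProj n u j i := by
  rw [spanProj_apply_eq_inner, spanProj_apply_eq_inner,
    Submodule.inner_starProjection_left_eq_right, real_inner_comm]

theorem spanProj_row_mem (n : ℕ) (u : ℕ → EuclideanSpace ℝ (Fin N)) (i : Fin N) :
    WithLp.toLp 2 (spanProj n u i) ∈ Submodule.span ℝ (u '' Set.Icc 1 n) :=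
  Submodule.starProjection_apply_mem (Submodule.span ℝ (u '' Set.Icc 1 n))
    (EuclideanSpace.single i 1)

theorem sum_spanProj_mul {n : ℕ} {u : ℕ → EuclideanSpace ℝ (Fin N)} {v : EuclideanSpace ℝ (Fin N)}
    (hv : v ∈ Submodule.span ℝ (u '' Set.Icc 1 n)) (i : Fin N) :
    ∑ t, spanProj n u i t * v t = v i := by
  have h1 : ∑ t, spanProj n u i t * v t = inner ℝ ((Submodule.span ℝ (u '' Set.Icc 1 n)).starProjection
      (EuclideanSpace.single i 1)) v := by
    rw [PiLp.inner_apply]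
    exact Finset.sum_congr rfl fun t _ => mul_comm _ _
  rw [h1, Submodule.inner_starProjection_left_eq_right, Submodule.starProjection_eq_self_iff.2 hv,
    EuclideanSpace.inner_single_left]
  simp

theorem exists_coeff_of_mem_span {n : ℕ} {u : ℕ → EuclideanSpace ℝ (Fin N)}
    {v : EuclideanSpace ℝ (Fin N)} (hv : v ∈ Submodule.span ℝ (u '' Set.Icc 1 n)) :
    ∃ a : Fin n → ℝ, v = ∑ k, a k • u (k + 1) := by
  have h1 : u '' Set.Icc 1 n = Set.range fun k : Fin n => u (k + 1) := by
    ext y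
    constructor
    · rintro ⟨j, hj, rfl⟩
      exact ⟨⟨j - 1, by have := hj.1; have := hj.2; omega⟩, by simp [Nat.sub_add_cancel hj.1]⟩
    · rintro ⟨j, rfl⟩
      exact ⟨j + 1, ⟨by omega, by omega⟩, rfl⟩
  rw [h1, Submodule.mem_span_range_iff_exists_fun] at hv
  obtain ⟨a, ha⟩ := hv
  exact ⟨a, ha.symm⟩

/-- If the Gram matrix is bounded below, then the entries of the projection are of order `N⁻¹`. -/
theorem abs_spanProj_le {n : ℕ} {u : ℕ → EuclideanSpace ℝ (Fin N)} {l b : ℝ} (hl : 0 < l)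
    (hb : ∀ k, 1 ≤ k → k ≤ n → ∀ i, |u k i| ≤ b)
    (hu : ∀ a : Fin n → ℝ, N * (l * ∑ k, a k ^ 2) ≤ ‖∑ k, a k • u (k + 1)‖ ^ 2) (i j : Fin N) :
    |spanProj n u i j| ≤ n * b ^ 2 / l / N := by
  obtain ⟨a, ha⟩ := exists_coeff_of_mem_span (spanProj_row_mem n u i)
  have hN : (0 : ℝ) < N := by exact_mod_cast i.pos
  have hrow : ∀ t, spanProj n u i t = ∑ k, a k * u (k + 1) t := fun t => by
    have := congrArg (fun v : EuclideanSpace ℝ (Fin N) => v t) ha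
    simpa using this
  have hbt : ∀ t, |spanProj n u i t| ≤ b * ∑ k, |a k| := fun t => by
    rw [hrow, Finset.mul_sum]
    refine (Finset.abs_sum_le_sum_abs _ _).trans (Finset.sum_le_sum fun k _ => ?_)
    rw [abs_mul, mul_comm]
    exact mul_le_mul_of_nonneg_right (hb _ (by omega) (by omega) t) (abs_nonneg _)
  -- Since R is a symmetric idempotent, the squared norm of its row i is its entry R_{ii}. That
  -- entry is at most b ∑ |a_k|, linear in the coefficients, whereas the squared norm is at least N
  -- l ∑ a_k²; comparing the two forces ∑ |a_k| to be O(N⁻¹).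
  have hnorm : ‖∑ k, a k • u (k + 1)‖ ^ 2 = spanProj n u i i := by
    rw [← ha, EuclideanSpace.real_norm_sq_eq]
    exact (Finset.sum_congr rfl fun t _ => pow_two _).trans
      (sum_spanProj_mul (spanProj_row_mem n u i) i)
  set S := ∑ k, |a k| with hS
  have hS0 : 0 ≤ S := Finset.sum_nonneg fun k _ => abs_nonneg _
  have hCS : S ^ 2 ≤ n * ∑ k, a k ^ 2 := by
    have := sq_sum_le_card_mul_sum_sq (s := (Finset.univ : Finset (Fin n))) (f := fun k => |a k|)
    simpa using this
  have h1 : N * l * S ^ 2 ≤ n * b * S := by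
    calc N * l * S ^ 2 ≤ N * l * (n * ∑ k, a k ^ 2) := by gcongr
      _ = n * (N * (l * ∑ k, a k ^ 2)) := by ring
      _ ≤ n * (b * S) := mul_le_mul_of_nonneg_left
          ((hu a).trans (hnorm ▸ (le_abs_self _).trans (hbt i))) (Nat.cast_nonneg n)
      _ = n * b * S := by ring
  rcases hS0.eq_or_lt with h0 | h0
  · have := hbt j
    rw [← h0, mul_zero] at this
    exact this.trans (by positivity)
  · have h2 : S ≤ n * b / l / N := by
      rw [div_div, le_div_iff₀ (by positivity)]
      refine le_of_mul_le_mul_right ?_ h0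
      linarith
    have hb0 : 0 ≤ b := by
      by_contra hb0
      have := (abs_nonneg _).trans (hbt j)
      nlinarith
    calc |spanProj n u i j| ≤ b * S := hbt j
      _ ≤ b * (n * b / l / N) := by gcongr
      _ = n * b ^ 2 / l / N := by ring

theorem orthComp_ne_zero {n : ℕ} {u : ℕ → EuclideanSpace ℝ (Fin N)}
    (hu : LinearIndependent ℝ fun k : Fin n => u (k + 1)) {m : ℕ} (h1 : 1 ≤ m) (hm : m ≤ n) :
    orthComp u m ≠ 0 := by
  intro h0
  have h2 : u m ∈ Submodule.span ℝ (u '' Set.Ico 1 m) := by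
    rw [orthComp, sub_eq_zero] at h0
    rw [h0]
    exact Submodule.starProjection_apply_mem _ _
  have h3 := hu.notMem_span_image (s := {k : Fin n | (k : ℕ) + 1 < m}) (x := ⟨m - 1, by omega⟩)
    (by simp only [Set.mem_ofPred_eq]; omega)
  apply h3
  have h4 : u '' Set.Ico 1 m =
      (fun k : Fin n => u (k + 1)) '' {k : Fin n | (k : ℕ) + 1 < m} := by
    ext y
    constructor
    · rintro ⟨j, hj, rfl⟩
      have := hj.1
      have := hj.2
      exact ⟨⟨j - 1, by omega⟩, by simp only [Set.mem_ofPred_eq]; omega,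
        by simp [Nat.sub_add_cancel hj.1]⟩
    · rintro ⟨j, hj, rfl⟩
      exact ⟨j + 1, ⟨by omega, hj⟩, rfl⟩
  rw [← h4]
  simpa only [Nat.sub_add_cancel h1] using h2

/-- The projection in terms of the normalized orthogonal vectors. -/
theorem spanProj_eq_sum {n : ℕ} {u : ℕ → EuclideanSpace ℝ (Fin N)}
    (hu : ∀ m, 1 ≤ m → m ≤ n → orthComp u m ≠ 0) (i j : Fin N) :
    spanProj n u i j = ∑ m ∈ Finset.Ico 1 (n + 1), normComp u m i * normComp u m j / N := by
  have hN : (0 : ℝ) < N := by exact_mod_cast i.pos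
  have hmem : ∀ m, 1 ≤ m → m ≤ n → normComp u m ∈ Submodule.span ℝ (u '' Set.Icc 1 m) :=
    fun m h1 hm => by
      rw [normComp_eq_smul_orthComp u m (hu m h1 hm)]
      exact Submodule.smul_mem _ _ (orthComp_mem_span h1)
  have horth : ∀ m, 1 ≤ m → m ≤ n → ∀ v ∈ Submodule.span ℝ (u '' Set.Ico 1 m),
      inner ℝ (normComp u m) v = 0 := fun m h1 hm v hv => by
    rw [normComp_eq_smul_orthComp u m (hu m h1 hm), inner_smul_left, orthComp,
      Submodule.starProjection_inner_eq_zero _ _ hv, mul_zero]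
  have hlt : ∀ a b, 1 ≤ a → a < b → b ≤ n → inner ℝ (normComp u b) (normComp u a) = 0 :=
    fun a b ha hab hb => horth b (by omega) hb _
      (Submodule.span_mono (Set.image_mono (show Set.Icc 1 a ⊆ Set.Ico 1 b from
        fun k hk => ⟨hk.1, hk.2.trans_lt hab⟩))
        (hmem a ha (by omega)))
  have hself : ∀ m, 1 ≤ m → m ≤ n → inner ℝ (normComp u m) (normComp u m) = (N : ℝ) :=
    fun m h1 hm => by
      have h0 := hu m h1 hm
      have h2 : 0 < ‖orthComp u m‖ := norm_pos_iff.2 h0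
      rw [normComp_eq_smul_orthComp u m h0, real_inner_self_eq_norm_sq, norm_smul, mul_pow,
        norm_inv, inv_pow, Real.norm_eq_abs, sq_abs, nNorm_sq]
      field_simp
  have hspan : ∀ k, k ≤ n → Submodule.span ℝ (u '' Set.Icc 1 k) ≤
      Submodule.span ℝ (normComp u '' Set.Icc 1 k) := by
    intro k
    induction k with
    | zero => simp
    | succ k ih =>
      intro hk
      have hmono : Submodule.span ℝ (normComp u '' Set.Icc 1 k) ≤
          Submodule.span ℝ (normComp u '' Set.Icc 1 (k + 1)) :=
        Submodule.span_mono (Set.image_mono (Set.Icc_subset_Icc_right k.le_succ))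
      rw [Submodule.span_le]
      rintro _ ⟨j, hj, rfl⟩
      rcases Nat.lt_or_ge j (k + 1) with h | h
      · exact hmono (ih (by omega) (Submodule.subset_span ⟨j, ⟨hj.1, by omega⟩, rfl⟩))
      · obtain rfl : j = k + 1 := le_antisymm hj.2 h
        have h2 : u (k + 1) = orthComp u (k + 1) +
            (Submodule.span ℝ (u '' Set.Ico 1 (k + 1))).starProjection (u (k + 1)) := by
          simp [orthComp]
        have h3 : Set.Ico 1 (k + 1) = Set.Icc 1 k := by ext; simp
        have h4 : (Submodule.span ℝ (u '' Set.Ico 1 (k + 1))).starProjection (u (k + 1)) ∈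
            Submodule.span ℝ (u '' Set.Icc 1 k) := h3 ▸ Submodule.starProjection_apply_mem _ _
        rw [SetLike.mem_coe, h2, orthComp_eq_smul_normComp]
        exact Submodule.add_mem _ (Submodule.smul_mem _ _ (Submodule.subset_span
          ⟨k + 1, ⟨by omega, le_rfl⟩, rfl⟩)) (hmono (ih (by omega) h4))
  have key : (Submodule.span ℝ (u '' Set.Icc 1 n)).starProjection (EuclideanSpace.single i 1) =
      ∑ m ∈ Finset.Ico 1 (n + 1), (normComp u m i / N) • normComp u m := by
    refine Submodule.eq_starProjection_of_mem_of_inner_eq_zero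
      (Submodule.sum_mem _ fun m hm => Submodule.smul_mem _ _ ?_) fun v hv => ?_
    · rw [Finset.mem_Ico] at hm
      exact Submodule.span_mono (Set.image_mono (Set.Icc_subset_Icc_right (by omega)))
        (hmem m hm.1 (by omega))
    · have hv' := hspan n le_rfl hv
      clear hv
      induction hv' using Submodule.span_induction with
      | mem y hy =>
        obtain ⟨k, hk, rfl⟩ := hy
        rw [inner_sub_left, sum_inner, Finset.sum_eq_single k]
        · rw [inner_smul_left, hself k hk.1 hk.2, EuclideanSpace.inner_single_left]
          simp
          field_simp
          simp
        · intro m hm hmk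
          rw [Finset.mem_Ico] at hm
          rw [inner_smul_left]
          rcases lt_or_gt_of_ne hmk with h | h
          · rw [real_inner_comm, hlt m k hm.1 h hk.2, mul_zero]
          · rw [hlt k m hk.1 h (by omega), mul_zero]
        · intro h
          exact absurd (Finset.mem_Ico.2 ⟨hk.1, Nat.lt_succ_of_le hk.2⟩) h
      | zero => simp
      | add y z _ _ hy hz => rw [inner_add_right, hy, hz, add_zero]
      | smul c y _ hy => rw [inner_smul_right, hy, mul_zero]
  rw [spanProj, Matrix.of_apply, key]
  simp only [WithLp.ofLp_sum, WithLp.ofLp_smul, Finset.sum_apply, Pi.smul_apply, smul_eq_mul]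
  exact Finset.sum_congr rfl fun m _ => by ring

end SpanProjection


/-! ### Positive definiteness of the limiting Gram matrix -/

section LimitGram

theorem tanh_add_tanh_nonneg {a b : ℝ} (hab : 0 ≤ a + b) : 0 ≤ Real.tanh a + Real.tanh b := by
  have h1 : Real.tanh a + Real.tanh b = Real.sinh (a + b) / (Real.cosh a * Real.cosh b) := by
    rw [Real.tanh_eq_sinh_div_cosh, Real.tanh_eq_sinh_div_cosh, Real.sinh_add]
    have := (Real.cosh_pos a).ne'
    have := (Real.cosh_pos b).ne'
    field_simp
  rw [h1]
  have := Real.cosh_pos a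
  have := Real.cosh_pos b
  have := Real.sinh_nonneg_iff.2 hab
  positivity

theorem continuous_Th (β h : ℝ) : Continuous (Th β h) := by
  unfold Th
  exact continuous_tanh.comp (by fun_prop)

theorem abs_Th_le (β h x : ℝ) : |Th β h x| ≤ 1 := (Real.abs_tanh_lt_one _).le

theorem Th_injective {β : ℝ} (hβ : 0 < β) (h : ℝ) : Function.Injective (Th β h) := fun x y hxy => by
  have := Real.tanh_injective hxy
  have h2 : β * x = β * y := by linarith
  exact mul_left_cancel₀ hβ.ne' h2

theorem IsFixedPoint.pos {β h q : ℝ} (hh : 0 < h) (hq : IsFixedPoint β h q) : 0 < q := by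
  refine hq.1.lt_of_ne fun h0 => ?_
  have h1 := hq.2
  rw [← h0] at h1
  simp only [Real.sqrt_zero, mul_zero, zero_mul, add_zero, integral_const, probReal_univ,
    one_smul] at h1
  have h2 : Real.tanh h = 0 := by
    rw [← pow_eq_zero_iff two_ne_zero]
    exact h1.symm
  rw [← Real.tanh_zero] at h2
  exact hh.ne' (Real.tanh_injective h2)

/-- For ρ₁, symmetrize in z: the arguments h ± x of tanh have nonnegative sum 2h. For later indices,
integrating out Z' and Z'' separately turns ψ into the mean of a square. -/
theorem rho_nonneg {β h q : ℝ} (hh : 0 < h) (k : ℕ) : 0 ≤ rho β h q k := by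
  match k with
  | 0 => exact le_rfl
  | 1 =>
    refine mul_nonneg ?_ (Real.sqrt_nonneg q)
    have hc : Continuous fun z => Th β h (√q * z) := (continuous_Th β h).comp (by fun_prop)
    have hi : Integrable (fun z => Th β h (√q * z)) stdGaussian :=
      .of_bound hc.aestronglyMeasurable 1 (.of_forall fun z => abs_Th_le _ _ _)
    have hi' : Integrable (fun z => Th β h (√q * -z)) stdGaussian :=
      .of_bound (hc.comp continuous_neg).aestronglyMeasurable 1
        (.of_forall fun z => abs_Th_le _ _ _)
    have h1 : ∫ z, Th β h (√q * z) ∂stdGaussian = ∫ z, Th β h (√q * -z) ∂stdGaussian := by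
      have h2 : stdGaussian.map (fun z => -z) = stdGaussian := by
        simpa using gaussianReal_map_neg (μ := 0) (v := 1)
      conv_lhs => rw [← h2]
      rw [integral_map (by fun_prop) hc.aestronglyMeasurable]
    have h3 : 0 ≤ ∫ z, (Th β h (√q * z) + Th β h (√q * -z)) ∂stdGaussian := by
      refine integral_nonneg fun z => tanh_add_tanh_nonneg ?_
      linarith
    rw [integral_add hi hi', ← h1] at h3
    linarith
  | k + 2 =>
    simp only [rho, psi]
    refine integral_nonneg fun z => ?_
    simp only [Pi.zero_apply, integral_const_mul, integral_mul_const]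
    exact mul_self_nonneg _

/-- The limit of the Gram matrix of the first `n` iterates. -/
def limGram (β h q : ℝ) (n : ℕ) : Matrix (Fin n) (Fin n) ℝ :=
  Matrix.of fun i j => if i = j then q else rho β h q (min (i : ℕ) j + 1)

theorem limGram_self (β h q : ℝ) {n : ℕ} (i : Fin n) : limGram β h q n i i = q := by
  simp [limGram]

theorem limGram_comm (β h q : ℝ) {n : ℕ} (i j : Fin n) :
    limGram β h q n i j = limGram β h q n j i := by
  simp only [limGram, Matrix.of_apply, eq_comm (a := i), min_comm (i : ℕ)]

theorem limGram_of_ne (β h q : ℝ) {n : ℕ} {i j : Fin n} (hij : i ≠ j) :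
    limGram β h q n i j = rho β h q (min (i : ℕ) j + 1) := by
  simp [limGram, hij]

theorem dotProduct_mulVec_two {n : ℕ} (G : Matrix (Fin n) (Fin n) ℝ) (i j : Fin n) (a b : ℝ) :
    (a • Pi.single i 1 + b • Pi.single j 1 : Fin n → ℝ) ⬝ᵥ
      G.mulVec (a • Pi.single i 1 + b • Pi.single j 1) =
      a ^ 2 * G i i + a * b * G i j + a * b * G j i + b ^ 2 * G j j := by
  simp only [Matrix.mulVec_add, Matrix.mulVec_smul, Matrix.mulVec_single_one, add_dotProduct,
    dotProduct_add, smul_dotProduct, dotProduct_smul, single_one_dotProduct, Matrix.col_apply,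
    smul_eq_mul]
  ring

/-- The Gaussian expectation defining `psi`, for two coordinates of a Gaussian vector. -/
theorem integral_Th_mul_Th_eq_psi (β h : ℝ) {q t : ℝ} {n : ℕ} {G : Matrix (Fin n) (Fin n) ℝ}
    (hG : G.PosSemidef) {i j : Fin n} (hi : G i i = q) (hj : G j j = q) (hij : G i j = t)
    (hji : G j i = t) (ht : 0 ≤ t) (htq : t ≤ q) :
    ∫ x, Th β h (x i) * Th β h (x j) ∂(multivariateGaussian 0 G) = psi β h q t := by
  let L : EuclideanSpace ℝ (Fin n) → EuclideanSpace ℝ (Fin 2) := fun x => !₂[x i, x j]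
  let K : ℝ × ℝ × ℝ → EuclideanSpace ℝ (Fin 2) := fun p =>
    !₂[√t * p.1 + √(q - t) * p.2.1, √t * p.1 + √(q - t) * p.2.2]
  have hLm : Measurable L := by
    refine (WithLp.measurable_toLp 2 _).comp (measurable_pi_lambda _ fun k => ?_)
    fin_cases k
    · exact (by fun_prop : Measurable fun x : EuclideanSpace ℝ (Fin n) => x i)
    · exact (by fun_prop : Measurable fun x : EuclideanSpace ℝ (Fin n) => x j)
  have hKm : Measurable K := by
    refine (WithLp.measurable_toLp 2 _).comp (measurable_pi_lambda _ fun k => ?_)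
    fin_cases k
    · exact (by fun_prop : Measurable fun p : ℝ × ℝ × ℝ => √t * p.1 + √(q - t) * p.2.1)
    · exact (by fun_prop : Measurable fun p : ℝ × ℝ × ℝ => √t * p.1 + √(q - t) * p.2.2)
  -- The vector (√t Z + √(q-t) Z', √t Z + √(q-t) Z'') has variances q and covariance t, like the two
  -- coordinates; 0 ≤ t ≤ q is needed for the square roots to square back.
  have hlaw : (multivariateGaussian 0 G).map L =
      (stdGaussian.prod (stdGaussian.prod stdGaussian)).map K := by
    have := Measure.isProbabilityMeasure_map (μ := multivariateGaussian 0 G) hLm.aemeasurable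
    have := Measure.isProbabilityMeasure_map
      (μ := stdGaussian.prod (stdGaussian.prod stdGaussian)) hKm.aemeasurable
    refine Measure.ext_of_charFun (funext fun s => ?_)
    have h1 : charFun ((multivariateGaussian 0 G).map L) s = charFun (multivariateGaussian 0 G)
        (WithLp.toLp 2 (s 0 • Pi.single i 1 + s 1 • Pi.single j 1)) := by
      rw [charFun_apply, charFun_apply, integral_map hLm.aemeasurable (by fun_prop)]
      congr 1 with x
      congr 3
      simp [L, PiLp.inner_apply, Fin.sum_univ_two, add_mul, Finset.sum_add_distrib]
    have h2 : charFun ((stdGaussian.prod (stdGaussian.prod stdGaussian)).map K) s =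
        charFun stdGaussian (√t * (s 0 + s 1)) *
          (charFun stdGaussian (√(q - t) * s 0) * charFun stdGaussian (√(q - t) * s 1)) := by
      rw [charFun_apply, integral_map hKm.aemeasurable (by fun_prop), charFun_apply_real,
        charFun_apply_real, charFun_apply_real, ← integral_prod_mul, ← integral_prod_mul]
      congr 1 with p
      rw [← Complex.exp_add, ← Complex.exp_add]
      congr 1
      simp only [K, PiLp.inner_apply, Fin.sum_univ_two]
      simp
      ring
    rw [h1, h2, charFun_multivariateGaussian hG, dotProduct_mulVec_two, hi, hj, hij, hji]
    simp only [charFun_gaussianReal, ← Complex.exp_add]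
    congr 1
    have e1 : ((√t : ℝ) : ℂ) ^ 2 = t := by rw [← Complex.ofReal_pow, Real.sq_sqrt ht]
    have e2 : ((√(q - t) : ℝ) : ℂ) ^ 2 = q - t := by
      rw [← Complex.ofReal_pow, Real.sq_sqrt (by linarith), Complex.ofReal_sub]
    push_cast
    simp only [mul_pow, e1, e2]
    simp
    ring
  have hF : Continuous fun y : EuclideanSpace ℝ (Fin 2) => Th β h (y 0) * Th β h (y 1) :=
    ((continuous_Th β h).comp (by fun_prop)).mul ((continuous_Th β h).comp (by fun_prop))
  have h3 : ∫ x, Th β h (x i) * Th β h (x j) ∂(multivariateGaussian 0 G) =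
      ∫ y, Th β h (y 0) * Th β h (y 1) ∂((multivariateGaussian 0 G).map L) := by
    rw [integral_map hLm.aemeasurable hF.aestronglyMeasurable]
    rfl
  rw [h3, hlaw, integral_map hKm.aemeasurable hF.aestronglyMeasurable]
  have hFK : Integrable (fun p => Th β h (K p 0) * Th β h (K p 1))
      (stdGaussian.prod (stdGaussian.prod stdGaussian)) := by
    refine .of_bound (hF.measurable.comp hKm).aestronglyMeasurable 1 (.of_forall fun p => ?_)
    rw [norm_mul]
    exact mul_le_one₀ (abs_Th_le _ _ _) (norm_nonneg _) (abs_Th_le _ _ _)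
  rw [integral_prod _ hFK, psi]
  congr 1 with z
  have hFz : Integrable (fun p : ℝ × ℝ => Th β h (K (z, p) 0) * Th β h (K (z, p) 1))
      (stdGaussian.prod stdGaussian) := by
    refine .of_bound (hF.measurable.comp (hKm.comp measurable_prodMk_left)).aestronglyMeasurable 1
      (.of_forall fun p => ?_)
    rw [norm_mul]
    exact mul_le_one₀ (abs_Th_le _ _ _) (norm_nonneg _) (abs_Th_le _ _ _)
  rw [integral_prod _ hFz]
  rfl

theorem integral_eval_multivariateGaussian {q : ℝ} (hq : 0 ≤ q) {n : ℕ}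
    {G : Matrix (Fin n) (Fin n) ℝ} (hG : G.PosSemidef) {i : Fin n} (hi : G i i = q) {f : ℝ → ℝ}
    (hf : Continuous f) :
    ∫ x, f (x i) ∂(multivariateGaussian 0 G) = ∫ z, f (√q * z) ∂stdGaussian := by
  have h1 := (measurePreserving_eval_multivariateGaussian (μ := 0) hG (i := i)).map_eq
  have h2 : stdGaussian.map (fun z => √q * z) = gaussianReal 0 q.toNNReal := by
    rw [gaussianReal_map_const_mul]
    congr 1
    · simp
    · ext
      simp [Real.sq_sqrt hq, hq]
  have h3 : ∫ x, f (x i) ∂(multivariateGaussian 0 G) =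
      ∫ y, f y ∂((multivariateGaussian 0 G).map fun x => x i) := by
    rw [integral_map (by fun_prop) hf.aestronglyMeasurable]
  rw [h3, h1, hi]
  simp only [PiLp.zero_apply]
  rw [← h2, integral_map (by fun_prop) hf.aestronglyMeasurable]

instance : Measure.IsOpenPosMeasure stdGaussian :=
  (gaussianReal_absolutelyContinuous' 0 one_ne_zero).isOpenPosMeasure

open scoped MatrixOrder in
/-- Nondegenerate Gaussian measures have full support. -/
theorem eq_zero_of_ae_eq_zero_multivariateGaussian {n : ℕ} {G : Matrix (Fin n) (Fin n) ℝ}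
    (hG : G.PosDef) {f : EuclideanSpace ℝ (Fin n) → ℝ} (hf : Continuous f)
    (h0 : f =ᵐ[multivariateGaussian 0 G] 0) (x : EuclideanSpace ℝ (Fin n)) : f x = 0 := by
  set T := Matrix.toEuclideanCLM (𝕜 := ℝ) (CFC.sqrt G) with hT
  have hsurj : Function.Surjective T := by
    have h1 : T * Matrix.toEuclideanCLM (𝕜 := ℝ) (CFC.sqrt G * G⁻¹) = 1 := by
      rw [hT, ← map_mul, ← mul_assoc, CFC.sqrt_mul_sqrt_self _ hG.posSemidef.nonneg,
        Matrix.mul_nonsing_inv _ ((Matrix.isUnit_iff_isUnit_det _).1 hG.isUnit), map_one]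
    intro y
    exact ⟨_, congrArg (fun A : EuclideanSpace ℝ (Fin n) →L[ℝ] EuclideanSpace ℝ (Fin n) => A y) h1⟩
  obtain ⟨y, rfl⟩ := hsurj x
  let e : (Fin n → ℝ) → EuclideanSpace ℝ (Fin n) := fun v => T (WithLp.toLp 2 v)
  have he : Continuous e := T.continuous.comp (PiLp.continuous_toLp 2 _)
  have hmap : multivariateGaussian 0 G =
      (Measure.pi fun _ : Fin n => gaussianReal 0 1).map e := by
    rw [multivariateGaussian, ← map_pi_eq_stdGaussian,
      Measure.map_map (by fun_prop) (by fun_prop)]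
    congr 1
    ext v
    simp [e, hT]
  rw [hmap] at h0
  have h1 : (fun v => f (e v)) =ᵐ[Measure.pi fun _ : Fin n => gaussianReal 0 1] fun _ => 0 :=
    ae_of_ae_map he.measurable.aemeasurable h0
  have h2 := (Continuous.ae_eq_iff_eq _ (hf.comp he) continuous_const).1 h1
  exact congrFun h2 (WithLp.ofLp y)

/-- The fixed point equation gives the diagonal entries of the L² Gram matrix of √q, Th(x₁), …,
Th(x_n), the definition of ρ₁ its first row, and ρ_{k+1} = ψ(ρ_k) the rest: appending the constant
in front shifts the indices by one. A null vector would yield a linear relation holding for every x,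
and varying one coordinate at a time kills its coefficients. -/
theorem posDef_limGram {β h q : ℝ} (hβ : 0 < β) (hh : 0 < h) (hq : IsFixedPoint β h q) (n : ℕ) :
    (limGram β h q n).PosDef := by
  have hherm : ∀ n, (limGram β h q n).IsHermitian := fun n =>
    Matrix.IsHermitian.ext fun i j => limGram_comm β h q j i
  induction n with
  | zero => exact .of_dotProduct_mulVec_pos (hherm 0) fun x hx => absurd (Subsingleton.elim x 0) hx
  | succ n ih =>
    set G := limGram β h q n with hG
    set ν := multivariateGaussian 0 G
    let f : Fin (n + 1) → EuclideanSpace ℝ (Fin n) → ℝ :=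
      Fin.cons (fun _ => √q) fun i x => Th β h (x i)
    have hf0 : f 0 = fun _ => √q := rfl
    have hfs : ∀ i : Fin n, f i.succ = fun x => Th β h (x i) := fun i => rfl
    have hfc : ∀ i, Continuous (f i) := by
      refine Fin.cases ?_ fun i => ?_
      · exact continuous_const
      · rw [hfs]
        exact (continuous_Th β h).comp (by fun_prop)
    have hfb : ∀ i x, ‖f i x‖ ≤ 1 + √q := by
      have := Real.sqrt_nonneg q
      refine Fin.cases (fun x => ?_) fun i x => ?_
      · rw [hf0, Real.norm_of_nonneg this]
        linarith
      · rw [hfs]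
        have h2 := abs_Th_le β h (x i)
        rw [Real.norm_eq_abs]
        linarith
    have hfi : ∀ i j, Integrable (fun x => f i x * f j x) ν := fun i j => by
      refine .of_bound ((hfc i).mul (hfc j)).aestronglyMeasurable ((1 + √q) * (1 + √q))
        (.of_forall fun x => ?_)
      rw [norm_mul]
      exact mul_le_mul (hfb i x) (hfb j x) (norm_nonneg _) (by positivity)
    have h0s : ∀ j : Fin n, ∫ x, f 0 x * f j.succ x ∂ν = limGram β h q (n + 1) 0 j.succ := by
      intro j
      rw [limGram_of_ne β h q (Fin.succ_ne_zero j).symm, hf0, hfs]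
      have h1 := integral_eval_multivariateGaussian hq.1 ih.posSemidef
        (limGram_self β h q j) (continuous_Th β h)
      rw [integral_const_mul, h1, mul_comm]
      simp [rho]
    have hgram : ∀ i j, ∫ x, f i x * f j x ∂ν = limGram β h q (n + 1) i j := by
      refine Fin.cases (Fin.cases ?_ fun j => ?_) fun i => Fin.cases ?_ fun j => ?_
      · rw [limGram_self, hf0]
        simp [Real.mul_self_sqrt hq.1]
      · exact h0s j
      · rw [limGram_comm, ← h0s i]
        simp only [mul_comm]
      · by_cases hij : i = j
        · subst hij
          rw [limGram_self, hfs]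
          have h1 := integral_eval_multivariateGaussian hq.1 ih.posSemidef
            (limGram_self β h q i) (f := fun y => Th β h y ^ 2) ((continuous_Th β h).pow 2)
          simp only [← pow_two]
          rw [h1]
          conv_rhs => rw [hq.2]
          simp only [Th, mul_assoc]
        · have h1 : limGram β h q (n + 1) i.succ j.succ = psi β h q (limGram β h q n i j) := by
            rw [limGram_of_ne β h q hij,
              limGram_of_ne β h q (fun h => hij (Fin.succ_injective _ h))]
            simp [rho, Nat.succ_min_succ]
          rw [h1]
          refine integral_Th_mul_Th_eq_psi β h ih.posSemidef (limGram_self β h q i)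
            (limGram_self β h q j) rfl (limGram_comm β h q j i) ?_ ?_
          · rw [limGram_of_ne β h q hij]
            exact rho_nonneg hh _
          -- The quadratic form at e_i - e_j is 2q - 2ρ, which gives the bound ρ ≤ q required for ψ.
          · have h2 := ih.posSemidef.dotProduct_mulVec_nonneg
              ((1 : ℝ) • Pi.single i 1 + (-1 : ℝ) • Pi.single j 1)
            rw [star_trivial, dotProduct_mulVec_two, hG, limGram_self, limGram_self,
              limGram_comm β h q j i] at h2
            linarith
    refine .of_dotProduct_mulVec_pos (hherm _) fun c hc => ?_
    have hquad : star c ⬝ᵥ (limGram β h q (n + 1)).mulVec c = ∫ x, (∑ i, c i * f i x) ^ 2 ∂ν := by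
      have h1 : ∀ x, (∑ i, c i * f i x) ^ 2 = ∑ i, ∑ j, c i * c j * (f i x * f j x) := fun x => by
        rw [pow_two, Finset.sum_mul_sum]
        exact Finset.sum_congr rfl fun i _ => Finset.sum_congr rfl fun j _ => by ring
      simp only [h1]
      rw [integral_finsetSum _ fun i _ => integrable_finsetSum _ fun j _ =>
        (hfi i j).const_mul (c i * c j)]
      simp only [star_trivial, dotProduct, Matrix.mulVec, Finset.mul_sum]
      refine Finset.sum_congr rfl fun i _ => ?_
      rw [integral_finsetSum _ fun j _ => (hfi i j).const_mul (c i * c j)]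
      refine Finset.sum_congr rfl fun j _ => ?_
      rw [integral_const_mul, hgram]
      ring
    have hsc : Continuous fun x => ∑ i, c i * f i x :=
      continuous_finsetSum _ fun i _ => continuous_const.mul (hfc i)
    rw [hquad]
    refine (integral_nonneg fun x => sq_nonneg _).lt_of_ne fun h0 => hc ?_
    have hint : Integrable (fun x => (∑ i, c i * f i x) ^ 2) ν := by
      refine .of_bound (hsc.pow 2).aestronglyMeasurable ((∑ i, |c i| * (1 + √q)) ^ 2)
        (.of_forall fun x => ?_)
      rw [norm_pow]
      refine pow_le_pow_left₀ (norm_nonneg _) ((norm_sum_le _ _).trans ?_) 2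
      refine Finset.sum_le_sum fun i _ => ?_
      rw [norm_mul]
      exact mul_le_mul_of_nonneg_left (hfb i x) (abs_nonneg _)
    have h2 := (integral_eq_zero_iff_of_nonneg (fun x => sq_nonneg _) hint).1 h0.symm
    have h3 : ∀ x, (∑ i, c i * f i x) ^ 2 = 0 :=
      eq_zero_of_ae_eq_zero_multivariateGaussian ih (f := fun x => (∑ i, c i * f i x) ^ 2)
        (hsc.pow 2) h2
    have h4 : ∀ x : EuclideanSpace ℝ (Fin n), c 0 * √q + ∑ i : Fin n, c i.succ * Th β h (x i) = 0 := fun x => by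
      have h5 := pow_eq_zero_iff two_ne_zero |>.1 (h3 x)
      rwa [Fin.sum_univ_succ] at h5
    -- Subtract the relation at 0 from the one at the i-th unit vector: only c_{i+1} (Th 1 - Th 0)
    -- remains, and Th is injective.
    have hcs : ∀ i : Fin n, c i.succ = 0 := fun i => by
      have h5 := h4 0
      have h6 := h4 (EuclideanSpace.single i 1)
      rw [Fintype.sum_eq_add_sum_compl i] at h5 h6
      have h7 : ∑ k ∈ {i}ᶜ, c (Fin.succ k) * Th β h
          ((EuclideanSpace.single i 1 : EuclideanSpace ℝ (Fin n)) k) =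
          ∑ k ∈ {i}ᶜ, c (Fin.succ k) * Th β h ((0 : EuclideanSpace ℝ (Fin n)) k) := by
        refine Finset.sum_congr rfl fun k hk => ?_
        have : k ≠ i := by simpa using hk
        simp [this]
      rw [h7] at h6
      have h8 : c i.succ * (Th β h 1 - Th β h 0) = 0 := by
        simp only [PiLp.single_apply, if_true, PiLp.zero_apply] at h5 h6
        linarith
      rcases mul_eq_zero.1 h8 with h9 | h9
      · exact h9
      · exact absurd (Th_injective hβ h (sub_eq_zero.1 h9)) one_ne_zero
    ext i
    refine Fin.cases ?_ hcs i
    have h5 := h4 0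
    simp only [hcs, zero_mul, Finset.sum_const_zero, add_zero] at h5
    exact (mul_eq_zero.1 h5).resolve_right (Real.sqrt_pos.2 (hq.pos hh)).ne'

/-- A positive definite matrix is bounded below. -/
theorem exists_pos_le_of_posDef {n : ℕ} {G : Matrix (Fin n) (Fin n) ℝ} (hG : G.PosDef) :
    ∃ l : ℝ, 0 < l ∧ ∀ a : Fin n → ℝ, l * ∑ k, a k ^ 2 ≤ a ⬝ᵥ G.mulVec a := by
  let Q : EuclideanSpace ℝ (Fin n) → ℝ := fun x => (x : Fin n → ℝ) ⬝ᵥ G.mulVec x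
  have hQ : Continuous Q := by
    simp only [Q, dotProduct, Matrix.mulVec]
    fun_prop
  rcases (Metric.sphere (0 : EuclideanSpace ℝ (Fin n)) 1).eq_empty_or_nonempty with he | hne
  -- The unit sphere is empty only for n = 0, where any constant works.
  · refine ⟨1, one_pos, fun a => ?_⟩
    have : IsEmpty (Fin n) := by
      by_contra hn
      rw [not_isEmpty_iff] at hn
      obtain ⟨i⟩ := hn
      have : EuclideanSpace.single i (1 : ℝ) ∈ Metric.sphere (0 : EuclideanSpace ℝ (Fin n)) 1 := by
        simp
      rw [he] at this
      exact this
    simp [dotProduct]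
  · obtain ⟨x₀, hx₀, hmin⟩ := (isCompact_sphere _ _).exists_isMinOn hne hQ.continuousOn
    have hx₀0 : (x₀ : Fin n → ℝ) ≠ 0 := by
      intro h0
      have : x₀ = 0 := by ext i; exact congrFun h0 i
      rw [this] at hx₀
      simp at hx₀
    refine ⟨Q x₀, hG.dotProduct_mulVec_pos hx₀0, fun a => ?_⟩
    set x : EuclideanSpace ℝ (Fin n) := WithLp.toLp 2 a with hx
    have hsum : ∑ k, a k ^ 2 = ‖x‖ ^ 2 := (EuclideanSpace.real_norm_sq_eq x).symm
    rw [hsum]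
    rcases eq_or_ne x 0 with h0 | h0
    · have ha : a = 0 := by
        ext i
        exact congrArg (fun y : EuclideanSpace ℝ (Fin n) => y i) h0
      rw [h0, ha]
      simp
    · have hnx : 0 < ‖x‖ := norm_pos_iff.2 h0
      have h1 : ‖x‖⁻¹ • x ∈ Metric.sphere (0 : EuclideanSpace ℝ (Fin n)) 1 := by
        simp [norm_smul, hnx.ne']
      have h2 : Q x₀ ≤ Q (‖x‖⁻¹ • x) := hmin h1
      have h3 : Q (‖x‖⁻¹ • x) = (‖x‖ ^ 2)⁻¹ * (a ⬝ᵥ G.mulVec a) := by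
        simp only [Q, WithLp.ofLp_smul, Matrix.mulVec_smul, smul_dotProduct, dotProduct_smul,
          smul_eq_mul, hx]
        ring
      rw [h3, ← div_eq_inv_mul, le_div_iff₀ (by positivity)] at h2
      exact h2

end LimitGram


/-! ### The covariance relations -/

section Gram

variable {N : ℕ}

theorem norm_sum_smul_sq {n : ℕ} (v : Fin n → EuclideanSpace ℝ (Fin N)) (a : Fin n → ℝ)
    (hN : (N : ℝ) ≠ 0) :
    ‖∑ k, a k • v k‖ ^ 2 = N * ∑ i, ∑ j, a i * a j * nInner (v i) (v j) := by
  rw [← real_inner_self_eq_norm_sq, sum_inner, Finset.mul_sum]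
  refine Finset.sum_congr rfl fun i _ => ?_
  rw [inner_sum, Finset.mul_sum]
  refine Finset.sum_congr rfl fun j _ => ?_
  rw [real_inner_smul_left, real_inner_smul_right, PiLp.inner_apply, nInner]
  simp only [RCLike.inner_apply, conj_trivial, mul_comm (v j _)]
  field_simp

theorem nInner_comm (x y : EuclideanSpace ℝ (Fin N)) : nInner x y = nInner y x := by
  simp only [nInner, mul_comm (x _)]

/-- Vectors whose Gram matrix is close to a matrix that is bounded below span a parallelepiped that
is not too thin. -/
theorem gram_lower_bound {n : ℕ} {v : Fin n → EuclideanSpace ℝ (Fin N)}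
    {G : Matrix (Fin n) (Fin n) ℝ} {l ε : ℝ}
    (hG : ∀ a : Fin n → ℝ, 2 * l * ∑ k, a k ^ 2 ≤ a ⬝ᵥ G.mulVec a) (hε0 : 0 ≤ ε) (hε : ε * n ≤ l)
    (hv : ∀ i j, |nInner (v i) (v j) - G i j| ≤ ε) (hN : 1 ≤ N) (a : Fin n → ℝ) :
    N * (l * ∑ k, a k ^ 2) ≤ ‖∑ k, a k • v k‖ ^ 2 := by
  have hN0 : (N : ℝ) ≠ 0 := by positivity
  rw [norm_sum_smul_sq v a hN0]
  refine mul_le_mul_of_nonneg_left ?_ (by positivity)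
  have h1 : ∑ i, ∑ j, a i * a j * nInner (v i) (v j) =
      a ⬝ᵥ G.mulVec a + ∑ i, ∑ j, a i * a j * (nInner (v i) (v j) - G i j) := by
    simp only [dotProduct, Matrix.mulVec, Finset.mul_sum, ← Finset.sum_add_distrib]
    exact Finset.sum_congr rfl fun i _ => Finset.sum_congr rfl fun j _ => by ring
  have h2 : |∑ i, ∑ j, a i * a j * (nInner (v i) (v j) - G i j)| ≤ ε * (∑ i, |a i|) ^ 2 := by
    rw [pow_two, Finset.sum_mul_sum, Finset.mul_sum]
    refine (Finset.abs_sum_le_sum_abs _ _).trans (Finset.sum_le_sum fun i _ => ?_)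
    rw [Finset.mul_sum]
    refine (Finset.abs_sum_le_sum_abs _ _).trans (Finset.sum_le_sum fun j _ => ?_)
    rw [abs_mul, abs_mul, mul_comm]
    exact mul_le_mul_of_nonneg_right (hv i j) (by positivity)
  have h3 : (∑ i, |a i|) ^ 2 ≤ n * ∑ k, a k ^ 2 := by
    have := sq_sum_le_card_mul_sum_sq (s := (Finset.univ : Finset (Fin n))) (f := fun k => |a k|)
    simpa using this
  have h4 : ε * (∑ i, |a i|) ^ 2 ≤ l * ∑ k, a k ^ 2 :=
    calc ε * (∑ i, |a i|) ^ 2 ≤ ε * (n * ∑ k, a k ^ 2) := by gcongr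
      _ = ε * n * ∑ k, a k ^ 2 := by ring
      _ ≤ l * ∑ k, a k ^ 2 :=
        mul_le_mul_of_nonneg_right hε (Finset.sum_nonneg fun k _ => sq_nonneg _)
  have h5 := hG a
  have h6 := (abs_le.1 h2).1
  rw [h1]
  linarith

theorem linearIndependent_of_lower_bound {n : ℕ} {v : Fin n → EuclideanSpace ℝ (Fin N)} {l : ℝ}
    (hl : 0 < l) (hN : 1 ≤ N)
    (hv : ∀ a : Fin n → ℝ, N * (l * ∑ k, a k ^ 2) ≤ ‖∑ k, a k • v k‖ ^ 2) :
    LinearIndependent ℝ v := by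
  rw [Fintype.linearIndependent_iff]
  intro a ha k
  have h1 := hv a
  rw [ha, norm_zero, zero_pow two_ne_zero] at h1
  have hN0 : (0 : ℝ) < N := by exact_mod_cast hN
  have h2 : ∑ k, a k ^ 2 ≤ 0 := by
    by_contra! h3
    have : 0 < N * (l * ∑ k, a k ^ 2) := by positivity
    linarith
  have h3 := Finset.single_le_sum (fun k _ => sq_nonneg (a k)) (Finset.mem_univ k)
  exact pow_eq_zero_iff two_ne_zero |>.1 (le_antisymm (h3.trans h2) (sq_nonneg _))

/-- The expansion, with error bound `K`, of the projections of the coordinate functionals onto the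
space of matrices annihilating `u 1, …, u n`, in terms of the normalized components of these
vectors. -/
def HasCovExpansion (n : ℕ) (u : ℕ → EuclideanSpace ℝ (Fin N)) (K : ℝ) : Prop :=
  ∀ i j : Fin N, i ≠ j →
    (N : ℝ) ^ 2 * |(N : ℝ)⁻¹ * toMat ((annih n u).starProjection (entryVec i j)) i j -
      1 / (N : ℝ)| < K ∧
    (∀ t, t ≠ i → t ≠ j →
      (N : ℝ) ^ 3 * |(N : ℝ)⁻¹ * toMat ((annih n u).starProjection (entryVec i j)) j t -
        (-∑ m ∈ Finset.Ico 1 (n + 1), normComp u m i * normComp u m t / (N : ℝ) ^ 2)| < K) ∧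
    ∀ s t, s ≠ t → s ≠ i → s ≠ j → t ≠ i → t ≠ j →
      (N : ℝ) ^ 4 * |(N : ℝ)⁻¹ * toMat ((annih n u).starProjection (entryVec i j)) s t -
        ((∑ m ∈ Finset.Ico 1 (n + 1), normComp u m i * normComp u m s) *
            (∑ m ∈ Finset.Ico 1 (n + 1), normComp u m j * normComp u m t) +
          (∑ m ∈ Finset.Ico 1 (n + 1), normComp u m i * normComp u m t) *
            ∑ m ∈ Finset.Ico 1 (n + 1), normComp u m j * normComp u m s) / (N : ℝ) ^ 3| < K

/-- The deterministic core: K and N₀ depend only on n, l and b, so the same error constant serves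
all large N and all indices. The lower Gram bound both bounds R by c / N and makes the vectors
independent, so that R is N⁻¹ ∑ φ φᵀ without degenerate terms. -/
theorem exists_hasCovExpansion {n : ℕ} {l b : ℝ} (hl : 0 < l) :
    ∃ (K : ℝ) (N₀ : ℕ), 0 < K ∧ ∀ N : ℕ, N₀ ≤ N → 1 ≤ N → ∀ u : ℕ → EuclideanSpace ℝ (Fin N),
      (∀ k i, |u k i| ≤ b) →
      (∀ a : Fin n → ℝ, N * (l * ∑ k, a k ^ 2) ≤ ‖∑ k, a k • u (k + 1)‖ ^ 2) →
      HasCovExpansion n u K := by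
  set c : ℝ := max 1 (n * b ^ 2 / l) with hcdef
  have hc : 1 ≤ c := le_max_left _ _
  set K₀ : ℝ := 68 + 2 * (4 * (13 + 4 * c) + 8 + c * (13 + 4 * c)) with hK₀
  have hK₀0 : 0 < K₀ := by positivity
  obtain ⟨N₀, hN₀⟩ := exists_nat_ge (2 * c * (3 + c))
  -- After scaling, the three errors are at most K₀ c, K₀ c² and K₀ c³, and c ≥ 1. The extra 1 makes
  -- the inequalities strict, because the exceptional event of `ErrBound` includes equality.
  refine ⟨K₀ * c ^ 3 + 1, N₀, by positivity, fun N hN hN1 u hb hu i j hij => ?_⟩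
  have hN0 : (0 : ℝ) < N := by exact_mod_cast hN1
  have hli := linearIndependent_of_lower_bound (v := fun k : Fin n => u (k + 1)) hl hN1 hu
  have hne : ∀ m, 1 ≤ m → m ≤ n → orthComp u m ≠ 0 := fun m => orthComp_ne_zero hli
  have hRc : ∀ i j, |spanProj n u i j| ≤ c / N := fun i j =>
    (abs_spanProj_le hl (fun k _ _ => hb k) hu i j).trans
      (div_le_div_of_nonneg_right (le_max_right _ _) hN0.le)
  have hR : ∀ i j, spanProj n u i j =
      (∑ m ∈ Finset.Ico 1 (n + 1), normComp u m i * normComp u m j) / N := fun i j => by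
    rw [spanProj_eq_sum hne, Finset.sum_div]
  obtain ⟨h1, h2, h3⟩ := starProjection_annih_expansion (spanProj_symm n u) (spanProj_row_mem n u)
    (fun k hk hkn i => sum_spanProj_mul (Submodule.subset_span ⟨k, ⟨hk, hkn⟩, rfl⟩) i) hc
    (hN₀.trans (by exact_mod_cast hN)) hRc hij hK₀
  have hc1 : K₀ * c ≤ K₀ * c ^ 3 := mul_le_mul_of_nonneg_left (le_self_pow₀ hc three_ne_zero) hK₀0.le
  have hc2 : K₀ * c ^ 2 ≤ K₀ * c ^ 3 :=
    mul_le_mul_of_nonneg_left (pow_le_pow_right₀ hc (by norm_num)) hK₀0.le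
  refine ⟨?_, fun t hti htj => ?_, fun s t hst hsi hsj hti htj => ?_⟩
  · calc (N : ℝ) ^ 2 * |(N : ℝ)⁻¹ * toMat ((annih n u).starProjection (entryVec i j)) i j -
          1 / (N : ℝ)|
        = N * |toMat ((annih n u).starProjection (entryVec i j)) i j - 1| := by
          rw [one_div, ← mul_sub_one, abs_mul, abs_of_pos (inv_pos.2 hN0)]
          field_simp
      _ ≤ N * (K₀ * (c / N)) := mul_le_mul_of_nonneg_left h1 hN0.le
      _ = K₀ * c := by field_simp
      _ < K₀ * c ^ 3 + 1 := by linarith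
  · have h4 := h2 t hti htj
    have h5 : (N : ℝ)⁻¹ * toMat ((annih n u).starProjection (entryVec i j)) j t -
        (-∑ m ∈ Finset.Ico 1 (n + 1), normComp u m i * normComp u m t / (N : ℝ) ^ 2) =
        (N : ℝ)⁻¹ * (toMat ((annih n u).starProjection (entryVec i j)) j t + spanProj n u i t) := by
      rw [hR, ← Finset.sum_div]
      field_simp
      ring
    rw [h5, abs_mul, abs_of_pos (inv_pos.2 hN0)]
    calc _ = (N : ℝ) ^ 2 * |toMat ((annih n u).starProjection (entryVec i j)) j t +
            spanProj n u i t| := by field_simp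
      _ ≤ (N : ℝ) ^ 2 * (K₀ * (c / N) ^ 2) := mul_le_mul_of_nonneg_left h4 (by positivity)
      _ = K₀ * c ^ 2 := by field_simp
      _ < K₀ * c ^ 3 + 1 := by linarith
  · have h4 := h3 s t hst hsi hsj hti htj
    have h5 : (N : ℝ)⁻¹ * toMat ((annih n u).starProjection (entryVec i j)) s t -
        ((∑ m ∈ Finset.Ico 1 (n + 1), normComp u m i * normComp u m s) *
            (∑ m ∈ Finset.Ico 1 (n + 1), normComp u m j * normComp u m t) +
          (∑ m ∈ Finset.Ico 1 (n + 1), normComp u m i * normComp u m t) *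
            ∑ m ∈ Finset.Ico 1 (n + 1), normComp u m j * normComp u m s) / (N : ℝ) ^ 3 =
        (N : ℝ)⁻¹ * (toMat ((annih n u).starProjection (entryVec i j)) s t -
          (spanProj n u s i * spanProj n u j t + spanProj n u s j * spanProj n u i t)) := by
      rw [spanProj_symm n u s i, spanProj_symm n u s j, hR, hR, hR, hR]
      field_simp
    rw [h5, abs_mul, abs_of_pos (inv_pos.2 hN0)]
    calc _ = (N : ℝ) ^ 3 * |toMat ((annih n u).starProjection (entryVec i j)) s t -
          (spanProj n u s i * spanProj n u j t + spanProj n u s j * spanProj n u i t)| := by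
          field_simp
      _ ≤ (N : ℝ) ^ 3 * (K₀ * (c / N) ^ 3) := mul_le_mul_of_nonneg_left h4 (by positivity)
      _ = K₀ * c ^ 3 := by field_simp
      _ < K₀ * c ^ 3 + 1 := by linarith

end Gram

/-! ### Exponentially small exceptional events -/

section Exceptional

variable {Ω : Type*} {mΩ : MeasurableSpace Ω} {μ : Measure Ω}

/-- The probability of `E N` is exponentially small in `N`. -/
def ExpSmall (μ : Measure Ω) (E : ℕ → Set Ω) : Prop :=
  ∃ C : ℝ, 0 < C ∧ ∀ N : ℕ, 1 ≤ N → μ.real (E N) ≤ C * Real.exp (-((N : ℝ) / C))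

theorem mul_exp_neg_div_le {C C' x : ℝ} (hC : 0 < C) (h : C ≤ C') (hx : 0 ≤ x) :
    C * Real.exp (-(x / C)) ≤ C' * Real.exp (-(x / C')) := by
  have h1 : x / C' ≤ x / C := div_le_div_of_nonneg_left hx hC h
  exact mul_le_mul h (Real.exp_le_exp.2 (by linarith)) (Real.exp_pos _).le (hC.le.trans h)

theorem ExpSmall.mono {E E' : ℕ → Set Ω} [IsFiniteMeasure μ] (h : ExpSmall μ E)
    (hE : ∀ N, 1 ≤ N → E' N ⊆ E N) : ExpSmall μ E' := by
  obtain ⟨C, hC, h⟩ := h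
  exact ⟨C, hC, fun N hN => (measureReal_mono (hE N hN)).trans (h N hN)⟩

theorem ExpSmall.iUnion {ι : Type*} [Fintype ι] {E : ι → ℕ → Set Ω} (h : ∀ i, ExpSmall μ (E i)) :
    ExpSmall μ fun N => ⋃ i, E i N := by
  choose C hC h using h
  have hle : ∀ i, C i ≤ 1 + ∑ i, C i := fun i => by
    have := Finset.single_le_sum (fun i _ => (hC i).le) (Finset.mem_univ i)
    linarith
  have hpos : 0 < 1 + ∑ i, C i := by
    have := Finset.sum_nonneg fun i (_ : i ∈ Finset.univ) => (hC i).le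
    linarith
  refine ⟨1 + ∑ i, C i, hpos, fun N hN => ?_⟩
  calc μ.real (⋃ i, E i N) ≤ ∑ i, μ.real (E i N) := measureReal_iUnion_fintype_le _
    _ ≤ ∑ i, C i * Real.exp (-((N : ℝ) / (1 + ∑ i, C i))) := by
        refine Finset.sum_le_sum fun i _ => (h i N hN).trans ?_
        refine mul_le_mul_of_nonneg_left (Real.exp_le_exp.2 (neg_le_neg ?_)) (hC i).le
        exact div_le_div_of_nonneg_left N.cast_nonneg (hC i) (hle i)
    _ ≤ (1 + ∑ i, C i) * Real.exp (-((N : ℝ) / (1 + ∑ i, C i))) := by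
        rw [← Finset.sum_mul]
        exact mul_le_mul_of_nonneg_right (by linarith) (Real.exp_pos _).le

/-- Finitely many indices do not matter. -/
theorem ExpSmall.of_eventually [IsProbabilityMeasure μ] {E : ℕ → Set Ω} (h : ExpSmall μ E)
    (N₀ : ℕ) : ExpSmall μ fun N => {ω | N₀ ≤ N → ω ∈ E N} := by
  obtain ⟨C, hC, h⟩ := h
  -- For N < N₀ the exponent is at least -1 thanks to N₀ in the constant, and the summand e brings
  -- the bound up to 1, so it is trivially true.
  refine ⟨C + N₀ + Real.exp 1, by positivity, fun N hN => ?_⟩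
  by_cases hN₀ : N₀ ≤ N
  · simp only [hN₀, true_imp_iff, Set.ofPred_mem_eq]
    refine (h N hN).trans (mul_exp_neg_div_le hC ?_ N.cast_nonneg)
    have := Real.exp_pos 1
    have : (0 : ℝ) ≤ N₀ := N₀.cast_nonneg
    linarith
  · have h1 : (N : ℝ) / (C + N₀ + Real.exp 1) ≤ 1 := by
      rw [div_le_one (by positivity)]
      have : (N : ℝ) ≤ N₀ := by exact_mod_cast (not_le.1 hN₀).le
      have := Real.exp_pos 1
      linarith
    calc μ.real _ ≤ 1 := measureReal_le_one
      _ = Real.exp 1 * Real.exp (-1) := by rw [← Real.exp_add]; simp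
      _ ≤ _ := by
        refine mul_le_mul ?_ (Real.exp_le_exp.2 (by linarith)) (Real.exp_pos _).le (by positivity)
        have : (0 : ℝ) ≤ N₀ := N₀.cast_nonneg
        linarith

theorem SimEq.expSmall {X Y : ℕ → Ω → ℝ} (h : SimEq μ X Y) {t : ℝ} (ht : 0 < t) (ht1 : t ≤ 1) :
    ExpSmall μ fun N => {ω | t ≤ |X N ω - Y N ω|} := by
  obtain ⟨C, hC, h⟩ := h
  have ht2 : t ^ 2 ≤ 1 := pow_le_one₀ ht.le ht1
  -- Dividing by t² reproduces the exponent exactly, and t ≤ 1 means that the prefactor only grows.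
  refine ⟨C / t ^ 2, by positivity, fun N hN => (h N hN t ht ht1).trans ?_⟩
  have h1 : C ≤ C / t ^ 2 := (le_div_iff₀ (by positivity)).2 (by nlinarith)
  have h2 : (N : ℝ) / (C / t ^ 2) = t ^ 2 * N / C := by field_simp
  rw [h2]
  exact mul_le_mul_of_nonneg_right h1 (Real.exp_pos _).le

theorem Cond.expSmall [IsFiniteMeasure μ] {β h q : ℝ} {g : (N : ℕ) → Ω → Matrix (Fin N) (Fin N) ℝ}
    {J : ℕ} (hc : Cond μ β h q g J) {t : ℝ} (ht : 0 < t) (ht1 : t ≤ 1) :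
    ExpSmall μ fun N => ⋃ p : Fin J × Fin J, {ω | t ≤ |nInner (mIter β h q (g N ω) (p.1 + 1))
      (mIter β h q (g N ω) (p.2 + 1)) - limGram β h q J p.1 p.2|} := by
  have hlt : ∀ i j : Fin J, i < j → ExpSmall μ fun N => {ω | t ≤ |nInner
      (mIter β h q (g N ω) (i + 1)) (mIter β h q (g N ω) (j + 1)) - limGram β h q J i j|} := by
    intro i j hij
    have h1 := ((hc (j + 1) (by omega) (by omega)).2 (i + 1) (by omega)
      (by simpa using hij)).expSmall ht ht1
    rw [limGram_of_ne β h q hij.ne]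
    have : min (i : ℕ) j = i := min_eq_left (by exact_mod_cast hij.le)
    simpa only [this] using h1
  refine ExpSmall.iUnion fun p => ?_
  obtain ⟨i, j⟩ := p
  rcases lt_trichotomy i j with hij | rfl | hij
  · exact hlt i j hij
  · have h1 := (hc (i + 1) (by omega) (by omega)).1.expSmall ht ht1
    simp only [limGram_self]
    refine h1.mono fun N _ ω hω => ?_
    simpa only [Set.mem_ofPred_eq, nNorm_sq, nInner_self] using hω
  · simpa only [nInner_comm, limGram_comm] using hlt j i hij

end Exceptional

/-! ### Transfer of the deterministic expansion to the conditional covariances -/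

section Relations

variable {Ω : Type*} {mΩ : MeasurableSpace Ω} {μ : Measure Ω} [IsProbabilityMeasure μ]
  {β h q : ℝ} {g : (N : ℕ) → Ω → Matrix (Fin N) (Fin N) ℝ}

/-- One exceptional event serves all three relations and all indices: off it the Gram matrix of the
iterates is within t of its positive definite limit, and everything else is deterministic. -/
theorem Cond.exists_expSmall_not_hasCovExpansion (hβ : 0 < β) (hh : 0 < h)
    (hq : IsFixedPoint β h q) {J : ℕ} (hc : Cond μ β h q g J) :
    ∃ K : ℝ, 0 < K ∧ ExpSmall μ fun N => {ω | ¬HasCovExpansion J (mIter β h q (g N ω)) K} := by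
  obtain ⟨l₀, hl₀, hG⟩ := exists_pos_le_of_posDef (posDef_limGram hβ hh hq J)
  set l := l₀ / 2 with hl
  have hlpos : 0 < l := by positivity
  obtain ⟨K, N₀, hK, hexp⟩ := exists_hasCovExpansion (n := J) (b := 1 + √q) hlpos
  -- The perturbation t·J must stay below half of the spectral bound l₀, and `SimEq` only controls
  -- deviations of size at most 1.
  set t := min 1 (l / (J + 1)) with ht
  have ht0 : 0 < t := lt_min one_pos (by positivity)
  have htJ : t * J ≤ l := by
    calc t * J ≤ l / (J + 1) * (J + 1) := by
          refine mul_le_mul (min_le_right _ _) (by linarith) J.cast_nonneg (by positivity)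
      _ = l := by field_simp
  refine ⟨K, hK, ((hc.expSmall ht0 (min_le_left _ _)).of_eventually N₀).mono
    fun N hN ω hω hN₀ => ?_⟩
  by_contra hbad
  simp only [Set.mem_iUnion, Set.mem_ofPred_eq, not_exists, not_le] at hbad
  refine hω (hexp N hN₀ hN _ (fun k i => abs_mIter_le β h q (g N ω) k i) ?_)
  refine gram_lower_bound (v := fun k : Fin J => mIter β h q (g N ω) (k + 1))
    (G := limGram β h q J) (fun a => ?_) ht0.le htJ (fun i j => (hbad (i, j)).le) hN
  rw [hl, mul_div_cancel₀ _ two_ne_zero]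
  exact hG a

theorem IsInteraction.aemeas_phi {N : ℕ} {g : Ω → Matrix (Fin N) (Fin N) ℝ}
    (hg : IsInteraction μ g) (hq : 0 < q) {n m : ℕ} (h1 : 1 ≤ m) (hm : m ≤ n + 1) (i : Fin N) :
    AEMeas (Fil μ β h q g n) μ fun ω => phi β h q (g ω) m i := by
  have h2 : AEMeas (Fil μ β h q g n) μ fun ω (j : ℕ) =>
      if 1 ≤ j ∧ j ≤ m then mIter β h q (g ω) j else 0 := by
    refine AEMeas.pi fun j => ?_
    by_cases hj : 1 ≤ j ∧ j ≤ m
    · simpa only [hj, and_self, if_true] using hg.aemeas_mIter hq hj.1 (hj.2.trans hm)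
    · simpa only [hj, if_false] using AEMeas.of_measurable measurable_const
  have h3 := (h2.comp (measurable_normComp m)).comp
    (by fun_prop : Measurable fun y : EuclideanSpace ℝ (Fin N) => y i)
  refine h3.congr (.of_forall fun ω => ?_)
  simp only [phi_eq]
  rw [normComp_congr (v := fun j => if 1 ≤ j ∧ j ≤ m then mIter β h q (g ω) j else 0) h1
    fun j hj hjm => (if_pos ⟨hj, hjm⟩).symm]

omit [IsProbabilityMeasure μ] in
theorem AEMeas.finset_sum {F : MeasurableSpace Ω} {ι : Type*} {s : Finset ι} {f : ι → Ω → ℝ}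
    (hf : ∀ i ∈ s, AEMeas F μ (f i)) : AEMeas F μ fun ω => ∑ i ∈ s, f i ω := by
  simp only [← Finset.sum_coe_sort s]
  exact AEMeas.sum fun i => hf i i.2

/-- The expansion is known for the explicit formula Y, while the relation concerns a version X of a
conditional expectation; the almost sure identity affects the exceptional event only by a null set.
-/
theorem errBound_of_expSmall {N r : ℕ} {F : MeasurableSpace Ω} {C K : ℝ} {X Y : Ω → ℝ}
    {E : Set Ω} (hX : AEStronglyMeasurable[F] X μ) (hE : μ.real E ≤ C * Real.exp (-((N : ℝ) / C)))
    (hXY : X =ᵐ[μ] Y) (hY : ∀ ω, ω ∉ E → (N : ℝ) ^ r * |Y ω| < K) : ErrBound μ F N r C K X := by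
  refine ⟨hX, le_trans (ENNReal.toReal_mono (measure_ne_top _ _) (measure_mono_ae ?_)) hE⟩
  filter_upwards [hXY] with ω hω hKω
  by_contra hωE
  have h1 : K ≤ (N : ℝ) ^ r * |X ω| := hKω
  rw [hω] at h1
  exact absurd (hY ω hωE) h1.not_gt

/-- The coefficients of the limiting fourth order covariances. -/
def pairing (a b c d : ℕ) : ℝ :=
  (if a = c ∧ b = d then 1 else 0) + if a = d ∧ b = c then 1 else 0

theorem alphaPoly_pairing (β h q : ℝ) {N : ℕ} (A : Matrix (Fin N) (Fin N) ℝ) (k : ℕ)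
    (i j s t : Fin N) :
    alphaPoly β h q A k pairing i j s t =
      (∑ m ∈ Finset.Ico 1 k, phi β h q A m i * phi β h q A m s) *
          (∑ m ∈ Finset.Ico 1 k, phi β h q A m j * phi β h q A m t) +
        (∑ m ∈ Finset.Ico 1 k, phi β h q A m i * phi β h q A m t) *
          ∑ m ∈ Finset.Ico 1 k, phi β h q A m j * phi β h q A m s := by
  rw [alphaPoly, Finset.sum_mul_sum, Finset.sum_mul_sum, ← Finset.sum_add_distrib]
  refine Finset.sum_congr rfl fun a ha => ?_
  rw [← Finset.sum_add_distrib]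
  refine Finset.sum_congr rfl fun b hb => ?_
  simp only [pairing, add_mul, Finset.sum_add_distrib, ite_and, ite_mul, zero_mul, one_mul,
    Finset.sum_ite_eq, ha, hb, if_true]
  -- What is left is the pairing c = a, d = b, with a still to be selected in the sum over c; the
  -- other pairing has already collapsed.
  rw [Finset.sum_eq_single_of_mem a ha fun c _ hc => by simp [hc.symm]]
  simp only [if_true, Finset.sum_ite_eq, hb]
  ring

omit [IsProbabilityMeasure μ] in
theorem aestronglyMeasurable_condCov (N k : ℕ) (i j s t : Fin N) :
    AEStronglyMeasurable[Fil μ β h q (g N) (k - 2)] (condCov μ β h q (g N) k i j s t) μ :=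
  stronglyMeasurable_condExp.aestronglyMeasurable

/-- At level n + 2 the conditioning is on F_n, which determines the iterates up to n + 1 and thus
every φ⁽ᵐ⁾ in the main terms; this yields the measurability required of the errors. Their size comes
from the exact covariance formula together with the deterministic expansion. -/
theorem Cond.gaussMain (hβ : 0 < β) (hh : 0 < h) (hq : IsFixedPoint β h q)
    (hg : ∀ N, IsInteraction μ (g N)) {n : ℕ} (hc : Cond μ β h q g (n + 1)) :
    GaussMain1 μ β h q g (n + 2) ∧ GaussMain2 μ β h q g (n + 2) ∧
      GaussMain3 μ β h q g (n + 2) := by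
  obtain ⟨K, hK, C, hC, hE⟩ := hc.exists_expSmall_not_hasCovExpansion hβ hh hq
  have hq0 := hq.pos hh
  have hphi : ∀ N m (i : Fin N), m ∈ Finset.Ico 1 (n + 2) →
      AEMeas (Fil μ β h q (g N) n) μ fun ω => phi β h q (g N ω) m i := fun N m i hm => by
    rw [Finset.mem_Ico] at hm
    exact (hg N).aemeas_phi hq0 hm.1 (by omega) i
  refine ⟨⟨C, K, hC, hK, fun N hN i j hij => ?_⟩, ⟨C, K, hC, hK, fun N hN i j t hij hti htj => ?_⟩,
    pairing, fun a b c d => ?_, C, K, hC, hK, fun N hN i j s t hij hst hsi hsj hti htj => ?_⟩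
  · refine errBound_of_expSmall
      ((aestronglyMeasurable_condCov N (n + 2) i j i j).sub aestronglyMeasurable_const) (hE N hN)
      (((hg N).condCov_ae_eq hq0 n i j i j).sub .rfl) fun ω hω => ?_
    exact ((not_not.1 hω) i j hij).1
  · refine errBound_of_expSmall
      ((aestronglyMeasurable_condCov N (n + 2) i j j t).sub ?_) (hE N hN)
      (((hg N).condCov_ae_eq hq0 n i j j t).sub .rfl) fun ω hω => ?_
    · have h1 := AEMeas.finset_sum fun m hm => (hphi N m i hm).mul (hphi N m t hm)
      exact (h1.comp (by fun_prop : Measurable fun y : ℝ => -(y / (N : ℝ) ^ 2))).congr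
        (.of_forall fun ω => by simp only [Finset.sum_div]) |>.aestronglyMeasurable
    · exact ((not_not.1 hω) i j hij).2.1 t hti htj
  · simp only [pairing]
    refine ⟨?_, ?_, ?_⟩
    · simp only [and_comm, add_comm]
    · exact add_comm _ _
    · simp only [and_comm, eq_comm]
  · refine errBound_of_expSmall
      ((aestronglyMeasurable_condCov N (n + 2) i j s t).sub ?_) (hE N hN)
      (((hg N).condCov_ae_eq hq0 n i j s t).sub .rfl) fun ω hω => ?_
    · have h1 : AEMeas (Fil μ β h q (g N) n) μ fun ω =>
          alphaPoly β h q (g N ω) (n + 2) pairing i j s t :=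
        .finset_sum fun a ha => .finset_sum fun b hb => .finset_sum fun c hc => .finset_sum fun d hd =>
          ((((hphi N a i ha).mul (hphi N b j hb)).mul (hphi N c s hc)).mul (hphi N d t hd)).comp
            (measurable_const_mul _)
      exact (h1.comp (measurable_id.div_const _)).aestronglyMeasurable
    · have h1 := ((not_not.1 hω) i j hij).2.2 s t hst hsi hsj hti htj
      simp only [Pi.sub_apply, alphaPoly_pairing]
      exact h1

end Relations

end

end TAP

theorem mainTheorem4 {Ω : Type*} [MeasurableSpace Ω] (μ : Measure Ω) [IsProbabilityMeasure μ]
    (β h q : ℝ) (hβ : 0 < β) (hh : 0 < h) (hq : TAP.IsFixedPoint β h q)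
    (g : (N : ℕ) → Ω → Matrix (Fin N) (Fin N) ℝ)
    (hg : ∀ N, TAP.IsInteraction μ (g N))
    (J : ℕ) (hJ : 1 ≤ J)
    (hcond : TAP.Cond μ β h q g J)
    (h1 : ∀ k, 1 ≤ k → k ≤ J → TAP.GaussMain1 μ β h q g k)
    (h2 : ∀ k, 1 ≤ k → k ≤ J → TAP.GaussMain2 μ β h q g k)
    (h3 : ∀ k, 1 ≤ k → k ≤ J → TAP.GaussMain3 μ β h q g k) :
    (∀ N (i j : Fin N), MemLp (fun ω => TAP.gMod μ β h q (g N) (J + 1) ω i j) 2 μ) ∧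
    TAP.GaussMain1 μ β h q g (J + 1) ∧
    TAP.GaussMain2 μ β h q g (J + 1) ∧
    TAP.GaussMain3 μ β h q g (J + 1) := by
  -- With J = n + 1, the truncated subtraction in F_{J+1-2} becomes F_n.
  obtain ⟨n, rfl⟩ := Nat.exists_eq_add_of_le' hJ
  exact ⟨fun N i j => (hg N).memLp_gMod (hq.pos hh) (n + 1) i j,
    hcond.gaussMain hβ hh hq hg⟩
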